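/- **Setting.** Let $N\ge 0$ be an integer, $\eta\in\mathbb C\setminus\{0\}$ and $\xi_1,\dots,\xi_N\in\mathbb C$. On $\mathbb C^2\otimes\mathbb C^2$ let $R(\lambda)=\lambda\,\mathrm{Id}+\eta\,\mathcal P$, where $\mathcal P$ is the flip. Put $$K(\lambda;\zeta,\kappa,\tau)=\frac1\zeta\begin{pmatrix}\zeta+\lambda & 2\kappa e^{\tau}\lambda\\ 2\kappa e^{-\tau}\lambda & \zeta-\lambda\end{pmatrix},\qquad K_\pm(\lambda)=K(\lambda\pm\eta/2;\zeta_\pm,\kappa_\pm,\tau_\pm),$$ $$M_0(\lambda)=R_{0N}(\lambda-\xi_N-\tfrac\eta2)\cdots R_{01}(\lambda-\xi_1-\tfrac\eta2),\qquad \hat M_0(\lambda)=(-1)^N\sigma^y_0\,M_0^{t_0}(-\lambda)\,\sigma^y_0 ,$$ where $0$ labels an auxiliary copy of $\mathbb C^2$. The transfer matrix of the open XXX spin-$1/2$ chain is $$\mathcal T(\lambda\,|\,\zeta_\pm,\kappa_\pm,\tau_\pm)=\operatorname{tr}_0\{K_+(\lambda)M_0(\lambda)K_-(\lambda)\hat M_0(\lambda)\}\in\operatorname{End}\big((\mathbb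 C^2)^{\otimes N}\big).$$ Boundary parameters are six complex numbers $\zeta_\pm,\kappa_\pm,\tau_\pm$ with $\zeta_\pm\ne0$ and $1+4\kappa_\pm^2\neq0$. With $\sqrt{1+4\kappa_\pm^2}$ the principal square roots and $\epsilon_\pm\in\{1,-1\}$, put $$c=\frac{1+4\kappa_+\kappa_-\cosh(\tau_+-\tau_-)}{\zeta_+\zeta_-}=\tfrac12 t_{N+1},\qquad \bar\zeta_\pm=\epsilon_\pm\frac{\zeta_\pm}{\sqrt{1+4\kappa_\pm^2}},\qquad \bar\zeta_\pm^2=\frac{\zeta_\pm^2}{1+4\kappa_\pm^2},$$ $$\omega_\epsilon(\kappa_\pm,\tau_\pm)=1+4\kappa_+\kappa_-\cosh(\tau_+-\tau_-)-\epsilon\sqrt{1+4\kappa_+^2}\,\sqrt{1+4\kappa_-^2}\qquad(\epsilon=\pm1).$$ The inhomogeneities are called generic if $\xi_j,\ \xi_j\pm\xi_k\notin\{0,\eta,-\eta\}$ for all $j\ne k$. The spectrum of $\mathcal T$ is called simple if for some $\lambda$ the matrix $\mathcal T(\lambda)$ has $2^N$ distinct eigenvalues. Two transfer matrices are called similar if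 $\mathcal T_1(\lambda)=\Gamma^{-1}\mathcal T_2(\lambda)\Gamma$ for all $\lambda$, with one invertible $\Gamma$ not depending on $\lambda$. **Corollary.** Let $\xi_1,\dots,\xi_N$ be generic. 1. For almost any choice of the boundary parameters the spectrum is simple: there is a nonzero polynomial $P$ in three variables such that $\mathcal T(\lambda|\zeta_\pm,\kappa_\pm,\tau_\pm)$ has simple spectrum whenever $P(c,\bar\zeta_+^2,\bar\zeta_-^2)\neq0$. 2. Let $(\zeta_{1,\pm},\kappa_{1,\pm},\tau_{1,\pm})$ and $(\zeta_{2,\pm},\kappa_{2,\pm},\tau_{2,\pm})$ be two sets of boundary parameters such that $$\frac{1+4\kappa_{1,+}\kappa_{1,-}\cosh(\tau_{1,+}-\tau_{1,-})}{\zeta_{1,+}\zeta_{1,-}}=\frac{1+4\kappa_{2,+}\kappa_{2,-}\cosh(\tau_{2,+}-\tau_{2,-})}{\zeta_{2,+}\zeta_{2,-}}$$ and, for one of the two signs $\epsilon=\pm$, $\bar\zeta_{1,\pm}^2=\bar\zeta_{2,\pm\epsilon}^2$. Then for every $\lambda$ the two transfer matrices have the same eigenvalues with the same algebraic multiplicities;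 and if the spectrum of the first (equivalently, of the second) is simple, they are similar. 3. Let the boundary parameters and the signs $\epsilon_\pm$ satisfy $\omega_{\epsilon_+\epsilon_-}(\kappa_\pm,\tau_\pm)=0$. Then for every $\lambda$ the matrices $\mathcal T(\lambda|\zeta_\pm,\kappa_\pm,\tau_\pm)$ and $\mathcal T(\lambda|\bar\zeta_\pm,0,0)$, the latter with diagonal boundary matrices, have the same eigenvalues with the same algebraic multiplicities; and if their spectrum is simple, they are similar. 4. The simplicity in 3 holds for almost any choice: given $N$ and $\eta$, there is a nonzero polynomial $Q$ in $N+2$ variables such that, for all generic $\xi$, all boundary parameters and all signs with $\omega_{\epsilon_+\epsilon_-}(\kappa_\pm,\tau_\pm)=0$ and $Q(\xi_1,\dots,\xi_N,\bar\zeta_+,\bar\zeta_-)\ne0$, the spectrum of $\mathcal T(\lambda|\zeta_\pm,\kappa_\pm,\tau_\pm)$ is simple. -/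

import Mathlib

namespace OpenXXX

open Matrix

/-! The open XXX spin-1/2 chain with `N` sites. The quantum space is the `N`-fold tensor power of
`ℂ²`; its canonical basis is indexed by spin configurations `Fin N → Fin 2`, and operators are
written as matrices in this basis. The auxiliary space with label `0` is the first factor of
`Fin 2 × (Fin N → Fin 2)`. -/

/-- Spin configurations, i.e. the canonical basis of the quantum space. -/
abbrev Conf (N : ℕ) : Type := Fin N → Fin 2

/-- The six-vertex `R`-matrix on `ℂ² ⊗ ℂ²`, with the basis ordered as `00, 01, 10, 11`. -/
def RMat (η z : ℂ) : Matrix (Fin 2 × Fin 2) (Fin 2 × Fin 2) ℂ :=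
  (!![z + η, 0, 0, 0;
      0, z, η, 0;
      0, η, z, 0;
      0, 0, 0, z + η]).submatrix finProdFinEquiv finProdFinEquiv

/-- An operator on `ℂ² ⊗ ℂ²` acting on the auxiliary space and on the site `n`, and as the identity
on all other sites. -/
def actAt {N : ℕ} (n : Fin N) (X : Matrix (Fin 2 × Fin 2) (Fin 2 × Fin 2) ℂ) :
    Matrix (Fin 2 × Conf N) (Fin 2 × Conf N) ℂ :=
  Matrix.of fun p q =>
    if ∀ m, m ≠ n → p.2 m = q.2 m then X (p.1, p.2 n) (q.1, q.2 n) else 0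

/-- A matrix acting on the auxiliary space only. -/
def onAux (N : ℕ) (X : Matrix (Fin 2) (Fin 2) ℂ) :
    Matrix (Fin 2 × Conf N) (Fin 2 × Conf N) ℂ :=
  Matrix.kronecker X (1 : Matrix (Conf N) (Conf N) ℂ)

/-- Transposition with respect to the auxiliary space. -/
def auxTranspose {N : ℕ} (X : Matrix (Fin 2 × Conf N) (Fin 2 × Conf N) ℂ) :
    Matrix (Fin 2 × Conf N) (Fin 2 × Conf N) ℂ :=
  Matrix.of fun p q => X (q.1, p.2) (p.1, q.2)

/-- Trace over the auxiliary space. -/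
def auxTrace {N : ℕ} (X : Matrix (Fin 2 × Conf N) (Fin 2 × Conf N) ℂ) :
    Matrix (Conf N) (Conf N) ℂ :=
  Matrix.of fun s t => ∑ a : Fin 2, X (a, s) (a, t)

/-- The Pauli matrix `σʸ`. -/
def sigmaY : Matrix (Fin 2) (Fin 2) ℂ := !![0, -Complex.I; Complex.I, 0]

/-- The bulk monodromy matrix
`M₀(z) = R_{0N}(z - ξ_N - η/2) ⋯ R_{01}(z - ξ_1 - η/2)`. -/
noncomputable def monodromy {N : ℕ} (η : ℂ) (ξ : Fin N → ℂ) (z : ℂ) :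
    Matrix (Fin 2 × Conf N) (Fin 2 × Conf N) ℂ :=
  ((List.finRange N).reverse.map fun n => actAt n (RMat η (z - ξ n - η / 2))).prod

/-- The reflected monodromy matrix `(-1)^N σ₀ʸ M₀(-z)^{t₀} σ₀ʸ`. -/
noncomputable def monodromyHat {N : ℕ} (η : ℂ) (ξ : Fin N → ℂ) (z : ℂ) :
    Matrix (Fin 2 × Conf N) (Fin 2 × Conf N) ℂ :=
  ((-1 : ℂ) ^ N) • (onAux N sigmaY * auxTranspose (monodromy η ξ (-z)) * onAux N sigmaY)

/-- The scalar boundary matrix `K(z; ζ, κ, τ)`. -/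
noncomputable def KMat (z ζ κ τ : ℂ) : Matrix (Fin 2) (Fin 2) ℂ :=
  (1 / ζ) • !![ζ + z, 2 * κ * Complex.exp τ * z;
               2 * κ * Complex.exp (-τ) * z, ζ - z]

/-- The six boundary parameters `ζ_±, κ_±, τ_±`. The label `±` is an element of `ℤˣ = {1, -1}`. -/
structure BoundaryParams where
  ζ : ℤˣ → ℂ
  κ : ℤˣ → ℂ
  τ : ℤˣ → ℂ

namespace BoundaryParams

/-- The conditions under which `K_±` and `ζ̄_±` are well defined (and `ζ̄_±` is finite). -/
def Admissible (p : BoundaryParams) : Prop :=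
  ∀ σ : ℤˣ, p.ζ σ ≠ 0 ∧ 1 + 4 * p.κ σ ^ 2 ≠ 0

/-- `√(1 + 4κ_±²)`, the principal square root. -/
noncomputable def root (p : BoundaryParams) (σ : ℤˣ) : ℂ :=
  (1 + 4 * p.κ σ ^ 2) ^ (1 / 2 : ℂ)

/-- `ζ̄_± = ε_± ζ_± / √(1 + 4κ_±²)`, for a choice `ε` of the two signs. -/
noncomputable def zetaBar (p : BoundaryParams) (ε : ℤˣ → ℤˣ) (σ : ℤˣ) : ℂ :=
  ((ε σ : ℤ) : ℂ) * p.ζ σ / p.root σ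

/-- `ζ̄_±²`, which does not depend on the choice of signs. -/
noncomputable def zetaBarSq (p : BoundaryParams) (σ : ℤˣ) : ℂ :=
  p.ζ σ ^ 2 / (1 + 4 * p.κ σ ^ 2)

theorem zetaBar_sq (p : BoundaryParams) (ε : ℤˣ → ℤˣ) (σ : ℤˣ) :
    p.zetaBar ε σ ^ 2 = p.zetaBarSq σ := by
  have h : p.root σ ^ 2 = 1 + 4 * p.κ σ ^ 2 := by
    unfold root
    rw [← Complex.cpow_nat_mul]
    norm_num
  have h2 : (((ε σ : ℤ) : ℂ)) ^ 2 = 1 := by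
    rcases Int.units_eq_one_or (ε σ) with h | h <;> simp [h]
  unfold zetaBar zetaBarSq
  rw [div_pow, mul_pow, h, h2, one_mul]

/-- `(1 + 4κ₊κ₋ cosh(τ₊ - τ₋)) / (ζ₊ζ₋)`, half the leading coefficient `t_{N+1}` of the transfer
matrix. -/
noncomputable def coupling (p : BoundaryParams) : ℂ :=
  (1 + 4 * p.κ 1 * p.κ (-1) * Complex.cosh (p.τ 1 - p.τ (-1))) / (p.ζ 1 * p.ζ (-1))

/-- `ω_ε(κ_±, τ_±) = 1 + 4κ₊κ₋ cosh(τ₊ - τ₋) - ε √(1 + 4κ₊²) √(1 + 4κ₋²)`. -/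
noncomputable def omega (p : BoundaryParams) (ε : ℤˣ) : ℂ :=
  1 + 4 * p.κ 1 * p.κ (-1) * Complex.cosh (p.τ 1 - p.τ (-1))
    - ((ε : ℤ) : ℂ) * (p.root 1 * p.root (-1))

/-- The diagonal boundary parameters `(ζ̄_±, 0, 0)`. -/
noncomputable def diagonal (p : BoundaryParams) (ε : ℤˣ → ℤˣ) : BoundaryParams where
  ζ := p.zetaBar ε
  κ := fun _ => 0
  τ := fun _ => 0

end BoundaryParams

/-- The boundary transfer matrix `T(z) = tr₀ (K₊(z) M(z) K₋(z) M̂(z))`, where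
`K_±(z) = K(z ± η/2; ζ_±, κ_±, τ_±)`. -/
noncomputable def transfer {N : ℕ} (η : ℂ) (ξ : Fin N → ℂ) (p : BoundaryParams) (z : ℂ) :
    Matrix (Conf N) (Conf N) ℂ :=
  auxTrace
    (onAux N (KMat (z + η / 2) (p.ζ 1) (p.κ 1) (p.τ 1)) * monodromy η ξ z *
      onAux N (KMat (z - η / 2) (p.ζ (-1)) (p.κ (-1)) (p.τ (-1))) * monodromyHat η ξ z)

/-- Generic inhomogeneities: `ξ_j, ξ_j ± ξ_k ∉ {0, -η, η}` for all `j ≠ k`. -/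
def GenericInhom {N : ℕ} (η : ℂ) (ξ : Fin N → ℂ) : Prop :=
  (∀ j, ξ j ∉ ({0, -η, η} : Set ℂ)) ∧
  ∀ j k, j ≠ k →
    ξ j + ξ k ∉ ({0, -η, η} : Set ℂ) ∧ ξ j - ξ k ∉ ({0, -η, η} : Set ℂ)

/-- The spectrum of a family `T(z)` is simple: for some `z` all eigenvalues of `T(z)` have algebraic
multiplicity one. For a commuting family depending polynomially on `z` this says that its joint
eigenvalues `t(z)`, as polynomials in `z`, are pairwise distinct and as many as the dimension. -/
def HasSimpleSpectrum {n : Type*} [Fintype n] [DecidableEq n] (T : ℂ → Matrix n n ℂ) : Prop :=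
  ∃ z : ℂ, (T z).charpoly.roots.Nodup

/-- Two families have, for every `z`, the same eigenvalues with the same algebraic
multiplicities. -/
def SameSpectrum {n : Type*} [Fintype n] [DecidableEq n] (T₁ T₂ : ℂ → Matrix n n ℂ) : Prop :=
  ∀ z : ℂ, (T₁ z).charpoly = (T₂ z).charpoly

/-- Two families are similar, by one invertible matrix which does not depend on `z`. -/
def SimilarFamilies {n : Type*} [Fintype n] [DecidableEq n] (T₁ T₂ : ℂ → Matrix n n ℂ) : Prop :=
  ∃ Γ : (Matrix n n ℂ)ˣ, ∀ z : ℂ,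
    T₁ z = ((Γ⁻¹ : (Matrix n n ℂ)ˣ) : Matrix n n ℂ) * T₂ z * (Γ : Matrix n n ℂ)

end OpenXXX

/-!
The open XXX chain is integrable, and the theorem rests on three features of its transfer matrix,
which up to a shift of `z` is
`tr (K₊(x + η) L_N(x - ξ_N) ⋯ L_1(x - ξ_1) K₋(x) L_1(x + ξ_1) ⋯ L_N(x + ξ_N))`, where
`K_±(x) = 1 + x A_±` with traceless `2 × 2` matrices `A_±` (`transfer_eq`).

*Symmetry.* The flip commutes with `g ⊗ g`, so conjugating `A₊` and `A₋` by the same `g` conjugates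
the transfer matrix (`exists_openT_conj`). The pair `(A₊, A₋)` is determined, up to conjugation and
closure of orbits, by the invariants `tr A₊² = 2 / ζ̄₊²`, `tr A₋² = 2 / ζ̄₋²`, `tr A₊ A₋ = 2 c`.
By continuity the characteristic polynomials are therefore functions of these three numbers
(`chainT_invariants`). The exchange of the two boundaries is the composition of three operations:
moving all sites from the right boundary to the left one (`openT_swap`), restoring the order of the
sites by conjugation with `R`-matrices (`exists_openT_perm`), and transposition
(`openT_transpose`). This gives isospectrality, also for linear combinations `T(z) + μ T(w)`.

*Commutativity.* By the reflection equation the transfer matrices commute (`chainT_comm`). If the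
spectrum is simple, commuting families with the same joint spectrum are similar
(`JointlyIsospectral.similar`). The third part is the second one applied to the diagonal boundary
parameters `(ζ̄_±, 0, 0)`, for which `ω = 0` says that the invariants agree.

*Simplicity.* The resultant of the characteristic polynomial and its derivative is a polynomial in
the parameters, so one transfer matrix with simple spectrum suffices. For generic fixed
inhomogeneities it is a deformation of the one with nilpotent `A₊ = σ⁺`, `A₋ = σ⁻`: there the
transfer matrix is a product of two entries of bulk monodromy matrices, triangular in the
colexicographic order of spin configurations, with diagonal entries which are distinct polynomials
in `x` (`exists_simple_nilpotent`). The resultant is then a polynomial in `c`, `ζ̄₊`, `ζ̄₋`, and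
divides one in `c`, `ζ̄₊²`, `ζ̄₋²` by integrality (`exists_polynomial_squares`). For diagonal
boundary matrices and free inhomogeneities, the witness is found by first-order perturbation theory in `η`,
at a point where both boundary matrices are proportional to the same projector
(`exists_simple_diagonal`); the eigenvalues are then subset sums of powers of `2`.
-/

namespace OpenXXX

open Matrix

/-! ### Lax operators and double-row transfer matrices -/

section Abstract

variable {R 𝒜 ι : Type*}

/-- The flip of the auxiliary space and a site, as a `2 × 2` matrix of operators on the site. -/
def siteFlip (e : Fin 2 → Fin 2 → 𝒜) : Matrix (Fin 2) (Fin 2) 𝒜 := Matrix.of fun a b => e b a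

@[simp] theorem siteFlip_apply (e : Fin 2 → Fin 2 → 𝒜) (a b : Fin 2) :
    siteFlip e a b = e b a := rfl

variable [CommRing R] [Ring 𝒜] [Algebra R 𝒜]

/-- A system of `2 × 2` matrix units in a ring: a copy of the algebra of operators on one site. -/
structure IsMatrixUnits (e : Fin 2 → Fin 2 → 𝒜) : Prop where
  mul : ∀ a b c d, e a b * e c d = if b = c then e a d else 0
  sum : e 0 0 + e 1 1 = 1

/-- The Lax operator `u + η 𝒫` of a site: the `R`-matrix as a `2 × 2` matrix of operators. -/
def lax (e : Fin 2 → Fin 2 → 𝒜) (η u : R) : Matrix (Fin 2) (Fin 2) 𝒜 := u • 1 + η • siteFlip e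

/-- A matrix acting on the auxiliary space only. -/
def auxMat (𝒜 : Type*) [Ring 𝒜] [Algebra R 𝒜] (X : Matrix (Fin 2) (Fin 2) R) :
    Matrix (Fin 2) (Fin 2) 𝒜 := X.map (algebraMap R 𝒜)

/-- The double-row monodromy matrix `L_{n₁}(x - ξ_{n₁}) ⋯ L_{n_k}(x - ξ_{n_k}) K
L_{n_k}(x + ξ_{n_k}) ⋯ L_{n₁}(x + ξ_{n₁})` for the list `[n₁, …, n_k]` of sites. -/
def dressed (e : ι → Fin 2 → Fin 2 → 𝒜) (η : R) (ξ : ι → R) (x : R)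
    (K : Matrix (Fin 2) (Fin 2) 𝒜) : List ι → Matrix (Fin 2) (Fin 2) 𝒜
  | [] => K
  | n :: l => lax (e n) η (x - ξ n) * dressed e η ξ x K l * lax (e n) η (x + ξ n)

/-- The double-row transfer matrix with boundary matrices `α + (x + η) B` on the left and
`α' + x B'` on the right, where `x = z - η / 2`. -/
def openT (e : ι → Fin 2 → Fin 2 → 𝒜) (η : R) (ξ : ι → R) (l : List ι) (α : R)
    (B : Matrix (Fin 2) (Fin 2) R) (α' : R) (B' : Matrix (Fin 2) (Fin 2) R) (x : R) : 𝒜 :=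
  trace (auxMat 𝒜 (α • 1 + (x + η) • B) * dressed e η ξ x (auxMat 𝒜 (α' • 1 + x • B')) l)

/-! ### Exchange relations -/

/-- The Yang–Baxter equation for the rational `R`-matrix follows from the multiplication table of
three transpositions `p`, `q`, `r` in the symmetric group on three letters. -/
theorem yangBaxter_of_transpositions (p q r : 𝒜) (hp : p * p = 1) (hqr : q * r = p * q)
    (hrp : r * p = p * q) (hrq : r * q = p * r) (hqp : q * p = p * r) (η u v : R) :
    ((u - v) • 1 + η • p) * (u • 1 + η • q) * (v • 1 + η • r) =
      (v • 1 + η • r) * (u • 1 + η • q) * ((u - v) • 1 + η • p) := by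
  have h1 : p * (p * q) = q := by rw [← mul_assoc, hp, one_mul]
  simp only [mul_add, add_mul, smul_mul_assoc, mul_smul_comm, one_mul, mul_one, mul_assoc, h1, hqr,
    hrp, hrq, hqp]
  module

/-- The Yang–Baxter equation with the `R`-matrix of the two outer spaces in the middle. -/
theorem yangBaxter_of_transpositions' (p q r : 𝒜) (hq : q * q = 1) (hr : r * r = 1)
    (hqr : q * r = p * q)
    (hrp : r * p = p * q) (hrq : r * q = p * r) (hqp : q * p = p * r) (η u v : R) :
    (u • 1 + η • q) * ((u + v) • 1 + η • p) * (v • 1 + η • r) =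
      (v • 1 + η • r) * ((u + v) • 1 + η • p) * (u • 1 + η • q) := by
  simp only [mul_add, add_mul, smul_mul_assoc, mul_smul_comm, one_mul, mul_one, mul_assoc, hq, hr,
    hqr, hrp, hrq, hqp]
  module

theorem IsMatrixUnits.siteFlip_mul_self {e : Fin 2 → Fin 2 → 𝒜} (h : IsMatrixUnits e) :
    siteFlip e * siteFlip e = 1 := by
  ext a b
  rw [mul_apply, Fin.sum_univ_two]
  simp only [siteFlip_apply, h.mul, one_apply]
  by_cases hab : a = b
  · subst hab; simp [h.sum]
  · simp [hab]

/-! ### Exchange of the two boundaries -/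

theorem commute_scalar_of_entries {X : Matrix (Fin 2) (Fin 2) 𝒜} {g : 𝒜}
    (h : ∀ i j, Commute (X i j) g) : Commute X (scalar (Fin 2) g) := by
  ext i j
  simpa [scalar_apply] using (h i j).eq

theorem commute_entry_of_scalar {X : Matrix (Fin 2) (Fin 2) 𝒜} {g : 𝒜}
    (h : Commute X (scalar (Fin 2) g)) (i j : Fin 2) : Commute (X i j) g := by
  have := congrFun (congrFun h.eq i) j
  rw [Commute, SemiconjBy]
  simpa [scalar_apply] using this

theorem commute_auxMat (X : Matrix (Fin 2) (Fin 2) R) (g : 𝒜) :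
    Commute (auxMat 𝒜 X) (scalar (Fin 2) g) :=
  commute_scalar_of_entries fun _ _ => Algebra.commutes _ _

theorem commute_siteFlip {e : Fin 2 → Fin 2 → 𝒜} {g : 𝒜} (h : ∀ a b, Commute (e a b) g) :
    Commute (siteFlip e) (scalar (Fin 2) g) :=
  commute_scalar_of_entries fun _ _ => h _ _

theorem commute_lax {e : Fin 2 → Fin 2 → 𝒜} {g : 𝒜} (h : ∀ a b, Commute (e a b) g) (η u : R) :
    Commute (lax e η u) (scalar (Fin 2) g) :=
  ((Commute.one_left _).smul_left u).add_left ((commute_siteFlip h).smul_left η)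

theorem commute_dressed {e : ι → Fin 2 → Fin 2 → 𝒜} {g : 𝒜} {l : List ι}
    (h : ∀ n ∈ l, ∀ a b, Commute (e n a b) g) (η : R) (ξ : ι → R) (x : R)
    {K : Matrix (Fin 2) (Fin 2) 𝒜} (hK : Commute K (scalar (Fin 2) g)) :
    Commute (dressed e η ξ x K l) (scalar (Fin 2) g) := by
  induction l with
  | nil => exact hK
  | cons n l ih =>
    have hn := h n (by simp)
    exact ((commute_lax hn _ _).mul_left (ih fun m hm => h m (by simp [hm]))).mul_left
      (commute_lax hn _ _)

theorem dressed_append (e : ι → Fin 2 → Fin 2 → 𝒜) (η : R) (ξ : ι → R) (x : R)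
    (K : Matrix (Fin 2) (Fin 2) 𝒜) (l l' : List ι) :
    dressed e η ξ x K (l ++ l') = dressed e η ξ x (dressed e η ξ x K l') l := by
  induction l with
  | nil => rfl
  | cons n l ih => simp [dressed, ih]

/-- The pairing `tr₁₂ (X₁ Y₂ ((2 x + 2 η) 𝒫 - η))` of left and right boundaries, where the trace is
over two copies of the auxiliary space. -/
def pairing (η x : R) (X Y : Matrix (Fin 2) (Fin 2) 𝒜) : 𝒜 :=
  (2 * x + 2 * η) • trace (X * Y) - η • (trace X * trace Y)

/-- A site can be moved from the right boundary to the left boundary. -/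
theorem pairing_lax {e : Fin 2 → Fin 2 → 𝒜} (h : IsMatrixUnits e) (η x : R)
    {X Y : Matrix (Fin 2) (Fin 2) 𝒜} (hX : ∀ a b, Commute X (scalar (Fin 2) (e a b)))
    (hY : ∀ a b, Commute Y (scalar (Fin 2) (e a b))) (t : R) :
    pairing η x X (lax e η (x - t) * Y * lax e η (x + t)) =
      pairing η x (lax e η (x + t) * X * lax e η (x - t)) Y := by
  -- the partial trace of `𝒫 Z` over the auxiliary space
  let s : Matrix (Fin 2) (Fin 2) 𝒜 → 𝒜 := fun Z => ∑ a, ∑ b, e a b * Z a b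
  have hs : ∀ Z, (∀ a b, Commute Z (scalar (Fin 2) (e a b))) →
      siteFlip e * Z * siteFlip e = scalar (Fin 2) (s Z) ∧ trace (siteFlip e * Z) = s Z ∧
        trace (Z * siteFlip e) = s Z := by
    intro Z hZ
    have hc : ∀ i j a b, Z i j * e a b = e a b * Z i j := fun i j a b =>
      (commute_entry_of_scalar (hZ a b) i j).eq
    refine ⟨?_, ?_, ?_⟩
    · ext a b
      simp only [mul_apply, Fin.sum_univ_two, siteFlip_apply, add_mul, mul_assoc, hc, scalar_apply,
        diagonal_apply, s]
      simp only [← mul_assoc, h.mul]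
      fin_cases a <;> fin_cases b <;> simp only [reduceIte, add_zero, zero_mul, zero_ne_one, one_ne_zero,
        Fin.zero_eta, Fin.mk_one, Fin.isValue] <;> abel
    · simp only [trace_fin_two, mul_apply, Fin.sum_univ_two, siteFlip_apply, s]
      abel
    · simp only [trace_fin_two, mul_apply, Fin.sum_univ_two, siteFlip_apply, s, hc]
  obtain ⟨hX1, hX2, hX3⟩ := hs X hX
  obtain ⟨hY1, hY2, hY3⟩ := hs Y hY
  have hXY : trace (siteFlip e * (X * Y)) = trace (X * (Y * siteFlip e)) := by
    obtain ⟨-, h2, h3⟩ := hs (X * Y) fun a b => (hX a b).mul_left (hY a b)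
    rw [h2, ← mul_assoc, h3]
  have hXs : trace (X * scalar (Fin 2) (s Y)) = trace X * s Y := by
    simp [trace_fin_two, mul_apply, scalar_apply, add_mul]
  have hYs : trace (scalar (Fin 2) (s X) * Y) = s X * trace Y := by
    simp [trace_fin_two, mul_apply, scalar_apply, mul_add]
  have hss : ∀ g : 𝒜, trace (scalar (Fin 2) g) = (2 : R) • g := by
    intro g
    simp [scalar_apply, two_smul]
  have hX1' : siteFlip e * (X * siteFlip e) = scalar (Fin 2) (s X) := by rw [← mul_assoc, hX1]
  have hY1' : siteFlip e * (Y * siteFlip e) = scalar (Fin 2) (s Y) := by rw [← mul_assoc, hY1]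
  simp only [pairing, lax, mul_add, add_mul, smul_mul_assoc, mul_smul_comm, one_mul, mul_one,
    trace_add, trace_smul, mul_assoc, hX1', hY1', hXY, hXs, hYs, hss, hX2, hX3, hY2, hY3]
  module

/-- All sites can be moved from the right boundary to the left boundary. -/
theorem pairing_dressed {e : ι → Fin 2 → Fin 2 → 𝒜} (he : ∀ n, IsMatrixUnits (e n)) {l : List ι}
    (hl : l.Pairwise fun m n => ∀ a b c d, Commute (e m a b) (e n c d)) (η : R) (ξ : ι → R) (x : R)
    {X Y : Matrix (Fin 2) (Fin 2) 𝒜}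
    (hX : ∀ n ∈ l, ∀ a b, Commute X (scalar (Fin 2) (e n a b)))
    (hY : ∀ n ∈ l, ∀ a b, Commute Y (scalar (Fin 2) (e n a b))) :
    pairing η x X (dressed e η ξ x Y l) = pairing η x (dressed e η (-ξ) x X l.reverse) Y := by
  induction l generalizing X with
  | nil => rfl
  | cons n l ih =>
    obtain ⟨h1, h2⟩ := List.pairwise_cons.mp hl
    have hn : ∀ a b, Commute (dressed e η ξ x Y l) (scalar (Fin 2) (e n a b)) := fun a b =>
      commute_dressed (fun m hm c d => (h1 m hm a b c d).symm) _ _ _ (hY n (by simp) a b)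
    rw [List.reverse_cons, dressed_append]
    simp only [dressed]
    rw [pairing_lax (he n) η x (hX n (by simp)) hn, Pi.neg_apply, sub_neg_eq_add, ← sub_eq_add_neg]
    refine ih h2 (fun m hm a b => ?_) fun m hm => hY m (by simp [hm])
    have hc : ∀ c d, Commute (e n c d) (e m a b) := fun c d => h1 m hm c d a b
    exact ((commute_lax hc _ _).mul_left (hX m (by simp [hm]) a b)).mul_left (commute_lax hc _ _)

theorem pairing_auxMat (η x α : R) {B : Matrix (Fin 2) (Fin 2) R} (hB : B.trace = 0)
    (U : Matrix (Fin 2) (Fin 2) 𝒜) :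
    pairing η x (auxMat 𝒜 (α • 1 + x • B)) U =
      (2 * x) • trace (auxMat 𝒜 (α • 1 + (x + η) • B) * U) := by
  have h1 : B 1 1 = - B 0 0 := by
    rw [trace_fin_two] at hB
    linear_combination hB
  simp only [pairing, auxMat, trace_fin_two, mul_apply, Fin.sum_univ_two, map_apply,
    Matrix.add_apply, Matrix.smul_apply, h1, smul_eq_mul, Algebra.algebraMap_eq_smul_one,
    smul_mul_assoc, one_mul, one_apply_eq, ← add_smul,
    one_apply_ne (zero_ne_one : (0 : Fin 2) ≠ 1), one_apply_ne (one_ne_zero : (1 : Fin 2) ≠ 0)]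
  module

theorem pairing_auxMat_comm (η x : R) (K : Matrix (Fin 2) (Fin 2) R)
    (U : Matrix (Fin 2) (Fin 2) 𝒜) :
    pairing η x U (auxMat 𝒜 K) = pairing η x (auxMat 𝒜 K) U := by
  have hc : ∀ (r : R) (g : 𝒜), g * algebraMap R 𝒜 r = algebraMap R 𝒜 r * g := fun r g =>
    (Algebra.commutes r g).symm
  simp only [pairing, auxMat, trace_fin_two, mul_apply, Fin.sum_univ_two, map_apply, hc, mul_add,
    add_mul, smul_add]
  abel

/-- Exchanging the two boundaries amounts to reversing the chain and the signs of the
inhomogeneities. -/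
theorem openT_swap {e : ι → Fin 2 → Fin 2 → 𝒜} (he : ∀ n, IsMatrixUnits (e n)) {l : List ι}
    (hl : l.Pairwise fun m n => ∀ a b c d, Commute (e m a b) (e n c d)) (η : R) (ξ : ι → R)
    (α α' : R) {B B' : Matrix (Fin 2) (Fin 2) R} (hB : B.trace = 0) (hB' : B'.trace = 0) (x : R) :
    (2 * x) • openT e η ξ l α B α' B' x = (2 * x) • openT e η (-ξ) l.reverse α' B' α B x := by
  rw [openT, openT, ← pairing_auxMat _ _ _ hB, ← pairing_auxMat _ _ _ hB',
    pairing_dressed he hl _ _ _ (fun _ _ _ _ => commute_auxMat _ _)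
      (fun _ _ _ _ => commute_auxMat _ _), pairing_auxMat_comm]

end Abstract

section Abstract

variable {R 𝒜 ι : Type*} [CommRing R] [Ring 𝒜] [Algebra R 𝒜]

/-! ### Reordering the sites -/

/-- The flip of two sites. -/
def flipSites (e f : Fin 2 → Fin 2 → 𝒜) : 𝒜 := ∑ a, ∑ b, e a b * f b a

section FlipSites

variable {e f : Fin 2 → Fin 2 → 𝒜}

theorem flipSites_mul_left (he : IsMatrixUnits e) (hef : ∀ a b c d, Commute (e a b) (f c d))
    (a b : Fin 2) : flipSites e f * e a b = ∑ c, e c b * f a c := by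
  have h1 : ∀ a b c d, f a b * e c d = e c d * f a b := fun a b c d => (hef c d a b).eq.symm
  simp only [flipSites, Finset.sum_mul, mul_assoc, h1]
  simp only [← mul_assoc, he.mul]
  fin_cases a <;> simp

theorem flipSites_mul_right (hf : IsMatrixUnits f) (a b : Fin 2) :
    flipSites e f * f a b = ∑ c, e a c * f c b := by
  simp only [flipSites, Finset.sum_mul, mul_assoc, hf.mul]
  fin_cases a <;> simp

theorem left_mul_flipSites (he : IsMatrixUnits e) (a b : Fin 2) :
    e a b * flipSites e f = ∑ c, e a c * f c b := by
  simp only [flipSites, Finset.mul_sum, ← mul_assoc, he.mul]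
  fin_cases b <;> simp

theorem right_mul_flipSites (hf : IsMatrixUnits f) (hef : ∀ a b c d, Commute (e a b) (f c d))
    (a b : Fin 2) : f a b * flipSites e f = ∑ c, e c b * f a c := by
  have h1 : ∀ a b c d, f a b * e c d = e c d * f a b := fun a b c d => (hef c d a b).eq.symm
  simp only [flipSites, Finset.mul_sum, ← mul_assoc, h1]
  simp only [mul_assoc, hf.mul]
  fin_cases b <;> simp

theorem flipSites_mul_self (he : IsMatrixUnits e) (hf : IsMatrixUnits f)
    (hef : ∀ a b c d, Commute (e a b) (f c d)) : flipSites e f * flipSites e f = 1 := by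
  conv_lhs => enter [1]; rw [flipSites]
  simp only [Finset.sum_mul, mul_assoc, right_mul_flipSites hf hef]
  simp only [Finset.mul_sum, ← mul_assoc, he.mul]
  simp only [Fin.sum_univ_two]
  have : (e 0 0 + e 1 1) * (f 0 0 + f 1 1) = 1 := by rw [he.sum, hf.sum, one_mul]
  simp only [zero_ne_one, one_ne_zero, if_false, if_true, zero_mul, add_zero, zero_add]
  rw [← this]
  noncomm_ring

/-- The Yang–Baxter equation for the auxiliary space and two sites. -/
theorem lax_exchange (he : IsMatrixUnits e) (hf : IsMatrixUnits f)
    (hef : ∀ a b c d, Commute (e a b) (f c d)) (η u v : R) :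
    scalar (Fin 2) ((u - v) • (1 : 𝒜) + η • flipSites e f) * (lax e η u * lax f η v) =
      lax f η v * lax e η u * scalar (Fin 2) ((u - v) • (1 : 𝒜) + η • flipSites e f) := by
  have h1 : scalar (Fin 2) ((u - v) • (1 : 𝒜) + η • flipSites e f) =
      (u - v) • 1 + η • scalar (Fin 2) (flipSites e f) := by
    ext i j
    fin_cases i <;> fin_cases j <;> simp [scalar_apply]
  have hc : ∀ a b c d, f a b * e c d = e c d * f a b := fun a b c d => (hef c d a b).eq.symm
  rw [h1, ← mul_assoc]
  refine yangBaxter_of_transpositions _ _ _ ?_ ?_ ?_ ?_ ?_ η u v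
  · rw [← map_mul, flipSites_mul_self he hf hef, map_one]
  · ext a b
    rw [Matrix.mul_apply]
    simp [flipSites_mul_left he hef]
  · ext a b
    simp [flipSites_mul_left he hef, right_mul_flipSites hf hef]
  · ext a b
    rw [Matrix.mul_apply]
    simp [flipSites_mul_right hf, hc]
  · ext a b
    simp [flipSites_mul_right hf, left_mul_flipSites he]

end FlipSites

/-- The order of the sites affects the double-row monodromy matrix by a conjugation only. -/
theorem exists_dressed_perm {e : ι → Fin 2 → Fin 2 → 𝒜} (he : ∀ n, IsMatrixUnits (e n))
    (hcomm : ∀ m n, m ≠ n → ∀ a b c d, Commute (e m a b) (e n c d)) (η : R) (ξ : ι → R)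
    (hξ : ∀ m n, m ≠ n → IsUnit (η ^ 2 - (ξ m - ξ n) ^ 2)) {l l' : List ι} (hl : l.Perm l')
    (hnd : l.Nodup) :
    ∃ g : 𝒜ˣ, (∀ h, (∀ n ∈ l, ∀ a b, Commute (e n a b) h) → Commute (g : 𝒜) h) ∧
      ∀ x (K : Matrix (Fin 2) (Fin 2) R),
        scalar (Fin 2) (g : 𝒜) * dressed e η ξ x (auxMat 𝒜 K) l =
          dressed e η ξ x (auxMat 𝒜 K) l' * scalar (Fin 2) (g : 𝒜) := by
  induction hl with
  | nil => exact ⟨1, fun h _ => Commute.one_left h, fun x K => by simp⟩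
  | @cons n l l' hl ih =>
    obtain ⟨hn, hnd⟩ := List.nodup_cons.mp hnd
    obtain ⟨g, hg, h⟩ := ih hnd
    refine ⟨g, fun k hk => hg k fun m hm => hk m (by simp [hm]), fun x K => ?_⟩
    have hc : ∀ u, Commute (lax (e n) η u) (scalar (Fin 2) (g : 𝒜)) := fun u =>
      commute_lax (fun a b => (hg _ fun m hm c d =>
        hcomm m n (fun h => hn (h ▸ hm)) c d a b).symm) _ _
    simp only [dressed]
    rw [← mul_assoc, ← mul_assoc, ← (hc _).eq, mul_assoc (lax (e n) η _), h, mul_assoc, mul_assoc,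
      mul_assoc, ← (hc _).eq]
    simp only [mul_assoc]
  | @swap m n l =>
    have hmn : n ≠ m := by
      rintro rfl
      simp at hnd
    have hnl : n ∉ l := fun h => (List.nodup_cons.mp hnd).1 (by simp [h])
    have hml : m ∉ l := (List.nodup_cons.mp (List.nodup_cons.mp hnd).2).1
    set p := flipSites (e n) (e m) with hp
    have hpp : p * p = 1 := flipSites_mul_self (he n) (he m) (hcomm n m hmn)
    set δ := ξ m - ξ n with hδ
    -- `r δ` moves the sites past each other to the left of the boundary, its inverse to the right
    let r : R → 𝒜 := fun t => t • 1 + η • p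
    have hr : ∀ t, r t * r (-t) = (η ^ 2 - t ^ 2) • (1 : 𝒜) := by
      intro t
      simp only [r, mul_add, add_mul, smul_mul_assoc, mul_smul_comm, one_mul, mul_one, hpp]
      module
    obtain ⟨c, hc⟩ := hξ m n hmn.symm
    have hcR : (↑c⁻¹ : R) * (η ^ 2 - δ ^ 2) = 1 := by rw [← hc, Units.inv_mul]
    have h1 : r δ * ((↑c⁻¹ : R) • r (-δ)) = 1 := by rw [mul_smul_comm, hr, smul_smul, hcR, one_smul]
    have h2 : ((↑c⁻¹ : R) • r (-δ)) * r δ = 1 := by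
      have := hr (-δ)
      rw [neg_neg, neg_sq] at this
      rw [smul_mul_assoc, this, smul_smul, hcR, one_smul]
    let g : 𝒜ˣ := ⟨r δ, (↑c⁻¹ : R) • r (-δ), h1, h2⟩
    have hg : ∀ h, (∀ a b, Commute (e n a b) h) → (∀ a b, Commute (e m a b) h) →
        Commute (r δ) h := by
      intro h hn hm
      refine ((Commute.one_left h).smul_left δ).add_left (Commute.smul_left ?_ η)
      exact Commute.sum_left _ _ _ fun a _ => Commute.sum_left _ _ _ fun b _ =>
        (hn a b).mul_left (hm b a)
    refine ⟨g, fun h hh => hg h (hh n (by simp)) (hh m (by simp)), fun x K => ?_⟩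
    have hU : Commute (dressed e η ξ x (auxMat 𝒜 K) l) (scalar (Fin 2) (r δ)) :=
      commute_dressed (fun k hk a b => (hg _
          (fun c d => (hcomm k n (fun h => hnl (h ▸ hk)) a b c d).symm)
          (fun c d => (hcomm k m (fun h => hml (h ▸ hk)) a b c d).symm)).symm) _ _ _
        (commute_auxMat _ _)
    have e1 := lax_exchange (he n) (he m) (hcomm n m hmn) η (x - ξ n) (x - ξ m)
    have e2 := lax_exchange (he n) (he m) (hcomm n m hmn) η (x + ξ n) (x + ξ m)
    rw [show x - ξ n - (x - ξ m) = δ by rw [hδ]; ring] at e1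
    rw [show x + ξ n - (x + ξ m) = -δ by rw [hδ]; ring] at e2
    change scalar (Fin 2) (r δ) * _ = _ * scalar (Fin 2) (r δ) at e1
    change scalar (Fin 2) (r (-δ)) * _ = _ * scalar (Fin 2) (r (-δ)) at e2
    have e3 : scalar (Fin 2) (r δ) * (lax (e m) η (x + ξ m) * lax (e n) η (x + ξ n)) =
        lax (e n) η (x + ξ n) * lax (e m) η (x + ξ m) * scalar (Fin 2) (r δ) := by
      have h3 := congrArg (fun Z => scalar (Fin 2) (r δ) * Z * ((↑c⁻¹ : R) • scalar (Fin 2) (r δ))) e2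
      have h1' : scalar (Fin 2) (r δ) * scalar (Fin 2) (r (-δ)) = (η ^ 2 - δ ^ 2) • 1 := by
        rw [← map_mul, hr]
        ext i j
        fin_cases i <;> fin_cases j <;> simp [scalar_apply]
      have h2' : scalar (Fin 2) (r (-δ)) * scalar (Fin 2) (r δ) = (η ^ 2 - δ ^ 2) • 1 := by
        have := hr (-δ)
        rw [neg_neg, neg_sq] at this
        rw [← map_mul, this]
        ext i j
        fin_cases i <;> fin_cases j <;> simp [scalar_apply]
      simp only [mul_assoc, mul_smul_comm, h2'] at h3
      rw [← mul_assoc (scalar (Fin 2) (r δ)) (scalar (Fin 2) (r (-δ))), h1'] at h3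
      simp only [smul_mul_assoc, one_mul, smul_smul, hcR, mul_one, one_smul] at h3
      rw [mul_assoc, h3]
    change scalar (Fin 2) (r δ) * _ = _ * scalar (Fin 2) (r δ)
    simp only [dressed]
    calc _ = (scalar (Fin 2) (r δ) * (lax (e n) η (x - ξ n) * lax (e m) η (x - ξ m))) *
          dressed e η ξ x (auxMat 𝒜 K) l * (lax (e m) η (x + ξ m) * lax (e n) η (x + ξ n)) := by
          simp only [mul_assoc]
      _ = lax (e m) η (x - ξ m) * lax (e n) η (x - ξ n) * (scalar (Fin 2) (r δ) *
          dressed e η ξ x (auxMat 𝒜 K) l) * (lax (e m) η (x + ξ m) * lax (e n) η (x + ξ n)) := by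
          rw [e1]; simp only [mul_assoc]
      _ = lax (e m) η (x - ξ m) * lax (e n) η (x - ξ n) * dressed e η ξ x (auxMat 𝒜 K) l *
          (scalar (Fin 2) (r δ) * (lax (e m) η (x + ξ m) * lax (e n) η (x + ξ n))) := by
          rw [← hU.eq]; simp only [mul_assoc]
      _ = _ := by rw [e3]; simp only [mul_assoc]
  | trans h12 h23 ih1 ih2 =>
    obtain ⟨g1, hg1, h1⟩ := ih1 hnd
    obtain ⟨g2, hg2, h2⟩ := ih2 (h12.nodup_iff.mp hnd)
    refine ⟨g2 * g1, fun h hh => ?_, fun x K => ?_⟩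
    · exact (hg2 h fun n hn => hh n (h12.mem_iff.mpr hn)).mul_left (hg1 h hh)
    · rw [Units.val_mul, map_mul, mul_assoc, h1, ← mul_assoc, h2, mul_assoc]

/-- The order of the sites affects the transfer matrix by a conjugation only. -/
theorem exists_openT_perm {e : ι → Fin 2 → Fin 2 → 𝒜} (he : ∀ n, IsMatrixUnits (e n))
    (hcomm : ∀ m n, m ≠ n → ∀ a b c d, Commute (e m a b) (e n c d)) (η : R) (ξ : ι → R)
    (hξ : ∀ m n, m ≠ n → IsUnit (η ^ 2 - (ξ m - ξ n) ^ 2)) {l l' : List ι} (hl : l.Perm l')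
    (hnd : l.Nodup) (α α' : R) (B B' : Matrix (Fin 2) (Fin 2) R) :
    ∃ g : 𝒜ˣ, ∀ x, (g : 𝒜) * openT e η ξ l α B α' B' x = openT e η ξ l' α B α' B' x * g := by
  obtain ⟨g, -, hg⟩ := exists_dressed_perm he hcomm η ξ hξ hl hnd
  refine ⟨g, fun x => ?_⟩
  have h1 : ∀ X : Matrix (Fin 2) (Fin 2) 𝒜, (g : 𝒜) * trace X = trace (scalar (Fin 2) (g : 𝒜) * X) :=
    fun X => by simp [trace_fin_two, scalar_apply, mul_add]
  have h2 : ∀ X : Matrix (Fin 2) (Fin 2) 𝒜, trace X * (g : 𝒜) = trace (X * scalar (Fin 2) (g : 𝒜)) :=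
    fun X => by simp [trace_fin_two, scalar_apply, add_mul]
  rw [openT, openT, h1, h2, ← mul_assoc, ← (commute_auxMat _ _).eq, mul_assoc, hg, mul_assoc]

/-! ### Invariance under simultaneous conjugation of the boundary matrices -/

/-- A `2 × 2` matrix acting on a site. -/
def siteMat (e : Fin 2 → Fin 2 → 𝒜) (h : Matrix (Fin 2) (Fin 2) R) : 𝒜 := ∑ a, ∑ b, h a b • e a b

theorem siteMat_mul {e : Fin 2 → Fin 2 → 𝒜} (he : IsMatrixUnits e) (h k : Matrix (Fin 2) (Fin 2) R) :
    siteMat e h * siteMat e k = siteMat e (h * k) := by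
  simp only [siteMat, Fin.sum_univ_two, mul_apply, mul_add, add_mul, smul_mul_assoc,
    mul_smul_comm, he.mul, zero_ne_one, one_ne_zero, if_false, if_true, smul_zero, add_zero,
    zero_add]
  module

theorem siteMat_one {e : Fin 2 → Fin 2 → 𝒜} (he : IsMatrixUnits e) :
    siteMat e (1 : Matrix (Fin 2) (Fin 2) R) = 1 := by
  simp [siteMat, he.sum]

/-- The flip commutes with the tensor square of a matrix. -/
theorem auxMat_mul_siteMat_mul_lax {e : Fin 2 → Fin 2 → 𝒜} (he : IsMatrixUnits e)
    (h : Matrix (Fin 2) (Fin 2) R) (η u : R) :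
    auxMat 𝒜 h * scalar (Fin 2) (siteMat e h) * lax e η u =
      lax e η u * (auxMat 𝒜 h * scalar (Fin 2) (siteMat e h)) := by
  have key : auxMat 𝒜 h * scalar (Fin 2) (siteMat e h) * siteFlip e =
      siteFlip e * (auxMat 𝒜 h * scalar (Fin 2) (siteMat e h)) := by
    ext a b
    simp only [mul_apply, Fin.sum_univ_two, auxMat, map_apply, scalar_apply, diagonal_apply,
      siteFlip_apply, siteMat, Algebra.algebraMap_eq_smul_one, smul_mul_assoc, one_mul, mul_add,
      add_mul, mul_smul_comm, mul_ite, ite_mul, mul_zero, zero_mul, he.mul]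
    fin_cases a <;> fin_cases b <;> simp <;> module
  simp only [lax, mul_add, add_mul, mul_smul_comm, smul_mul_assoc, mul_one, one_mul, key]

/-- Conjugation of the innermost boundary matrix by `h` conjugates the double-row monodromy matrix
by the product of `h` over the auxiliary space and all sites. -/
theorem exists_dressed_conj {e : ι → Fin 2 → Fin 2 → 𝒜} (he : ∀ n, IsMatrixUnits (e n))
    (hcomm : ∀ m n, m ≠ n → ∀ a b c d, Commute (e m a b) (e n c d)) (η : R) (ξ : ι → R)
    (l : List ι) (hnd : l.Nodup) (h : (Matrix (Fin 2) (Fin 2) R)ˣ) :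
    ∃ g : 𝒜ˣ, (∀ k, (∀ n ∈ l, ∀ a b, Commute (e n a b) k) → Commute (g : 𝒜) k) ∧
      ∀ x (K K' : Matrix (Fin 2) (Fin 2) R), h.val * K = K' * h.val →
        auxMat 𝒜 h.val * scalar (Fin 2) (g : 𝒜) * dressed e η ξ x (auxMat 𝒜 K) l =
          dressed e η ξ x (auxMat 𝒜 K') l * (auxMat 𝒜 h.val * scalar (Fin 2) (g : 𝒜)) := by
  induction l with
  | nil =>
    refine ⟨1, fun k _ => Commute.one_left k, fun x K K' hK => ?_⟩
    have := congrArg (algebraMap R 𝒜).mapMatrix hK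
    rw [map_mul, map_mul] at this
    rw [Units.val_one, map_one, mul_one]
    exact this
  | cons n l ih =>
    obtain ⟨hn, hnd⟩ := List.nodup_cons.mp hnd
    obtain ⟨g, hg, H⟩ := ih hnd
    let s : 𝒜ˣ := ⟨siteMat (e n) h.val, siteMat (e n) h⁻¹.val,
      by rw [siteMat_mul (he n), Units.mul_inv, siteMat_one (he n)],
      by rw [siteMat_mul (he n), Units.inv_mul, siteMat_one (he n)]⟩
    have hs : ∀ k, (∀ a b, Commute (e n a b) k) → Commute (siteMat (e n) h.val) k :=
      fun k hk => Commute.sum_left _ _ _ fun a _ => Commute.sum_left _ _ _ fun b _ =>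
        (hk a b).smul_left _
    refine ⟨g * s, fun k hk => ?_, fun x K K' hK => ?_⟩
    · exact (hg k fun m hm => hk m (by simp [hm])).mul_left (hs k (hk n (by simp)))
    have hng : ∀ a b, Commute (e n a b) (g : 𝒜) := fun a b =>
      (hg _ fun m hm c d => hcomm m n (fun h => hn (h ▸ hm)) c d a b).symm
    have hL : ∀ u, scalar (Fin 2) (g : 𝒜) * lax (e n) η u = lax (e n) η u * scalar (Fin 2) (g : 𝒜) :=
      fun u => (commute_lax hng _ _).eq.symm
    have hU : Commute (dressed e η ξ x (auxMat 𝒜 K') l) (scalar (Fin 2) (siteMat (e n) h.val)) :=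
      commute_dressed (fun k hk a b => (hs _ fun c d =>
        (hcomm k n (fun h => hn (h ▸ hk)) a b c d).symm).symm) _ _ _ (commute_auxMat _ _)
    have hgs : scalar (Fin 2) (g : 𝒜) * scalar (Fin 2) (siteMat (e n) h.val) =
        scalar (Fin 2) (siteMat (e n) h.val) * scalar (Fin 2) (g : 𝒜) := by
      rw [← map_mul, ← map_mul, ((hs _ hng).symm).eq]
    have hLs := auxMat_mul_siteMat_mul_lax (he n) h.val η
    have hA : ∀ k : 𝒜, auxMat 𝒜 h.val * scalar (Fin 2) k = scalar (Fin 2) k * auxMat 𝒜 h.val :=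
      fun k => (commute_auxMat h.val k).eq
    have H' := H x K K' hK
    have hL₁ := hL (x - ξ n)
    have hL₂ := hL (x + ξ n)
    have hLs₁ := hLs (x - ξ n)
    have hLs₂ := hLs (x + ξ n)
    have hA₁ := hA (siteMat (e n) h.val)
    rw [Units.val_mul, map_mul]
    simp only [dressed]
    clear ih hL hLs hA H
    change auxMat 𝒜 h.val * (_ * scalar (Fin 2) (siteMat (e n) h.val)) * _ =
      _ * (auxMat 𝒜 h.val * (_ * scalar (Fin 2) (siteMat (e n) h.val)))
    set A := auxMat 𝒜 h.val
    set S := scalar (Fin 2) (siteMat (e n) h.val)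
    set G := scalar (Fin 2) (g : 𝒜)
    set L := lax (e n) η (x - ξ n)
    set L' := lax (e n) η (x + ξ n)
    set U := dressed e η ξ x (auxMat 𝒜 K) l
    set U' := dressed e η ξ x (auxMat 𝒜 K') l
    calc A * (G * S) * (L * U * L') = A * S * (G * L) * U * L' := by
          rw [hgs]; simp only [mul_assoc]
      _ = A * S * L * G * U * L' := by rw [hL₁]; simp only [mul_assoc]
      _ = L * (S * A) * G * U * L' := by rw [hLs₁, hA₁]
      _ = L * S * (A * G * U) * L' := by simp only [mul_assoc]
      _ = L * (S * U') * (A * G) * L' := by rw [H']; simp only [mul_assoc]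
      _ = L * U' * (S * A) * (G * L') := by rw [← hU.eq]; simp only [mul_assoc]
      _ = L * U' * (A * S * L') * G := by rw [hL₂, hA₁]; simp only [mul_assoc]
      _ = L * U' * L' * (A * (S * G)) := by rw [hLs₂]; simp only [mul_assoc]
      _ = _ := by rw [hgs]

/-- Conjugating both boundary matrices by one invertible matrix conjugates the transfer matrix. -/
theorem exists_openT_conj {e : ι → Fin 2 → Fin 2 → 𝒜} (he : ∀ n, IsMatrixUnits (e n))
    (hcomm : ∀ m n, m ≠ n → ∀ a b c d, Commute (e m a b) (e n c d)) (η : R) (ξ : ι → R)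
    (l : List ι) (hnd : l.Nodup) (h : (Matrix (Fin 2) (Fin 2) R)ˣ) (α α' : R)
    {B C B' C' : Matrix (Fin 2) (Fin 2) R} (hB : h.val * B = C * h.val)
    (hB' : h.val * B' = C' * h.val) :
    ∃ g : 𝒜ˣ, ∀ x, (g : 𝒜) * openT e η ξ l α B α' B' x = openT e η ξ l α C α' C' x * g := by
  obtain ⟨g, -, hg⟩ := exists_dressed_conj he hcomm η ξ l hnd h
  refine ⟨g, fun x => ?_⟩
  have h1 : ∀ X : Matrix (Fin 2) (Fin 2) 𝒜, (g : 𝒜) * trace X = trace (scalar (Fin 2) (g : 𝒜) * X) :=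
    fun X => by simp [trace_fin_two, scalar_apply, mul_add]
  have h2 : ∀ X : Matrix (Fin 2) (Fin 2) 𝒜, trace X * (g : 𝒜) = trace (X * scalar (Fin 2) (g : 𝒜)) :=
    fun X => by simp [trace_fin_two, scalar_apply, add_mul]
  have hcyc : ∀ (Z : Matrix (Fin 2) (Fin 2) R) (X : Matrix (Fin 2) (Fin 2) 𝒜),
      trace (X * auxMat 𝒜 Z) = trace (auxMat 𝒜 Z * X) := by
    intro Z X
    have hc : ∀ (r : R) (g : 𝒜), g * algebraMap R 𝒜 r = algebraMap R 𝒜 r * g := fun r g =>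
      (Algebra.commutes r g).symm
    simp only [auxMat, trace_fin_two, mul_apply, Fin.sum_univ_two, map_apply, hc]
    abel
  have hmul : ∀ Z W : Matrix (Fin 2) (Fin 2) R, auxMat 𝒜 (Z * W) = auxMat 𝒜 Z * auxMat 𝒜 W :=
    fun Z W => map_mul (algebraMap R 𝒜).mapMatrix Z W
  have hinv : auxMat 𝒜 h.val * auxMat 𝒜 h⁻¹.val = 1 := by
    rw [← hmul, Units.mul_inv]
    exact map_one (algebraMap R 𝒜).mapMatrix
  have hinv' : auxMat 𝒜 h⁻¹.val * auxMat 𝒜 h.val = 1 := by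
    rw [← hmul, Units.inv_mul]
    exact map_one (algebraMap R 𝒜).mapMatrix
  have hK : ∀ (β t : R) {B C : Matrix (Fin 2) (Fin 2) R}, h.val * B = C * h.val →
      h.val * (β • 1 + t • B) = (β • 1 + t • C) * h.val := by
    intro β t B C hBC
    simp only [mul_add, add_mul, mul_smul_comm, smul_mul_assoc, mul_one, one_mul, hBC]
  have hg' := hg x _ _ (hK α' x hB')
  have hK' : auxMat 𝒜 h.val * auxMat 𝒜 (α • 1 + (x + η) • B) =
      auxMat 𝒜 (α • 1 + (x + η) • C) * auxMat 𝒜 h.val := by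
    rw [← hmul, ← hmul, hK _ _ hB]
  have hA : auxMat 𝒜 h.val * scalar (Fin 2) (g : 𝒜) = scalar (Fin 2) (g : 𝒜) * auxMat 𝒜 h.val :=
    (commute_auxMat h.val (g : 𝒜)).eq
  rw [openT, openT, h1, h2]
  set A := auxMat 𝒜 h.val
  set A' := auxMat 𝒜 h⁻¹.val
  set G := scalar (Fin 2) (g : 𝒜)
  set K := auxMat 𝒜 (α • 1 + (x + η) • B)
  set K₁ := auxMat 𝒜 (α • 1 + (x + η) • C)
  set U := dressed e η ξ x (auxMat 𝒜 (α' • 1 + x • B')) l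
  set U' := dressed e η ξ x (auxMat 𝒜 (α' • 1 + x • C')) l
  calc trace (G * (K * U)) = trace (A' * (A * (G * (K * U)))) := by
        rw [← mul_assoc A', hinv', one_mul]
    _ = trace (A * (G * (K * U)) * A') := (hcyc _ _).symm
    _ = trace ((A * K) * (G * U) * A') := by
        congr 2
        rw [← mul_assoc G, ← (show K * G = G * K from (commute_auxMat _ _).eq)]
        simp only [mul_assoc]
    _ = trace (K₁ * (A * G * U) * A') := by rw [hK']; simp only [mul_assoc]
    _ = trace (K₁ * U' * G * (A * A')) := by rw [hg', hA]; simp only [mul_assoc]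
    _ = _ := by rw [hinv, mul_one]

end Abstract

section Abstract

variable {R 𝒜 ι : Type*} [CommRing R] [Ring 𝒜] [Algebra R 𝒜]

/-! ### The reflection equation and commuting transfer matrices -/

/-- Operators on the first of two auxiliary spaces. -/
def aux₁ (R : Type*) {𝒜 : Type*} [CommRing R] [Ring 𝒜] [Algebra R 𝒜] :
    Matrix (Fin 2) (Fin 2) 𝒜 →ₐ[R] Matrix (Fin 2) (Fin 2) (Matrix (Fin 2) (Fin 2) 𝒜) :=
  (scalarAlgHom (Fin 2) R).mapMatrix

/-- Operators on the second of two auxiliary spaces. -/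
def aux₂ (R : Type*) {𝒜 : Type*} [CommRing R] [Ring 𝒜] [Algebra R 𝒜] :
    Matrix (Fin 2) (Fin 2) 𝒜 →ₐ[R] Matrix (Fin 2) (Fin 2) (Matrix (Fin 2) (Fin 2) 𝒜) :=
  scalarAlgHom (Fin 2) R

/-- The flip of two auxiliary spaces. -/
def auxFlip (𝒜 : Type*) [Ring 𝒜] : Matrix (Fin 2) (Fin 2) (Matrix (Fin 2) (Fin 2) 𝒜) :=
  Matrix.of fun i j => single j i 1

theorem aux₁_apply (X : Matrix (Fin 2) (Fin 2) 𝒜) (i j k l : Fin 2) :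
    aux₁ R X i j k l = if k = l then X i j else 0 := by
  simp [aux₁, scalarAlgHom_apply, scalar_apply, diagonal_apply]

theorem aux₂_apply (X : Matrix (Fin 2) (Fin 2) 𝒜) (i j k l : Fin 2) :
    aux₂ R X i j k l = if i = j then X k l else 0 := by
  by_cases h : i = j <;> simp [aux₂, scalarAlgHom_apply, scalar_apply, h]

theorem auxFlip_apply (i j k l : Fin 2) :
    auxFlip 𝒜 i j k l = if i = l ∧ j = k then 1 else 0 := by
  simp [auxFlip, single_apply, and_comm]

theorem mul_apply₄ (X Y : Matrix (Fin 2) (Fin 2) (Matrix (Fin 2) (Fin 2) 𝒜)) (i j k l : Fin 2) :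
    (X * Y) i j k l = X i 0 k 0 * Y 0 j 0 l + X i 0 k 1 * Y 0 j 1 l +
      (X i 1 k 0 * Y 1 j 0 l + X i 1 k 1 * Y 1 j 1 l) := by
  rw [Matrix.mul_apply, Fin.sum_univ_two, Matrix.add_apply, Matrix.mul_apply, Matrix.mul_apply,
    Fin.sum_univ_two, Fin.sum_univ_two]

theorem ext₄ {𝒜 : Type*} {X Y : Matrix (Fin 2) (Fin 2) (Matrix (Fin 2) (Fin 2) 𝒜)}
    (h : ∀ i j k l, X i j k l = Y i j k l) : X = Y := by
  ext i j k l
  exact h i j k l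

theorem auxFlip_mul_self : auxFlip 𝒜 * auxFlip 𝒜 = 1 := by
  refine ext₄ fun i j k l => ?_
  simp only [mul_apply₄, auxFlip_apply, Matrix.one_apply]
  fin_cases i <;> fin_cases j <;> fin_cases k <;> fin_cases l <;> simp

theorem auxFlip_mul_aux₁ (X : Matrix (Fin 2) (Fin 2) 𝒜) :
    auxFlip 𝒜 * aux₁ R X = aux₂ R X * auxFlip 𝒜 := by
  refine ext₄ fun i j k l => ?_
  simp only [mul_apply₄, auxFlip_apply, aux₁_apply, aux₂_apply]
  fin_cases i <;> fin_cases j <;> fin_cases k <;> fin_cases l <;> simp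

theorem auxFlip_mul_aux₂ (X : Matrix (Fin 2) (Fin 2) 𝒜) :
    auxFlip 𝒜 * aux₂ R X = aux₁ R X * auxFlip 𝒜 := by
  rw [← mul_one (auxFlip 𝒜 * _), ← auxFlip_mul_self, ← mul_assoc, mul_assoc (auxFlip 𝒜),
    ← auxFlip_mul_aux₁, ← mul_assoc (auxFlip 𝒜), auxFlip_mul_self, one_mul]

theorem aux₁_mul_aux₂_apply (X Y : Matrix (Fin 2) (Fin 2) 𝒜) (i j k l : Fin 2) :
    (aux₁ R X * aux₂ R Y) i j k l = X i j * Y k l := by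
  simp only [mul_apply₄, aux₁_apply, aux₂_apply]
  fin_cases i <;> fin_cases j <;> fin_cases k <;> fin_cases l <;> simp

theorem aux₂_mul_aux₁_apply (X Y : Matrix (Fin 2) (Fin 2) 𝒜) (i j k l : Fin 2) :
    (aux₂ R Y * aux₁ R X) i j k l = Y k l * X i j := by
  simp only [mul_apply₄, aux₁_apply, aux₂_apply]
  fin_cases i <;> fin_cases j <;> fin_cases k <;> fin_cases l <;> simp

theorem aux₁_commute_aux₂ {X Y : Matrix (Fin 2) (Fin 2) 𝒜}
    (h : ∀ i j k l, Commute (X i j) (Y k l)) : aux₁ R X * aux₂ R Y = aux₂ R Y * aux₁ R X := by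
  refine ext₄ fun i j k l => ?_
  rw [aux₁_mul_aux₂_apply, aux₂_mul_aux₁_apply, (h i j k l).eq]

/-- Sklyanin's reflection equation for a pair of matrices at spectral parameters `x`, `y`. -/
def ReflectionEq (η x y : R) (X Y : Matrix (Fin 2) (Fin 2) 𝒜) : Prop :=
  ((x - y) • 1 + η • auxFlip 𝒜) * aux₁ R X * ((x + y) • 1 + η • auxFlip 𝒜) * aux₂ R Y =
    aux₂ R Y * ((x + y) • 1 + η • auxFlip 𝒜) * aux₁ R X * ((x - y) • 1 + η • auxFlip 𝒜)

/-- A boundary matrix `α + x B` with `B` traceless solves the reflection equation. -/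
theorem reflectionEq_auxMat (η x y α : R) {B : Matrix (Fin 2) (Fin 2) R} (hB : B.trace = 0) :
    ReflectionEq η x y (auxMat 𝒜 (α • 1 + x • B)) (auxMat 𝒜 (α • 1 + y • B)) := by
  have h1 : B 1 1 = - B 0 0 := by
    rw [trace_fin_two] at hB
    linear_combination hB
  have hlin : ∀ t : R, auxMat 𝒜 (α • 1 + t • B) = α • 1 + t • auxMat 𝒜 B := by
    intro t
    ext i j
    fin_cases i <;> fin_cases j <;>
      simp [auxMat, Algebra.algebraMap_eq_smul_one, add_smul, mul_smul]
  have hsq : auxMat 𝒜 B * auxMat 𝒜 B = (B 0 0 ^ 2 + B 0 1 * B 1 0) • 1 := by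
    ext i j
    rw [Matrix.mul_apply, Fin.sum_univ_two]
    fin_cases i <;> fin_cases j <;>
      simp [auxMat, h1, Algebra.smul_def, mul_comm, ← map_mul, ← map_add] <;> ring_nf
  have hc : aux₁ R (auxMat 𝒜 B) * aux₂ R (auxMat 𝒜 B) =
      aux₂ R (auxMat 𝒜 B) * aux₁ R (auxMat 𝒜 B) :=
    aux₁_commute_aux₂ fun i j k l => Algebra.commute_algebraMap_left _ _
  have h11 : aux₁ R (auxMat 𝒜 B) * aux₁ R (auxMat 𝒜 B) = (B 0 0 ^ 2 + B 0 1 * B 1 0) • 1 := by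
    rw [← map_mul, hsq, map_smul, map_one]
  have h22 : aux₂ R (auxMat 𝒜 B) * aux₂ R (auxMat 𝒜 B) = (B 0 0 ^ 2 + B 0 1 * B 1 0) • 1 := by
    rw [← map_mul, hsq, map_smul, map_one]
  have hp1 := auxFlip_mul_aux₁ (R := R) (auxMat 𝒜 B)
  have hp2 := auxFlip_mul_aux₂ (R := R) (auxMat 𝒜 B)
  have hpp := auxFlip_mul_self (𝒜 := 𝒜)
  simp only [ReflectionEq, hlin, map_add, map_smul, map_one]
  generalize aux₁ R (auxMat 𝒜 B) = b₁ at *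
  generalize aux₂ R (auxMat 𝒜 B) = b₂ at *
  generalize auxFlip 𝒜 = p at *
  have h22' : ∀ Z, b₂ * (b₂ * Z) = (B 0 0 ^ 2 + B 0 1 * B 1 0) • Z := fun Z => by
    rw [← mul_assoc, h22, smul_one_mul]
  have h11' : ∀ Z, b₁ * (b₁ * Z) = (B 0 0 ^ 2 + B 0 1 * B 1 0) • Z := fun Z => by
    rw [← mul_assoc, h11, smul_one_mul]
  simp only [mul_add, add_mul, smul_mul_assoc, mul_smul_comm, one_mul, mul_one, mul_assoc, hp1, hp2,
    hpp, h22, hc, h22', h11']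
  module

/-- Dressing with a site preserves the reflection equation. -/
theorem ReflectionEq.lax {e : Fin 2 → Fin 2 → 𝒜} (he : IsMatrixUnits e) {η x y : R}
    {X Y : Matrix (Fin 2) (Fin 2) 𝒜} (h : ReflectionEq η x y X Y)
    (hX : ∀ a b, Commute X (scalar (Fin 2) (e a b)))
    (hY : ∀ a b, Commute Y (scalar (Fin 2) (e a b))) (t : R) :
    ReflectionEq η x y (lax e η (x - t) * X * lax e η (x + t))
      (lax e η (y - t) * Y * lax e η (y + t)) := by
  have hX2 : aux₁ R X * aux₂ R (siteFlip e) = aux₂ R (siteFlip e) * aux₁ R X :=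
    aux₁_commute_aux₂ fun i j k l => commute_entry_of_scalar (hX l k) i j
  have hY1 : aux₁ R (siteFlip e) * aux₂ R Y = aux₂ R Y * aux₁ R (siteFlip e) :=
    aux₁_commute_aux₂ fun i j k l => (commute_entry_of_scalar (hY j i) k l).symm
  have hq : aux₁ R (siteFlip e) * aux₁ R (siteFlip e) = 1 := by
    rw [← map_mul, he.siteFlip_mul_self, map_one]
  have hr : aux₂ R (siteFlip e) * aux₂ R (siteFlip e) = 1 := by
    rw [← map_mul, he.siteFlip_mul_self, map_one]
  have hpq := auxFlip_mul_aux₁ (R := R) (siteFlip e)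
  have hpr := auxFlip_mul_aux₂ (R := R) (siteFlip e)
  have hpp := auxFlip_mul_self (𝒜 := 𝒜)
  have hqr : aux₁ R (siteFlip e) * aux₂ R (siteFlip e) = auxFlip 𝒜 * aux₁ R (siteFlip e) := by
    refine ext₄ fun i j k l => ?_
    rw [aux₁_mul_aux₂_apply]
    simp only [mul_apply₄, auxFlip_apply, aux₁_apply, siteFlip_apply, he.mul]
    fin_cases i <;> fin_cases j <;> fin_cases k <;> fin_cases l <;> simp
  have hrq : aux₂ R (siteFlip e) * aux₁ R (siteFlip e) = auxFlip 𝒜 * aux₂ R (siteFlip e) := by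
    refine ext₄ fun i j k l => ?_
    rw [aux₂_mul_aux₁_apply]
    simp only [mul_apply₄, auxFlip_apply, aux₂_apply, siteFlip_apply, he.mul]
    fin_cases i <;> fin_cases j <;> fin_cases k <;> fin_cases l <;> simp
  rw [ReflectionEq] at h ⊢
  have y1 := yangBaxter_of_transpositions _ _ _ hpp hqr hpq.symm hrq hpr.symm η (x - t) (y - t)
  have y2 := yangBaxter_of_transpositions _ _ _ hpp hqr hpq.symm hrq hpr.symm η (x + t) (y + t)
  have y3 := yangBaxter_of_transpositions' _ _ _ hq hr hqr hpq.symm hrq hpr.symm η (x + t) (y - t)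
  have y4 := yangBaxter_of_transpositions' _ _ _ hq hr hqr hpq.symm hrq hpr.symm η (x - t) (y + t)
  rw [show x - t - (y - t) = x - y by ring] at y1
  rw [show x + t - (y + t) = x - y by ring] at y2
  rw [show x + t + (y - t) = x + y by ring] at y3
  rw [show x - t + (y + t) = x + y by ring] at y4
  have hX2' : ∀ u : R, aux₁ R X * (u • 1 + η • aux₂ R (siteFlip e)) =
      (u • 1 + η • aux₂ R (siteFlip e)) * aux₁ R X := fun u => by
    simp only [mul_add, add_mul, mul_smul_comm, smul_mul_assoc, mul_one, one_mul, hX2]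
  have hY1' : ∀ u : R, (u • 1 + η • aux₁ R (siteFlip e)) * aux₂ R Y =
      aux₂ R Y * (u • 1 + η • aux₁ R (siteFlip e)) := fun u => by
    simp only [mul_add, add_mul, mul_smul_comm, smul_mul_assoc, mul_one, one_mul, hY1]
  have hX2a := hX2' (y - t)
  have hX2b := hX2' (y + t)
  have hY1a := hY1' (x - t)
  have hY1b := hY1' (x + t)
  simp only [OpenXXX.lax, map_mul, map_add, map_smul, map_one]
  clear hX2' hY1' hX hY hqr hrq hpq hpr hpp hq hr hX2 hY1
  generalize (x - y) • 1 + η • auxFlip 𝒜 = D at *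
  generalize (x + y) • 1 + η • auxFlip 𝒜 = S at *
  generalize (x - t) • 1 + η • aux₁ R (siteFlip e) = A at *
  generalize (x + t) • 1 + η • aux₁ R (siteFlip e) = B at *
  generalize (y - t) • 1 + η • aux₂ R (siteFlip e) = A' at *
  generalize (y + t) • 1 + η • aux₂ R (siteFlip e) = B' at *
  generalize aux₁ R X = U at *
  generalize aux₂ R Y = V at *
  calc D * (A * U * B) * S * (A' * V * B')
      = D * A * U * (B * S * A') * V * B' := by simp only [mul_assoc]
    _ = D * A * (U * A') * S * (B * V) * B' := by rw [y3]; simp only [mul_assoc]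
    _ = (D * A * A') * U * S * V * (B * B') := by rw [hX2a, hY1b]; simp only [mul_assoc]
    _ = A' * A * (D * U * S * V) * (B * B') := by rw [y1]; simp only [mul_assoc]
    _ = A' * A * V * S * U * (D * B * B') := by rw [h]; simp only [mul_assoc]
    _ = A' * (A * V) * S * (U * B') * B * D := by rw [y2]; simp only [mul_assoc]
    _ = A' * V * (A * S * B') * U * B * D := by rw [hX2b, hY1a]; simp only [mul_assoc]
    _ = A' * V * B' * S * (A * U * B) * D := by rw [y4]; simp only [mul_assoc]

theorem reflectionEq_dressed {e : ι → Fin 2 → Fin 2 → 𝒜} (he : ∀ n, IsMatrixUnits (e n))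
    {l : List ι} (hl : l.Pairwise fun m n => ∀ a b c d, Commute (e m a b) (e n c d)) (η : R)
    (ξ : ι → R) (x y α : R) {B : Matrix (Fin 2) (Fin 2) R} (hB : B.trace = 0) :
    ReflectionEq η x y (dressed e η ξ x (auxMat 𝒜 (α • 1 + x • B)) l)
      (dressed e η ξ y (auxMat 𝒜 (α • 1 + y • B)) l) := by
  induction l with
  | nil => exact reflectionEq_auxMat η x y α hB
  | cons n l ih =>
    obtain ⟨h1, h2⟩ := List.pairwise_cons.mp hl
    exact (ih h2).lax (he n)
      (fun a b => commute_dressed (fun m hm c d => (h1 m hm a b c d).symm) _ _ _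
        (commute_auxMat _ _))
      (fun a b => commute_dressed (fun m hm c d => (h1 m hm a b c d).symm) _ _ _
        (commute_auxMat _ _)) (ξ n)

/-- The entries of the reflection equation. -/
theorem ReflectionEq.entry {η x y : R} {X Y : Matrix (Fin 2) (Fin 2) 𝒜}
    (h : ReflectionEq η x y X Y) (i j k l : Fin 2) :
    ((x - y) * (x + y)) • (X i j * Y k l) + (η * (x - y)) • (if j = k then (X * Y) i l else 0)
        + (η * (x + y)) • (X k j * Y i l) + (η * η) • (if i = j then (X * Y) k l else 0) =
      ((x - y) * (x + y)) • (Y k l * X i j) + (η * (x - y)) • (if i = l then (Y * X) k j else 0)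
        + (η * (x + y)) • (Y k j * X i l) + (η * η) • (if i = j then (Y * X) k l else 0) := by
  have H := congrFun (congrFun (congrFun (congrFun h i) j) k) l
  have hp1 := auxFlip_mul_aux₁ (R := R) X
  have hp2 := auxFlip_mul_aux₂ (R := R) Y
  have hpp := auxFlip_mul_self (𝒜 := 𝒜)
  have a1 : ∀ (Z : Matrix (Fin 2) (Fin 2) (Matrix (Fin 2) (Fin 2) 𝒜)) (i j k l : Fin 2),
      (auxFlip 𝒜 * Z) i j k l = Z k j i l := by
    intro Z i j k l
    simp only [mul_apply₄, auxFlip_apply]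
    fin_cases i <;> fin_cases k <;> simp
  have a2 : ∀ (Z : Matrix (Fin 2) (Fin 2) (Matrix (Fin 2) (Fin 2) 𝒜)) (i j k l : Fin 2),
      (Z * auxFlip 𝒜) i j k l = Z i l k j := by
    intro Z i j k l
    simp only [mul_apply₄, auxFlip_apply]
    fin_cases j <;> fin_cases l <;> simp
  have a3 : ∀ i j k l : Fin 2, (aux₁ R X * (auxFlip 𝒜 * aux₂ R Y)) i j k l =
      if j = k then (X * Y) i l else 0 := by
    intro i j k l
    rw [hp2, ← mul_assoc, a2, ← map_mul, aux₁_apply]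
    simp only [eq_comm]
  have a4 : ∀ i j k l : Fin 2, (aux₂ R Y * (auxFlip 𝒜 * aux₁ R X)) i j k l =
      if i = l then (Y * X) k j else 0 := by
    intro i j k l
    rw [hp1, ← mul_assoc, a2, ← map_mul, aux₂_apply]
  simp only [mul_add, add_mul, smul_mul_assoc, mul_smul_comm, one_mul, mul_one, mul_assoc,
    Matrix.add_apply, Matrix.smul_apply, a1, aux₁_mul_aux₂_apply, aux₂_mul_aux₁_apply, a3] at H
  simp only [← mul_assoc, a2, aux₂_mul_aux₁_apply] at H
  simp only [mul_assoc, a4] at H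
  simp only [smul_add, smul_smul] at H
  have e1 : (if j = i then (X * Y) k l else 0) = if i = j then (X * Y) k l else 0 := by
    simp only [eq_comm]
  rw [e1] at H
  refine Eq.trans ?_ (H.trans ?_)
  · module
  · module

/-- Two solutions of the reflection equation, traced against a boundary matrix, commute: the
sixteen entries of the reflection equation are combined with the entries of
`R(y - x) K(x + η) R(-x - y - 2 η) K(y + η)`. -/
theorem ReflectionEq.trace_mul_comm {η x y α : R} {X Y : Matrix (Fin 2) (Fin 2) 𝒜}
    (h : ReflectionEq η x y X Y) {B : Matrix (Fin 2) (Fin 2) R} (hB : B.trace = 0) :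
    (((x - y) ^ 2 - η ^ 2) * ((x + y) * (x + y + 2 * η))) •
      (trace (auxMat 𝒜 (α • 1 + (x + η) • B) * X) * trace (auxMat 𝒜 (α • 1 + (y + η) • B) * Y)) =
    (((x - y) ^ 2 - η ^ 2) * ((x + y) * (x + y + 2 * η))) •
      (trace (auxMat 𝒜 (α • 1 + (y + η) • B) * Y) *
        trace (auxMat 𝒜 (α • 1 + (x + η) • B) * X)) := by
  have h1 : B 1 1 = - B 0 0 := by
    rw [trace_fin_two] at hB
    linear_combination hB
  let w : Fin 2 → Fin 2 → Fin 2 → Fin 2 → R := fun i j k l =>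
    (x - y) * (x + y + 2 * η) * ((α • 1 + (x + η) • B) j i * (α • 1 + (y + η) • B) l k)
    - (x - y) * η *
        (if i = l then ((α • 1 + (x + η) • B) * (α • 1 + (y + η) • B)) j k else 0)
    - η * (x + y + 2 * η) * ((α • 1 + (x + η) • B) l i * (α • 1 + (y + η) • B) j k)
    + η * η * (if i = j then ((α • 1 + (x + η) • B) * (α • 1 + (y + η) • B)) l k else 0)
  have H : ∀ i j k l, _ := fun i j k l => congrArg (fun Z => w i j k l • Z) (h.entry i j k l)
  have H' := congrArg₂ (· + ·) (congrArg₂ (· + ·) (congrArg₂ (· + ·) (congrArg₂ (· + ·)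
    (H 0 0 0 0) (H 0 0 0 1)) (congrArg₂ (· + ·) (H 0 0 1 0) (H 0 0 1 1)))
    (congrArg₂ (· + ·) (congrArg₂ (· + ·)
    (H 0 1 0 0) (H 0 1 0 1)) (congrArg₂ (· + ·) (H 0 1 1 0) (H 0 1 1 1))))
    (congrArg₂ (· + ·) (congrArg₂ (· + ·) (congrArg₂ (· + ·)
    (H 1 0 0 0) (H 1 0 0 1)) (congrArg₂ (· + ·) (H 1 0 1 0) (H 1 0 1 1)))
    (congrArg₂ (· + ·) (congrArg₂ (· + ·)
    (H 1 1 0 0) (H 1 1 0 1)) (congrArg₂ (· + ·) (H 1 1 1 0) (H 1 1 1 1))))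
  simp only [w, if_true, zero_ne_one, one_ne_zero, if_false, Matrix.mul_apply, Fin.sum_univ_two,
    Matrix.add_apply, Matrix.smul_apply, Matrix.one_apply, smul_eq_mul, h1, smul_zero, add_zero]
    at H'
  simp only [trace_fin_two, auxMat, Matrix.mul_apply, Fin.sum_univ_two, map_apply,
    Matrix.add_apply, Matrix.smul_apply, Matrix.one_apply, if_true, zero_ne_one, one_ne_zero,
    if_false, smul_eq_mul, h1, Algebra.algebraMap_eq_smul_one, smul_mul_assoc, one_mul, mul_add,
    add_mul, mul_smul_comm]
  refine sub_eq_zero.mp ((sub_eq_zero.mpr H').symm.trans ?_).symm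
  module

end Abstract

/-! ### The spin chain in terms of matrix units -/

section Chain

variable {N : ℕ} {R : Type*} [CommRing R]

/-- The matrix units of the site `n` as operators on the quantum space. -/
def siteUnit (R : Type*) [CommRing R] (n : Fin N) (a b : Fin 2) : Matrix (Conf N) (Conf N) R :=
  Matrix.of fun s t => if s n = a ∧ t = Function.update s n b then 1 else 0

theorem siteUnit_mul_apply (n : Fin N) (a b : Fin 2) (X : Matrix (Conf N) (Conf N) R)
    (s t : Conf N) :
    (siteUnit R n a b * X) s t = if s n = a then X (Function.update s n b) t else 0 := by
  simp only [Matrix.mul_apply, siteUnit, of_apply, ite_mul, one_mul, zero_mul]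
  by_cases h : s n = a <;> simp [h]

theorem update_eq_comm (n : Fin N) {s t : Conf N} {a b : Fin 2} :
    (s n = a ∧ t = Function.update s n b) ↔ (t n = b ∧ s = Function.update t n a) := by
  constructor
  · rintro ⟨rfl, rfl⟩
    simp
  · rintro ⟨rfl, rfl⟩
    simp

theorem siteUnit_transpose (n : Fin N) (a b : Fin 2) :
    (siteUnit R n a b)ᵀ = siteUnit R n b a := by
  ext s t
  simp only [siteUnit, transpose_apply, of_apply, update_eq_comm n (s := s)]

theorem mul_siteUnit_apply (n : Fin N) (a b : Fin 2) (X : Matrix (Conf N) (Conf N) R)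
    (s t : Conf N) :
    (X * siteUnit R n a b) s t = if t n = b then X s (Function.update t n a) else 0 := by
  rw [← transpose_transpose (X * _), transpose_mul, siteUnit_transpose, transpose_apply,
    siteUnit_mul_apply, transpose_apply]

theorem isMatrixUnits_siteUnit (n : Fin N) : IsMatrixUnits (siteUnit R n) where
  mul a b c d := by
    ext s t
    rw [siteUnit_mul_apply]
    by_cases hbc : b = c <;> by_cases hs : s n = a <;> simp [siteUnit, hbc, hs]
  sum := by
    ext s t
    have h2 : s n = 0 ∨ s n = 1 := by
      generalize s n = i
      fin_cases i <;> simp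
    rcases h2 with h | h
    · have : Function.update s n 0 = s := by rw [← h, Function.update_eq_self]
      simp [siteUnit, h, this, Matrix.one_apply, eq_comm]
    · have : Function.update s n 1 = s := by rw [← h, Function.update_eq_self]
      simp [siteUnit, h, this, Matrix.one_apply, eq_comm]

theorem siteUnit_commute (m n : Fin N) (hmn : m ≠ n) (a b c d : Fin 2) :
    Commute (siteUnit R m a b) (siteUnit R n c d) := by
  ext s t
  rw [siteUnit_mul_apply, siteUnit_mul_apply]
  simp only [siteUnit, of_apply, Function.update_of_ne hmn, Function.update_of_ne hmn.symm,
    Function.update_comm hmn]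
  by_cases h1 : s m = a <;> by_cases h2 : s n = c <;> simp [h1, h2]

theorem siteUnit_map {S : Type*} [CommRing S] (f : R →+* S) (n : Fin N) (a b : Fin 2) :
    f.mapMatrix (siteUnit R n a b) = siteUnit S n a b := by
  ext s t
  simp only [siteUnit, RingHom.mapMatrix_apply, map_apply, of_apply]
  split <;> simp

/-- The double-row transfer matrix of the chain on the quantum space, with the last site
outermost. -/
def chainT (η : R) (ξ : Fin N → R) (α : R) (B : Matrix (Fin 2) (Fin 2) R) (α' : R)
    (B' : Matrix (Fin 2) (Fin 2) R) (x : R) : Matrix (Conf N) (Conf N) R :=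
  openT (siteUnit R) η ξ (List.finRange N).reverse α B α' B' x

theorem nodup_sites : (List.finRange N).reverse.Nodup :=
  List.nodup_reverse.mpr (List.nodup_finRange N)

/-- Transposition of the transfer matrix changes the signs of the inhomogeneities. -/
theorem openT_transpose (η : R) (ξ : Fin N → R) (l : List (Fin N)) (α : R)
    (B : Matrix (Fin 2) (Fin 2) R) (α' : R) (B' : Matrix (Fin 2) (Fin 2) R) (x : R) :
    (openT (siteUnit R) η ξ l α B α' B' x)ᵀ = openT (siteUnit R) η (-ξ) l α Bᵀ α' B'ᵀ x := by
  let θ : Matrix (Fin 2) (Fin 2) (Matrix (Conf N) (Conf N) R) →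
      Matrix (Fin 2) (Fin 2) (Matrix (Conf N) (Conf N) R) := fun X => Matrix.of fun a b => (X b a)ᵀ
  have hmul : ∀ X Y, θ (X * Y) = θ Y * θ X := by
    intro X Y
    refine Matrix.ext fun a b => ?_
    simp [θ, Matrix.mul_apply, transpose_mul]
  have hlax : ∀ n u, θ (lax (siteUnit R n) η u) = lax (siteUnit R n) η u := by
    intro n u
    refine Matrix.ext fun a b => ?_
    simp only [θ, lax, of_apply, Matrix.add_apply, Matrix.smul_apply, siteFlip_apply,
      transpose_add, transpose_smul, siteUnit_transpose, Matrix.one_apply]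
    by_cases h : a = b
    · simp [h]
    · simp [h, Ne.symm h]
  have haux : ∀ K : Matrix (Fin 2) (Fin 2) R,
      θ (auxMat (Matrix (Conf N) (Conf N) R) K) = auxMat (Matrix (Conf N) (Conf N) R) Kᵀ := by
    intro K
    refine Matrix.ext fun a b => ?_
    simp [θ, auxMat, Algebra.algebraMap_eq_smul_one]
  have hdr : ∀ K : Matrix (Fin 2) (Fin 2) R,
      θ (dressed (siteUnit R) η ξ x (auxMat (Matrix (Conf N) (Conf N) R) K) l) =
        dressed (siteUnit R) η (-ξ) x (auxMat (Matrix (Conf N) (Conf N) R) Kᵀ) l := by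
    intro K
    induction l with
    | nil => exact haux K
    | cons n l ih =>
      simp only [dressed, hmul, hlax, ih, Pi.neg_apply, sub_neg_eq_add, ← sub_eq_add_neg, mul_assoc]
  have htr : ∀ X : Matrix (Fin 2) (Fin 2) (Matrix (Conf N) (Conf N) R),
      (trace X)ᵀ = trace (θ X) := by
    intro X
    simp [trace_fin_two, θ]
  have hK : ∀ (β t : R) (C : Matrix (Fin 2) (Fin 2) R), (β • 1 + t • C)ᵀ = β • 1 + t • Cᵀ := by
    intro β t C
    simp
  rw [openT, openT, htr, hmul, haux, hdr, hK, hK]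
  simp only [trace_fin_two, Matrix.mul_apply, Fin.sum_univ_two, auxMat, map_apply]
  simp only [← Algebra.commutes]
  abel

/-- The transfer matrix is compatible with ring homomorphisms. -/
theorem openT_map {S : Type*} [CommRing S] (f : R →+* S) (η : R) (ξ : Fin N → R)
    (l : List (Fin N)) (α : R) (B : Matrix (Fin 2) (Fin 2) R) (α' : R)
    (B' : Matrix (Fin 2) (Fin 2) R) (x : R) :
    f.mapMatrix (openT (siteUnit R) η ξ l α B α' B' x) =
      openT (siteUnit S) (f η) (f ∘ ξ) l (f α) (f.mapMatrix B) (f α') (f.mapMatrix B') (f x) := by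
  have hlax : ∀ n u, (f.mapMatrix (m := Conf N)).mapMatrix (lax (siteUnit R n) η u) =
      lax (siteUnit S n) (f η) (f u) := by
    intro n u
    refine Matrix.ext fun a b => ?_
    simp only [lax, RingHom.mapMatrix_apply, map_apply, Matrix.add_apply, Matrix.smul_apply,
      siteFlip_apply, Matrix.one_apply]
    rw [Matrix.map_add _ (map_add f), ← siteUnit_map f]
    congr 1
    · ext s t
      split <;> simp [Matrix.one_apply, apply_ite f]
    · ext s t
      simp
  have haux : ∀ K : Matrix (Fin 2) (Fin 2) R,
      (f.mapMatrix (m := Conf N)).mapMatrix (auxMat (Matrix (Conf N) (Conf N) R) K) =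
        auxMat (Matrix (Conf N) (Conf N) S) (f.mapMatrix K) := by
    intro K
    ext a b s t
    simp [auxMat, Matrix.algebraMap_matrix_apply, apply_ite f]
  have hdr : ∀ K : Matrix (Fin 2) (Fin 2) R, (f.mapMatrix (m := Conf N)).mapMatrix
      (dressed (siteUnit R) η ξ x (auxMat (Matrix (Conf N) (Conf N) R) K) l) =
      dressed (siteUnit S) (f η) (f ∘ ξ) (f x)
        (auxMat (Matrix (Conf N) (Conf N) S) (f.mapMatrix K)) l := by
    intro K
    induction l with
    | nil => exact haux K
    | cons n l ih =>
      simp only [dressed, map_mul, hlax, ih, map_add, map_sub, Function.comp]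
  have htr : ∀ X : Matrix (Fin 2) (Fin 2) (Matrix (Conf N) (Conf N) R),
      f.mapMatrix (trace X) = trace ((f.mapMatrix (m := Conf N)).mapMatrix X) := by
    intro X
    rw [trace_fin_two, trace_fin_two, map_add]
    rfl
  have hK : ∀ (β t : R) (C : Matrix (Fin 2) (Fin 2) R),
      f.mapMatrix (β • 1 + t • C) = f β • 1 + f t • f.mapMatrix C := by
    intro β t C
    ext i j
    simp [Matrix.one_apply, apply_ite f]
  rw [openT, openT, htr, map_mul, haux, hdr, hK, hK, map_add]

theorem chainT_map {S : Type*} [CommRing S] (f : R →+* S) (η : R) (ξ : Fin N → R) (α : R)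
    (B : Matrix (Fin 2) (Fin 2) R) (α' : R) (B' : Matrix (Fin 2) (Fin 2) R) (x : R) :
    f.mapMatrix (chainT η ξ α B α' B' x) =
      chainT (f η) (f ∘ ξ) (f α) (f.mapMatrix B) (f α') (f.mapMatrix B') (f x) :=
  openT_map f η ξ _ α B α' B' x

end Chain

section Abstract

variable {R 𝒜 ι : Type*} [CommRing R] [Ring 𝒜] [Algebra R 𝒜]

theorem dressed_eq_prod (e : ι → Fin 2 → Fin 2 → 𝒜) (η : R) (ξ : ι → R) (x : R)
    (K : Matrix (Fin 2) (Fin 2) 𝒜) (l : List ι) :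
    dressed e η ξ x K l = (l.map fun n => lax (e n) η (x - ξ n)).prod * K *
      (l.reverse.map fun n => lax (e n) η (x + ξ n)).prod := by
  induction l with
  | nil => simp [dressed]
  | cons n l ih => simp [dressed, ih, mul_assoc]

end Abstract

/-! ### The transfer matrix as a product of Lax operators -/

section Translation

variable {N : ℕ}

/-- An operator on the auxiliary and the quantum space as a `2 × 2` matrix of operators. -/
def toBlocks (N : ℕ) : Matrix (Fin 2 × Conf N) (Fin 2 × Conf N) ℂ ≃+*
    Matrix (Fin 2) (Fin 2) (Matrix (Conf N) (Conf N) ℂ) :=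
  (compRingEquiv (Fin 2) (Conf N) ℂ).symm

theorem toBlocks_apply (X : Matrix (Fin 2 × Conf N) (Fin 2 × Conf N) ℂ) (a b : Fin 2)
    (s t : Conf N) : toBlocks N X a b s t = X (a, s) (b, t) := rfl

theorem RMat_apply (η z : ℂ) (a b k l : Fin 2) :
    RMat η z (a, k) (b, l) = (if a = b ∧ k = l then z else 0) + if a = l ∧ k = b then η else 0 := by
  fin_cases a <;> fin_cases b <;> fin_cases k <;> fin_cases l <;>
    simp [RMat, finProdFinEquiv, Matrix.of_apply, Matrix.cons_val]

theorem toBlocks_actAt (n : Fin N) (η z : ℂ) :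
    toBlocks N (actAt n (RMat η z)) = lax (siteUnit ℂ n) η z := by
  ext a b s t
  have h1 : (s = t) ↔ (∀ m, m ≠ n → s m = t m) ∧ s n = t n := by
    constructor
    · rintro rfl
      simp
    · rintro ⟨h, h'⟩
      ext1 m
      by_cases hm : m = n
      · rw [hm, h']
      · exact h m hm
  have h2 : (t = Function.update s n a) ↔ (∀ m, m ≠ n → s m = t m) ∧ a = t n := by
    constructor
    · rintro rfl
      refine ⟨fun m hm => by simp [hm], by simp⟩
    · rintro ⟨h, h'⟩
      ext1 m
      by_cases hm : m = n
      · rw [hm, Function.update_self, h']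
      · rw [Function.update_of_ne hm, h m hm]
  have h3 : (1 : Matrix (Fin 2) (Fin 2) (Matrix (Conf N) (Conf N) ℂ)) a b s t =
      if a = b ∧ s = t then 1 else 0 := by
    by_cases h : a = b <;> simp [h, Matrix.one_apply]
  simp only [toBlocks_apply, actAt, of_apply, RMat_apply, lax, Matrix.add_apply,
    Matrix.smul_apply, h3, siteFlip_apply, siteUnit, h1, h2]
  by_cases h : ∀ m, m ≠ n → s m = t m
  · have h4 : (∀ m, m ≠ n → s m = t m) = True := eq_true h
    simp only [h4, and_comm, true_and, if_true, smul_eq_mul, mul_ite, mul_one, mul_zero]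
  · simp [h]

theorem toBlocks_onAux (X : Matrix (Fin 2) (Fin 2) ℂ) :
    toBlocks N (onAux N X) = auxMat (Matrix (Conf N) (Conf N) ℂ) X := by
  ext a b s t
  simp [toBlocks_apply, onAux, auxMat, kroneckerMap_apply, Matrix.algebraMap_matrix_apply,
    Matrix.one_apply]

theorem toBlocks_auxTranspose (X : Matrix (Fin 2 × Conf N) (Fin 2 × Conf N) ℂ) :
    toBlocks N (auxTranspose X) = (toBlocks N X)ᵀ := rfl

theorem auxTrace_eq (X : Matrix (Fin 2 × Conf N) (Fin 2 × Conf N) ℂ) :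
    auxTrace X = trace (toBlocks N X) := by
  ext s t
  simp [auxTrace, trace_fin_two, toBlocks_apply]

theorem toBlocks_monodromy (η : ℂ) (ξ : Fin N → ℂ) (z : ℂ) :
    toBlocks N (monodromy η ξ z) = ((List.finRange N).reverse.map fun n =>
      lax (siteUnit ℂ n) η (z - ξ n - η / 2)).prod := by
  rw [monodromy, map_list_prod, List.map_map]
  congr 1
  refine List.map_congr_left fun n _ => ?_
  simp [toBlocks_actAt]

theorem auxMat_sigmaY_mul_self :
    auxMat (Matrix (Conf N) (Conf N) ℂ) sigmaY * auxMat (Matrix (Conf N) (Conf N) ℂ) sigmaY = 1 := by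
  have h : sigmaY * sigmaY = 1 := by
    ext i j
    fin_cases i <;> fin_cases j <;> simp [sigmaY, Matrix.mul_apply, Fin.sum_univ_two]
  rw [auxMat, ← Matrix.map_mul, h]
  exact map_one (algebraMap ℂ (Matrix (Conf N) (Conf N) ℂ)).mapMatrix

/-- Crossing symmetry of the Lax operator. -/
theorem sigmaY_lax_transpose (n : Fin N) (η w : ℂ) :
    auxMat (Matrix (Conf N) (Conf N) ℂ) sigmaY * (lax (siteUnit ℂ n) η w)ᵀ *
      auxMat (Matrix (Conf N) (Conf N) ℂ) sigmaY = - lax (siteUnit ℂ n) η (-w - η) := by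
  have hs := (isMatrixUnits_siteUnit (R := ℂ) n).sum
  have h0 : siteUnit ℂ n 0 0 = 1 - siteUnit ℂ n 1 1 := by rw [← hs, add_sub_cancel_right]
  have hσ : ∀ X : Matrix (Fin 2) (Fin 2) (Matrix (Conf N) (Conf N) ℂ),
      auxMat (Matrix (Conf N) (Conf N) ℂ) sigmaY * X * auxMat (Matrix (Conf N) (Conf N) ℂ) sigmaY =
        !![X 1 1, -X 1 0; -X 0 1, X 0 0] := by
    intro X
    refine Matrix.ext fun a b => ?_
    simp only [Matrix.mul_apply, Fin.sum_univ_two, auxMat, map_apply,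
      Algebra.algebraMap_eq_smul_one, smul_mul_assoc, one_mul, mul_smul_comm, mul_one]
    fin_cases a <;> fin_cases b <;> simp [sigmaY, smul_smul]
  rw [hσ]
  refine Matrix.ext fun a b => ?_
  fin_cases a <;> fin_cases b <;> simp [lax, h0] <;> module

/-- Crossing symmetry of a product of Lax operators. The transposition acts on the auxiliary space
only and reverses the product, because the entries at different sites commute. -/
theorem sigmaY_prod_transpose (η : ℂ) (w : Fin N → ℂ) (l : List (Fin N)) (hl : l.Nodup) :
    ((-1 : ℂ) ^ l.length) • (auxMat (Matrix (Conf N) (Conf N) ℂ) sigmaY *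
      ((l.map fun n => lax (siteUnit ℂ n) η (w n)).prod)ᵀ *
        auxMat (Matrix (Conf N) (Conf N) ℂ) sigmaY) =
      (l.reverse.map fun n => lax (siteUnit ℂ n) η (-w n - η)).prod := by
  induction l with
  | nil => simp [auxMat_sigmaY_mul_self]
  | cons n l ih =>
    obtain ⟨hn, hl⟩ := List.nodup_cons.mp hl
    have hc : ∀ a b, Commute ((l.map fun n => lax (siteUnit ℂ n) η (w n)).prod)
        (scalar (Fin 2) (siteUnit ℂ n a b)) := by
      intro a b
      refine Commute.list_prod_left _ _ fun X hX => ?_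
      obtain ⟨m, hm, rfl⟩ := List.mem_map.mp hX
      exact commute_lax (fun c d => siteUnit_commute m n (fun h => hn (h ▸ hm)) c d a b) _ _
    set P := (l.map fun n => lax (siteUnit ℂ n) η (w n)).prod with hP
    have hlaxc : ∀ i j k m, Commute (P i j) (lax (siteUnit ℂ n) η (w n) k m) := by
      intro i j k m
      have := commute_entry_of_scalar (hc m k) i j
      simp only [lax, Matrix.add_apply, Matrix.smul_apply, siteFlip_apply, Matrix.one_apply]
      refine Commute.add_right (Commute.smul_right ?_ _) (this.smul_right _)
      split
      · exact Commute.one_right _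
      · exact Commute.zero_right _
    have ht : (lax (siteUnit ℂ n) η (w n) * P)ᵀ = Pᵀ * (lax (siteUnit ℂ n) η (w n))ᵀ := by
      refine Matrix.ext fun a b => ?_
      simp only [transpose_apply, Matrix.mul_apply, Fin.sum_univ_two, (hlaxc _ _ _ _).eq]
    have hσ := auxMat_sigmaY_mul_self (N := N)
    have hx := sigmaY_lax_transpose n η (w n)
    rw [List.map_cons, List.prod_cons, ht, List.reverse_cons, List.map_append, List.prod_append,
      ← ih hl, List.map_singleton, List.prod_singleton, ← neg_eq_iff_eq_neg.mpr hx,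
      List.length_cons, pow_succ]
    set σ := auxMat (Matrix (Conf N) (Conf N) ℂ) sigmaY
    rw [smul_mul_assoc, mul_neg, mul_neg, mul_one, neg_smul, smul_neg]
    have hins : σ * (Pᵀ * (lax (siteUnit ℂ n) η (w n))ᵀ) * σ =
        σ * Pᵀ * σ * (σ * (lax (siteUnit ℂ n) η (w n))ᵀ * σ) := by
      calc σ * (Pᵀ * (lax (siteUnit ℂ n) η (w n))ᵀ) * σ
          = σ * Pᵀ * 1 * (lax (siteUnit ℂ n) η (w n))ᵀ * σ := by simp only [mul_assoc, mul_one]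
        _ = _ := by rw [← hσ]; simp only [mul_assoc]
    rw [hins]

theorem toBlocks_monodromyHat (η : ℂ) (ξ : Fin N → ℂ) (z : ℂ) :
    toBlocks N (monodromyHat η ξ z) = ((List.finRange N).map fun n =>
      lax (siteUnit ℂ n) η (z + ξ n - η / 2)).prod := by
  have h := sigmaY_prod_transpose η (fun n => -z - ξ n - η / 2) (List.finRange N).reverse nodup_sites
  have hsmul : ∀ (c : ℂ) X, toBlocks N (c • X) = c • toBlocks N X := fun c X => rfl
  rw [monodromyHat, hsmul, map_mul, map_mul, toBlocks_onAux, toBlocks_auxTranspose,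
    toBlocks_monodromy]
  rw [List.length_reverse, List.length_finRange, List.reverse_reverse] at h
  rw [h]
  congr 1
  refine List.map_congr_left fun n _ => ?_
  congr 1
  ring

/-- The traceless part `A` of a boundary matrix `K(z) = 1 + z A`. -/
noncomputable def BoundaryParams.slope (p : BoundaryParams) (σ : ℤˣ) : Matrix (Fin 2) (Fin 2) ℂ :=
  (1 / p.ζ σ) • !![1, 2 * p.κ σ * Complex.exp (p.τ σ); 2 * p.κ σ * Complex.exp (-p.τ σ), -1]

theorem BoundaryParams.KMat_eq (p : BoundaryParams) (hp : p.Admissible) (σ : ℤˣ) (z : ℂ) :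
    KMat z (p.ζ σ) (p.κ σ) (p.τ σ) = (1 : ℂ) • 1 + z • p.slope σ := by
  have h := (hp σ).1
  ext i j
  fin_cases i <;> fin_cases j <;> simp [KMat, slope] <;> field_simp
  ring

/-- The transfer matrix in terms of Lax operators, with `x = z - η / 2`. -/
theorem transfer_eq (η : ℂ) (ξ : Fin N → ℂ) {p : BoundaryParams} (hp : p.Admissible) (z : ℂ) :
    transfer η ξ p z = chainT η ξ 1 (p.slope 1) 1 (p.slope (-1)) (z - η / 2) := by
  rw [transfer, auxTrace_eq, map_mul, map_mul, map_mul, toBlocks_onAux, toBlocks_onAux,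
    toBlocks_monodromy, toBlocks_monodromyHat, chainT, openT, dressed_eq_prod,
    p.KMat_eq hp, p.KMat_eq hp, List.reverse_reverse]
  rw [show z - η / 2 + η = z + η / 2 by ring]
  simp only [mul_assoc, show ∀ n, z - η / 2 - ξ n = z - ξ n - η / 2 from fun n => by ring,
    show ∀ n, z - η / 2 + ξ n = z + ξ n - η / 2 from fun n => by ring]

end Translation

/-! ### Families of matrices -/

section Families

variable {n : Type*} [Fintype n] [DecidableEq n]

/-- Two families of matrices are jointly isospectral if the linear combinations `T(z) + μ T(w)` have
equal characteristic polynomials. For diagonalizable commuting families this determines the joint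
eigenvalues. -/
def JointlyIsospectral (T₁ T₂ : ℂ → Matrix n n ℂ) : Prop :=
  ∀ z w μ : ℂ, (T₁ z + μ • T₁ w).charpoly = (T₂ z + μ • T₂ w).charpoly

theorem JointlyIsospectral.symm {T₁ T₂ : ℂ → Matrix n n ℂ} (h : JointlyIsospectral T₁ T₂) :
    JointlyIsospectral T₂ T₁ := fun z w μ => (h z w μ).symm

theorem JointlyIsospectral.trans {T₁ T₂ T₃ : ℂ → Matrix n n ℂ} (h : JointlyIsospectral T₁ T₂)
    (h' : JointlyIsospectral T₂ T₃) : JointlyIsospectral T₁ T₃ :=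
  fun z w μ => (h z w μ).trans (h' z w μ)

theorem JointlyIsospectral.sameSpectrum {T₁ T₂ : ℂ → Matrix n n ℂ} (h : JointlyIsospectral T₁ T₂) :
    SameSpectrum T₁ T₂ := fun z => by simpa using h z z 0

theorem charpoly_conj (S : (Matrix n n ℂ)ˣ) (M : Matrix n n ℂ) :
    (S.val * M * S⁻¹.val).charpoly = M.charpoly := by
  rw [Matrix.coe_units_inv, charpoly_units_conj]

theorem JointlyIsospectral.of_conj {T₁ T₂ : ℂ → Matrix n n ℂ}
    (h : ∃ g : (Matrix n n ℂ)ˣ, ∀ z, (g : Matrix n n ℂ) * T₁ z = T₂ z * g) :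
    JointlyIsospectral T₁ T₂ := by
  obtain ⟨g, hg⟩ := h
  intro z w μ
  have : T₂ z + μ • T₂ w = g.val * (T₁ z + μ • T₁ w) * g⁻¹.val := by
    rw [mul_add, mul_smul_comm, hg, hg, ← smul_mul_assoc, ← add_mul, mul_assoc, Units.mul_inv,
      mul_one]
  rw [this, charpoly_conj]

theorem JointlyIsospectral.transpose (T : ℂ → Matrix n n ℂ) :
    JointlyIsospectral T fun z => (T z)ᵀ := by
  intro z w μ
  rw [← transpose_smul, ← transpose_add, charpoly_transpose]

/-- Joint isospectrality passes to limits. -/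
theorem JointlyIsospectral.of_limit {f : ℂ → ℂ → Matrix n n ℂ} {T : ℂ → Matrix n n ℂ}
    (hf : ∀ z, Continuous fun t => f t z) (h : ∀ t, t ≠ 0 → JointlyIsospectral (f t) T) :
    JointlyIsospectral (f 0) T := by
  intro z w μ
  refine Polynomial.funext fun ν => ?_
  have hc : Continuous fun t => ((f t z + μ • f t w).charpoly).eval ν := by
    simp only [Matrix.eval_charpoly]
    have := hf z
    have := hf w
    fun_prop
  have := Continuous.ext_on (dense_compl_singleton (0 : ℂ)) hc
    (continuous_const (y := ((T z + μ • T w).charpoly).eval ν)) fun t ht => by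
      simp only [h t ht z w μ]
  exact congrFun this 0

/-- A matrix whose characteristic polynomial has simple roots is diagonalizable. -/
theorem exists_diagonalization {M : Matrix n n ℂ} {d : n → ℂ} (hd : Function.Injective d)
    (hM : ∀ i, M.charpoly.IsRoot (d i)) :
    ∃ S : (Matrix n n ℂ)ˣ, M * S.val = S.val * diagonal d := by
  have h1 : ∀ i, ∃ v : n → ℂ, v ≠ 0 ∧ M *ᵥ v = d i • v := by
    intro i
    have := hM i
    rw [Polynomial.IsRoot, Matrix.eval_charpoly] at this
    obtain ⟨v, hv, h⟩ := Matrix.exists_mulVec_eq_zero_iff.mpr this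
    refine ⟨v, hv, ?_⟩
    rw [Matrix.sub_mulVec, sub_eq_zero] at h
    rw [← h]
    ext j
    simp [Matrix.scalar_apply, Matrix.mulVec_diagonal]
  choose v hv hMv using h1
  have hli : LinearIndependent ℂ v := by
    refine Module.End.eigenvectors_linearIndependent' (Matrix.toLin' M) d hd v fun i => ?_
    rw [Module.End.hasEigenvector_iff, Module.End.mem_eigenspace_iff]
    exact ⟨by rw [Matrix.toLin'_apply, hMv], hv i⟩
  have hS : IsUnit (Matrix.of v)ᵀ := by
    rw [← Matrix.linearIndependent_cols_iff_isUnit]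
    exact hli
  obtain ⟨S, hS⟩ := hS
  refine ⟨S, ?_⟩
  rw [hS]
  ext i j
  rw [Matrix.mul_diagonal]
  have := congrFun (hMv j) i
  simpa [Matrix.mulVec, dotProduct, Matrix.mul_apply, mul_comm] using this

theorem exists_eigenvalues {M : Matrix n n ℂ} (hM : M.charpoly.roots.Nodup) :
    ∃ d : n → ℂ, Function.Injective d ∧ ∀ i, M.charpoly.IsRoot (d i) := by
  classical
  have hcard : M.charpoly.roots.toFinset.card = Fintype.card n := by
    rw [Multiset.toFinset_card_of_nodup hM,
      ← (IsAlgClosed.splits M.charpoly).natDegree_eq_card_roots, charpoly_natDegree_eq_dim]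
  obtain ⟨e⟩ : Nonempty (n ≃ M.charpoly.roots.toFinset) := by
    rw [← Fintype.card_eq, Fintype.card_coe, hcard]
  refine ⟨fun i => e i, Subtype.val_injective.comp e.injective, fun i => ?_⟩
  have := (e i).2
  rw [Multiset.mem_toFinset] at this
  exact Polynomial.isRoot_of_mem_roots this

theorem eq_diagonal_of_commute {d : n → ℂ} (hd : Function.Injective d) {M : Matrix n n ℂ}
    (h : M * diagonal d = diagonal d * M) : M = diagonal fun i => M i i := by
  ext i j
  by_cases hij : i = j
  · simp [hij]
  · have := congrFun (congrFun h i) j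
    rw [Matrix.mul_diagonal, Matrix.diagonal_mul] at this
    rw [diagonal_apply_ne _ hij]
    have h0 : (d i - d j) * M i j = 0 := by linear_combination -this
    exact (mul_eq_zero.mp h0).resolve_left (sub_ne_zero.mpr fun h => hij (hd h))

/-- Jointly isospectral commuting families are similar as soon as the spectrum of the first is
simple. -/
theorem JointlyIsospectral.similar {T₁ T₂ : ℂ → Matrix n n ℂ} (h : JointlyIsospectral T₁ T₂)
    (h₁ : ∀ z w, T₁ z * T₁ w = T₁ w * T₁ z) (h₂ : ∀ z w, T₂ z * T₂ w = T₂ w * T₂ z)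
    (hs : HasSimpleSpectrum T₁) : SimilarFamilies T₁ T₂ := by
  obtain ⟨z₀, hz₀⟩ := hs
  obtain ⟨d, hd, hr₁⟩ := exists_eigenvalues hz₀
  have hr₂ : ∀ i, (T₂ z₀).charpoly.IsRoot (d i) := fun i => by
    rw [← h.sameSpectrum z₀]
    exact hr₁ i
  have key : ∀ T : ℂ → Matrix n n ℂ, (∀ z w, T z * T w = T w * T z) →
      (∀ i, (T z₀).charpoly.IsRoot (d i)) → ∃ (S : (Matrix n n ℂ)ˣ) (f : ℂ → n → ℂ),
        f z₀ = d ∧ ∀ z, T z = S.val * diagonal (f z) * S⁻¹.val := by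
    intro T hT hr
    obtain ⟨S, hS⟩ := exists_diagonalization hd hr
    have hS' : S⁻¹.val * T z₀ * S.val = diagonal d := by
      rw [mul_assoc, hS, ← mul_assoc, Units.inv_mul, one_mul]
    refine ⟨S, fun z i => (S⁻¹.val * T z * S.val) i i, ?_, fun z => ?_⟩
    · ext i
      simp only [hS', diagonal_apply_eq]
    · rw [← eq_diagonal_of_commute hd (M := S⁻¹.val * T z * S.val)]
      · simp only [mul_assoc, Units.mul_inv_cancel_left, Units.mul_inv, mul_one]
      · rw [← hS']
        simp only [mul_assoc, Units.mul_inv_cancel_left]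
        rw [← mul_assoc (T z), hT, mul_assoc]
  obtain ⟨S₁, f₁, hf₁, hS₁⟩ := key T₁ h₁ hr₁
  obtain ⟨S₂, f₂, hf₂, hS₂⟩ := key T₂ h₂ hr₂
  have hchar : ∀ (S : (Matrix n n ℂ)ˣ) (f g : n → ℂ) (μ : ℂ),
      (S.val * diagonal f * S⁻¹.val + μ • (S.val * diagonal g * S⁻¹.val)).charpoly =
        ∏ i, (Polynomial.X - Polynomial.C (f i + μ * g i)) := by
    intro S f g μ
    rw [← smul_mul_assoc, ← mul_smul_comm, ← add_mul, ← mul_add, charpoly_conj,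
      ← diagonal_smul, diagonal_add, charpoly_diagonal]
    simp
  have hf : f₁ = f₂ := by
    ext z i
    -- a value of `μ` for which `f₁ z i + μ d i = f₂ z j + μ d j` forces `i = j`
    obtain ⟨μ, hμ⟩ := Infinite.exists_notMem_finset
      (Finset.univ.image fun j => (f₁ z i - f₂ z j) / (d j - d i))
    have := h z z₀ μ
    rw [hS₁ z, hS₁ z₀, hS₂ z, hS₂ z₀, hchar, hchar, hf₁, hf₂] at this
    have h0 := congrArg (Polynomial.eval (f₁ z i + μ * d i)) this
    rw [Polynomial.eval_prod, Polynomial.eval_prod, Finset.prod_eq_zero (Finset.mem_univ i)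
      (by simp), eq_comm, Finset.prod_eq_zero_iff] at h0
    obtain ⟨j, -, hj⟩ := h0
    simp only [Polynomial.eval_sub, Polynomial.eval_X, Polynomial.eval_C] at hj
    by_cases hij : j = i
    · subst hij
      linear_combination hj
    · exfalso
      refine hμ (Finset.mem_image.mpr ⟨j, Finset.mem_univ j, ?_⟩)
      rw [div_eq_iff (sub_ne_zero.mpr fun h => hij (hd h))]
      linear_combination hj
  refine ⟨S₂ * S₁⁻¹, fun z => ?_⟩
  rw [hS₁, hS₂, hf]
  simp [mul_assoc]

/-- The resultant of the characteristic polynomial and its derivative. -/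
noncomputable def charDisc {R : Type*} [CommRing R] (M : Matrix n n R) : R :=
  M.charpoly.resultant (Polynomial.derivative M.charpoly) (Fintype.card n) (Fintype.card n)

theorem charDisc_map {R S : Type*} [CommRing R] [CommRing S] (f : R →+* S) (M : Matrix n n R) :
    charDisc (f.mapMatrix M) = f (charDisc M) := by
  rw [charDisc, charDisc, ← Polynomial.resultant_map_map, RingHom.mapMatrix_apply,
    Matrix.charpoly_map, Polynomial.derivative_map]

theorem charDisc_ne_zero_iff (M : Matrix n n ℂ) :
    charDisc M ≠ 0 ↔ M.charpoly.roots.Nodup := by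
  have hdeg := M.charpoly_natDegree_eq_dim
  have hle : (Polynomial.derivative M.charpoly).natDegree ≤ Fintype.card n := by
    have := Polynomial.natDegree_derivative_le M.charpoly
    omega
  have h1 : charDisc M = M.charpoly.resultant (Polynomial.derivative M.charpoly) := by
    obtain ⟨k, hk⟩ := Nat.exists_eq_add_of_le hle
    have := Polynomial.resultant_add_right_deg M.charpoly (Polynomial.derivative M.charpoly)
      (Fintype.card n) _ k le_rfl
    rw [← hk, ← hdeg, Polynomial.coeff_natDegree, M.charpoly_monic.leadingCoeff, one_pow, one_mul]
      at this
    rw [charDisc, ← this, hdeg]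
  rw [h1, ← isUnit_iff_ne_zero, Polynomial.isUnit_resultant_iff_isCoprime M.charpoly_monic,
    Polynomial.nodup_roots_iff_of_splits M.charpoly_monic.ne_zero (IsAlgClosed.splits _)]
  rfl

/-- If a matrix with polynomial entries has simple spectrum at `0`, then it has simple spectrum
outside of a finite set. -/
theorem exists_notMem_nodup {M : Matrix n n (Polynomial ℂ)}
    (h : ((Polynomial.evalRingHom 0).mapMatrix M).charpoly.roots.Nodup) (F : Finset ℂ) :
    ∃ ε ∉ F, ((Polynomial.evalRingHom ε).mapMatrix M).charpoly.roots.Nodup := by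
  rw [← charDisc_ne_zero_iff, charDisc_map] at h
  have h0 : charDisc M ≠ 0 := by
    intro h0
    rw [h0, map_zero] at h
    exact h rfl
  obtain ⟨ε, hε⟩ := Infinite.exists_notMem_finset ((charDisc M).roots.toFinset ∪ F)
  simp only [Finset.mem_union, Multiset.mem_toFinset, Polynomial.mem_roots h0, not_or] at hε
  refine ⟨ε, hε.2, ?_⟩
  rw [← charDisc_ne_zero_iff, charDisc_map]
  exact hε.1

theorem nodup_roots_prod {n : Type*} [Fintype n] {d : n → ℂ} (hd : Function.Injective d) :
    (∏ i, (Polynomial.X - Polynomial.C (d i))).roots.Nodup := by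
  have h := Polynomial.roots_multiset_prod_X_sub_C (Finset.univ.val.map d)
  rw [Multiset.map_map] at h
  rw [Finset.prod, show (fun i => Polynomial.X - Polynomial.C (d i)) =
    (fun a => Polynomial.X - Polynomial.C a) ∘ d from rfl, h]
  exact Finset.univ.nodup.map hd

theorem nodup_affine {M : Matrix n n ℂ} (hM : M.charpoly.roots.Nodup) (a : ℂ) {c : ℂ}
    (hc : c ≠ 0) : (a • 1 + c • M).charpoly.roots.Nodup := by
  obtain ⟨d, hd, h⟩ := exists_eigenvalues hM
  obtain ⟨S, hS⟩ := exists_diagonalization hd h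
  have h1 : M = S.val * diagonal d * S⁻¹.val := by rw [← hS, mul_assoc, Units.mul_inv, mul_one]
  have h2 : a • (1 : Matrix n n ℂ) = S.val * (a • 1) * S⁻¹.val := by
    rw [mul_smul_comm, mul_one, smul_mul_assoc, Units.mul_inv]
  rw [h1, h2, ← smul_mul_assoc, ← mul_smul_comm, ← add_mul, ← mul_add, charpoly_conj,
    ← diagonal_smul, smul_one_eq_diagonal, diagonal_add, charpoly_diagonal]
  refine nodup_roots_prod fun i j hij => hd ?_
  have := add_left_cancel hij
  simpa [hc] using this

end Families

/-! ### The spectrum as a function of the invariants of the boundary matrices -/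

section Invariants

variable {N : ℕ}

theorem continuous_auxMat {X : Type*} [TopologicalSpace X] {K : X → Matrix (Fin 2) (Fin 2) ℂ}
    (hK : Continuous K) : Continuous fun p => auxMat (Matrix (Conf N) (Conf N) ℂ) (K p) := by
  refine continuous_matrix fun i j => ?_
  simp only [auxMat, map_apply, Algebra.algebraMap_eq_smul_one]
  exact (hK.matrix_elem i j).smul continuous_const

theorem continuous_lax {X : Type*} [TopologicalSpace X] (n : Fin N) (η : ℂ) {u : X → ℂ}
    (hu : Continuous u) : Continuous fun p => lax (siteUnit ℂ n) η (u p) :=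
  (hu.smul continuous_const).add continuous_const

theorem continuous_openT {X : Type*} [TopologicalSpace X] (η : ℂ) (ξ : Fin N → ℂ)
    (l : List (Fin N)) (α α' : ℂ) {B B' : X → Matrix (Fin 2) (Fin 2) ℂ} {x : X → ℂ}
    (hB : Continuous B) (hB' : Continuous B') (hx : Continuous x) :
    Continuous fun p => openT (siteUnit ℂ) η ξ l α (B p) α' (B' p) (x p) := by
  have hd : ∀ (l : List (Fin N)) {K : X → Matrix (Fin 2) (Fin 2) (Matrix (Conf N) (Conf N) ℂ)},
      Continuous K → Continuous fun p => dressed (siteUnit ℂ) η ξ (x p) (K p) l := by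
    intro l K hK
    induction l with
    | nil => exact hK
    | cons n l ih =>
      exact ((continuous_lax n η (hx.sub continuous_const)).mul ih).mul
        (continuous_lax n η (hx.add continuous_const))
  refine Continuous.matrix_trace (Continuous.mul ?_ (hd _ ?_))
  · exact continuous_auxMat (continuous_const.add ((hx.add continuous_const).smul hB))
  · exact continuous_auxMat (continuous_const.add (hx.smul hB'))

/-- The transfer matrices at different spectral parameters commute. -/
theorem chainT_comm (η : ℂ) (ξ : Fin N → ℂ) (α α' : ℂ) {B B' : Matrix (Fin 2) (Fin 2) ℂ}
    (hB : B.trace = 0) (hB' : B'.trace = 0) (x y : ℂ) :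
    chainT η ξ α B α' B' x * chainT η ξ α B α' B' y =
      chainT η ξ α B α' B' y * chainT η ξ α B α' B' x := by
  have hpw : (List.finRange N).reverse.Pairwise fun m n => ∀ a b c d,
      Commute (siteUnit ℂ m a b) (siteUnit ℂ n c d) :=
    nodup_sites.imp fun h a b c d => siteUnit_commute _ _ h a b c d
  have hT : Continuous fun x => chainT η ξ α B α' B' x :=
    continuous_openT η ξ _ α α' continuous_const continuous_const continuous_id
  -- the relation obtained from the reflection equation has to be divided by a scalar, which
  -- vanishes for at most four values of `x`
  have hdense : Dense (({y + η, y - η, -y, -y - 2 * η} : Finset ℂ) : Set ℂ)ᶜ :=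
    ((Finset.finite_toSet _).countable).dense_compl ℂ
  refine congrFun (Continuous.ext_on hdense (hT.mul continuous_const)
    (continuous_const.mul hT) fun x hx => ?_) x
  have h := (reflectionEq_dressed (fun n => isMatrixUnits_siteUnit n) hpw η ξ x y α'
    hB').trace_mul_comm (α := α) hB
  have hne : ((x - y) ^ 2 - η ^ 2) * ((x + y) * (x + y + 2 * η)) ≠ 0 := by
    simp only [Finset.coe_insert, Finset.coe_singleton, Set.mem_compl_iff, Set.mem_insert_iff,
      Set.mem_singleton_iff, not_or] at hx
    have h1 : (x - y) ^ 2 - η ^ 2 = (x - (y + η)) * (x - (y - η)) := by ring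
    have h2 : (x + y) * (x + y + 2 * η) = (x - -y) * (x - (-y - 2 * η)) := by ring
    rw [h1, h2]
    exact mul_ne_zero (mul_ne_zero (sub_ne_zero.mpr hx.1) (sub_ne_zero.mpr hx.2.1))
      (mul_ne_zero (sub_ne_zero.mpr hx.2.2.1) (sub_ne_zero.mpr hx.2.2.2))
  exact smul_right_injective _ hne h

theorem chainT_conj (η : ℂ) (ξ : Fin N → ℂ) (α α' : ℂ) {B C B' C' : Matrix (Fin 2) (Fin 2) ℂ}
    (h : (Matrix (Fin 2) (Fin 2) ℂ)ˣ) (hB : h.val * B = C * h.val)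
    (hB' : h.val * B' = C' * h.val) :
    JointlyIsospectral (chainT η ξ α B α' B') (chainT η ξ α C α' C') :=
  JointlyIsospectral.of_conj (exists_openT_conj (fun n => isMatrixUnits_siteUnit n)
    siteUnit_commute η ξ _ nodup_sites h α α' hB hB')

/-- A traceless matrix with a nonzero eigenvalue `a` is conjugate to `diag (a, -a)`. -/
theorem exists_conj_diagonal {A : Matrix (Fin 2) (Fin 2) ℂ} {a : ℂ} (hA : A.trace = 0)
    (ha : (A * A).trace = 2 * a ^ 2) (ha0 : a ≠ 0) :
    ∃ g : (Matrix (Fin 2) (Fin 2) ℂ)ˣ, A * g.val = g.val * !![a, 0; 0, -a] := by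
  have h1 : A 1 1 = -A 0 0 := by
    rw [trace_fin_two] at hA
    linear_combination hA
  have h2 : A 0 0 ^ 2 + A 0 1 * A 1 0 = a ^ 2 := by
    rw [trace_fin_two] at ha
    simp only [Matrix.mul_apply, Fin.sum_univ_two, h1] at ha
    linear_combination ha / 2
  by_cases h : A 0 0 + a = 0
  · have h3 : A 0 0 = -a := by linear_combination h
    have hdet : IsUnit (!![A 0 1, 2 * a; 2 * a, -A 1 0]).det := by
      rw [Matrix.det_fin_two_of, isUnit_iff_ne_zero]
      have : A 0 1 * -A 1 0 - 2 * a * (2 * a) = -(4 * a ^ 2) := by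
        rw [h3] at h2
        linear_combination -h2
      rw [this]
      simpa using ha0
    refine ⟨((Matrix.isUnit_iff_isUnit_det _).mpr hdet).unit, ?_⟩
    rw [IsUnit.unit_spec]
    ext i j
    fin_cases i <;> fin_cases j <;>
      simp [Matrix.mul_apply, Fin.sum_univ_two, h1, h3] <;> rw [h3] at h2
    · ring
    · linear_combination -h2
    · linear_combination h2
    · ring
  · have hdet : IsUnit (!![A 0 0 + a, -A 0 1; A 1 0, A 0 0 + a]).det := by
      rw [Matrix.det_fin_two_of, isUnit_iff_ne_zero]
      have : (A 0 0 + a) * (A 0 0 + a) - -A 0 1 * A 1 0 = 2 * a * (A 0 0 + a) := by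
        linear_combination h2
      rw [this]
      simp [ha0, h]
    refine ⟨((Matrix.isUnit_iff_isUnit_det _).mpr hdet).unit, ?_⟩
    rw [IsUnit.unit_spec]
    ext i j
    fin_cases i <;> fin_cases j <;>
      simp [Matrix.mul_apply, Fin.sum_univ_two, h1]
    · linear_combination h2
    · ring
    · ring
    · linear_combination -h2

/-- With a diagonal left boundary the spectrum depends on the off-diagonal entries of the right one
through their product only. If the product vanishes, the two boundaries have a common eigenvector
and are not conjugate to diagonal ones, but have diagonal ones in the closure of their orbit. -/
theorem chainT_torus (η : ℂ) (ξ : Fin N → ℂ) (α α' a m p q p' q' : ℂ) (h : p * q = p' * q') :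
    JointlyIsospectral (chainT η ξ α !![a, 0; 0, -a] α' !![m, p; q, -m])
      (chainT η ξ α !![a, 0; 0, -a] α' !![m, p'; q', -m]) := by
  have key : ∀ (t : ℂ) (p q p' q' : ℂ), t ≠ 0 → t * p = p' → q = q' * t →
      JointlyIsospectral (chainT η ξ α !![a, 0; 0, -a] α' !![m, p; q, -m])
        (chainT η ξ α !![a, 0; 0, -a] α' !![m, p'; q', -m]) := by
    intro t p q p' q' ht hp hq
    have hdet : IsUnit (!![t, 0; 0, 1] : Matrix (Fin 2) (Fin 2) ℂ).det := by
      rw [Matrix.det_fin_two_of, isUnit_iff_ne_zero]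
      simpa using ht
    refine chainT_conj η ξ α α' ((Matrix.isUnit_iff_isUnit_det _).mpr hdet).unit ?_ ?_ <;>
      rw [IsUnit.unit_spec]
    · ext i j
      fin_cases i <;> fin_cases j <;> simp [Matrix.mul_apply, Fin.sum_univ_two, mul_comm]
    · ext i j
      fin_cases i <;> fin_cases j <;> simp [Matrix.mul_apply, Fin.sum_univ_two, mul_comm, ← hp, hq]
  have hcont : ∀ (r s z : ℂ), Continuous fun t : ℂ =>
      chainT η ξ α !![a, 0; 0, -a] α' !![m, t * r; t * s, -m] z := by
    intro r s z
    refine continuous_openT η ξ _ α α' continuous_const ?_ continuous_const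
    refine continuous_matrix fun i j => ?_
    fin_cases i <;> fin_cases j <;> simp <;> fun_prop
  have zero : ∀ p q : ℂ, p * q = 0 →
      JointlyIsospectral (chainT η ξ α !![a, 0; 0, -a] α' !![m, 0; 0, -m])
        (chainT η ξ α !![a, 0; 0, -a] α' !![m, p; q, -m]) := by
    intro p q hpq
    rcases mul_eq_zero.mp hpq with rfl | rfl
    · have := JointlyIsospectral.of_limit (hcont 0 q)
        (T := chainT η ξ α !![a, 0; 0, -a] α' !![m, 0; q, -m]) fun t ht =>
          key t _ _ _ _ ht (by ring) (by ring)
      simpa using this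
    · have := JointlyIsospectral.of_limit (hcont p 0)
        (T := chainT η ξ α !![a, 0; 0, -a] α' !![m, p; 0, -m]) fun t ht =>
          key t⁻¹ _ _ _ _ (inv_ne_zero ht) (by field_simp) (by ring)
      simpa using this
  by_cases h0 : p * q = 0
  · exact (zero p q h0).symm.trans (zero p' q' (h ▸ h0))
  · have hp : p ≠ 0 := left_ne_zero_of_mul h0
    have hp' : p' ≠ 0 := left_ne_zero_of_mul (h ▸ h0)
    refine key (p' / p) p q p' q' (div_ne_zero hp' hp) (by field_simp) ?_
    field_simp
    linear_combination h

/-- The spectrum depends on the boundary matrices `A₊`, `A₋` only through `tr A₊²`, `tr A₋²` and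
`tr A₊ A₋`, the invariants of pairs of traceless matrices under simultaneous conjugation. -/
theorem chainT_invariants (η : ℂ) (ξ : Fin N → ℂ) (α α' : ℂ)
    {A B A' B' : Matrix (Fin 2) (Fin 2) ℂ} (hA : A.trace = 0) (hB : B.trace = 0)
    (hA' : A'.trace = 0) (hB' : B'.trace = 0) (h0 : (A * A).trace ≠ 0)
    (h1 : (A * A).trace = (A' * A').trace) (h2 : (B * B).trace = (B' * B').trace)
    (h3 : (A * B).trace = (A' * B').trace) :
    JointlyIsospectral (chainT η ξ α A α' B) (chainT η ξ α A' α' B') := by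
  obtain ⟨a, ha⟩ : ∃ a : ℂ, (A * A).trace = 2 * a ^ 2 := by
    obtain ⟨a, ha⟩ := IsAlgClosed.exists_pow_nat_eq ((A * A).trace / 2) (n := 2) two_pos
    exact ⟨a, by rw [ha]; ring⟩
  have ha0 : a ≠ 0 := by
    rintro rfl
    exact h0 (by simpa using ha)
  have key : ∀ {A B : Matrix (Fin 2) (Fin 2) ℂ}, A.trace = 0 → B.trace = 0 →
      (A * A).trace = 2 * a ^ 2 → ∃ m p q, 2 * a * m = (A * B).trace ∧
        2 * (m ^ 2 + p * q) = (B * B).trace ∧ JointlyIsospectral (chainT η ξ α A α' B)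
          (chainT η ξ α !![a, 0; 0, -a] α' !![m, p; q, -m]) := by
    intro A B hA hB ha
    obtain ⟨g, hg⟩ := exists_conj_diagonal hA ha ha0
    set C := g⁻¹.val * B * g.val with hC
    have hD : !![a, 0; 0, -a] = g⁻¹.val * A * g.val := by
      rw [mul_assoc, hg, ← mul_assoc, Units.inv_mul, one_mul]
    have htr : ∀ X : Matrix (Fin 2) (Fin 2) ℂ, (g⁻¹.val * X * g.val).trace = X.trace := fun X => by
      rw [trace_mul_cycle, Units.mul_inv, one_mul]
    have hmul : ∀ X Y : Matrix (Fin 2) (Fin 2) ℂ,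
        (g⁻¹.val * X * g.val) * (g⁻¹.val * Y * g.val) = g⁻¹.val * (X * Y) * g.val := fun X Y => by
      simp only [mul_assoc, Units.mul_inv_cancel_left]
    have hC1 : C 1 1 = -C 0 0 := by
      have : C.trace = 0 := by rw [hC, htr, hB]
      rw [trace_fin_two] at this
      linear_combination this
    have hCeq : C = !![C 0 0, C 0 1; C 1 0, -C 0 0] := by
      rw [← hC1]
      exact Matrix.eta_fin_two C
    refine ⟨C 0 0, C 0 1, C 1 0, ?_, ?_, ?_⟩
    · rw [← htr (A * B), ← hmul, ← hD, ← hC, trace_fin_two]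
      simp [Matrix.mul_apply, Fin.sum_univ_two, hC1]
      ring
    · rw [← htr (B * B), ← hmul, ← hC, trace_fin_two]
      simp [Matrix.mul_apply, Fin.sum_univ_two, hC1]
      ring
    · rw [← hCeq]
      refine chainT_conj η ξ α α' g⁻¹ ?_ ?_
      · rw [hD, mul_assoc, Units.mul_inv, mul_one]
      · rw [hC, mul_assoc, Units.mul_inv, mul_one]
  obtain ⟨m, p, q, e1, e2, e3⟩ := key hA hB ha
  obtain ⟨m', p', q', e1', e2', e3'⟩ := key hA' hB' (h1 ▸ ha)
  have hm : m = m' := by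
    have : 2 * a * m = 2 * a * m' := by rw [e1, e1', h3]
    exact mul_left_cancel₀ (mul_ne_zero two_ne_zero ha0) this
  subst hm
  have hpq : p * q = p' * q' := by linear_combination (e2 - e2' + h2) / 2
  exact (e3.trans (chainT_torus η ξ α α' a m p q p' q' hpq)).trans e3'.symm

/-- Exchanging the two boundary matrices does not affect the spectrum. -/
theorem chainT_swap {η : ℂ} {ξ : Fin N → ℂ}
    (hξ : ∀ m n, m ≠ n → η ^ 2 - (ξ m - ξ n) ^ 2 ≠ 0) (α α' : ℂ)
    {A B : Matrix (Fin 2) (Fin 2) ℂ} (hA : A.trace = 0) (hB : B.trace = 0) :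
    JointlyIsospectral (chainT η ξ α A α' B) (chainT η ξ α' Bᵀ α Aᵀ) := by
  have hpw : (List.finRange N).reverse.Pairwise fun m n => ∀ a b c d,
      Commute (siteUnit ℂ m a b) (siteUnit ℂ n c d) :=
    nodup_sites.imp fun h a b c d => siteUnit_commute _ _ h a b c d
  -- exchange the boundaries, reversing the chain and the signs of the inhomogeneities
  have h1 : chainT η ξ α A α' B =
      openT (siteUnit ℂ) η (-ξ) (List.finRange N).reverse.reverse α' B α A := by
    have hc : ∀ l (ξ : Fin N → ℂ) α α' (A B : Matrix (Fin 2) (Fin 2) ℂ),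
        Continuous (openT (siteUnit ℂ) η ξ l α A α' B) := fun l ξ α α' A B =>
      continuous_openT η ξ l α α' continuous_const continuous_const continuous_id
    refine Continuous.ext_on (dense_compl_singleton (0 : ℂ)) (hc _ _ _ _ _ _) (hc _ _ _ _ _ _)
      fun x hx => ?_
    exact smul_right_injective _ (mul_ne_zero two_ne_zero hx)
      (openT_swap (fun n => isMatrixUnits_siteUnit n) hpw η ξ α α' hA hB x)
  -- restore the order of the sites
  have h2 : JointlyIsospectral
      (openT (siteUnit ℂ) η (-ξ) (List.finRange N).reverse.reverse α' B α A)
      (chainT η (-ξ) α' B α A) := by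
    refine JointlyIsospectral.of_conj (exists_openT_perm (fun n => isMatrixUnits_siteUnit n)
      siteUnit_commute η (-ξ) (fun m n hmn => ?_) (List.reverse_perm _)
      (List.nodup_reverse.mpr nodup_sites) α' α B A)
    rw [isUnit_iff_ne_zero]
    have := hξ m n hmn
    simp only [Pi.neg_apply]
    convert this using 2
    ring
  -- restore the signs
  have h3 : JointlyIsospectral (chainT η (-ξ) α' B α A) (chainT η ξ α' Bᵀ α Aᵀ) := by
    have := JointlyIsospectral.transpose (chainT η (-ξ) α' B α A)
    have e : (fun z => (chainT η (-ξ) α' B α A z)ᵀ) = chainT η ξ α' Bᵀ α Aᵀ := by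
      funext z
      rw [chainT, openT_transpose, neg_neg]
      rfl
    rwa [e] at this
  rw [h1]
  exact h2.trans h3

end Invariants

/-! ### Transfer matrices with simple spectrum -/

section Witness

variable {N : ℕ} {R : Type*} [CommRing R]

/-- A product of Lax operators over a list of sites. -/
def laxProd (η : R) (u : Fin N → R) (l : List (Fin N)) :
    Matrix (Fin 2) (Fin 2) (Matrix (Conf N) (Conf N) R) :=
  (l.map fun n => lax (siteUnit R n) η (u n)).prod

theorem laxProd_cons (η : R) (u : Fin N → R) (n : Fin N) (l : List (Fin N)) :
    laxProd η u (n :: l) = lax (siteUnit R n) η (u n) * laxProd η u l := by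
  simp [laxProd]

theorem laxProd_append_singleton (η : R) (u : Fin N → R) (n : Fin N) (l : List (Fin N)) :
    laxProd η u (l ++ [n]) = laxProd η u l * lax (siteUnit R n) η (u n) := by
  simp [laxProd]

/-- A product of Lax operators does not change the spins at other sites. -/
theorem laxProd_apply_eq_zero (η : R) (u : Fin N → R) {l : List (Fin N)} {m : Fin N} (hm : m ∉ l)
    (a b : Fin 2) {s t : Conf N} (hst : s m ≠ t m) : laxProd η u l a b s t = 0 := by
  have hc : Commute (laxProd η u l) (scalar (Fin 2) (siteUnit R m (s m) (s m))) := by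
    refine Commute.list_prod_left _ _ fun X hX => ?_
    obtain ⟨n, hn, rfl⟩ := List.mem_map.mp hX
    exact commute_lax (fun c d => siteUnit_commute n m (fun h => hm (h ▸ hn)) c d _ _) _ _
  have h := congrFun (congrFun (commute_entry_of_scalar hc a b).eq s) t
  rw [mul_siteUnit_apply, siteUnit_mul_apply, if_neg hst.symm, if_pos rfl,
    Function.update_eq_self] at h
  exact h.symm

theorem siteUnit_self (n : Fin N) (a : Fin 2) :
    siteUnit R n a a = diagonal fun s => if s n = a then 1 else 0 := by
  ext s t
  by_cases hst : s = t
  · subst hst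
    by_cases h : s n = a
    · have h' : Function.update s n a = s := by rw [← h, Function.update_eq_self]
      simp [siteUnit, h, h']
    · simp [siteUnit, h]
  · rw [diagonal_apply_ne _ hst, siteUnit, of_apply, if_neg]
    rintro ⟨h, h'⟩
    rw [← h, Function.update_eq_self] at h'
    exact hst h'.symm

theorem lax_self (n : Fin N) (η u : R) (a : Fin 2) :
    lax (siteUnit R n) η u a a = diagonal fun s => u + if s n = a then η else 0 := by
  ext s t
  by_cases hst : s = t
  · subst hst
    simp [lax, siteUnit_self]
  · simp [lax, siteUnit_self, hst]

theorem lax_ne (n : Fin N) (η u : R) {a b : Fin 2} (h : a ≠ b) :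
    lax (siteUnit R n) η u a b = η • siteUnit R n b a := by
  simp [lax, h]

theorem toColex_lt_of {n : Fin N} {s t : Conf N} (h : ∀ m, n < m → s m = t m) (hs : s n = 0)
    (ht : t n = 1) : toColex s < toColex t :=
  ⟨n, h, by change s n < t n; rw [hs, ht]; exact Fin.zero_lt_one⟩

/-- The lower diagonal entry of a product of Lax operators over decreasing sites is triangular in
the colexicographic order: if the auxiliary spin is flipped at a site, then it has to be flipped
back at a lower site. -/
theorem laxProd_one_one (η : R) (u : Fin N → R) {l : List (Fin N)}
    (hl : l.Pairwise fun m n => n < m) :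
    BlockTriangular (laxProd η u l 1 1) (fun s : Conf N => toColex s) ∧
      ∀ s, laxProd η u l 1 1 s s = (l.map fun n => u n + if s n = 1 then η else 0).prod := by
  induction l with
  | nil =>
    refine ⟨fun s t h => Matrix.one_apply_ne ?_, fun s => Matrix.one_apply_eq s⟩
    rintro rfl
    exact lt_irrefl _ h
  | cons n l ih =>
    obtain ⟨hn, hl⟩ := List.pairwise_cons.mp hl
    obtain ⟨h1, h2⟩ := ih hl
    have hml : ∀ m, n ≤ m → m ∉ l := fun m hm h => absurd (hn m h) (not_lt.mpr hm)
    have e : laxProd η u (n :: l) 1 1 = η • (siteUnit R n 0 1 * laxProd η u l 0 1) +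
        (diagonal fun s => u n + if s n = 1 then η else 0) * laxProd η u l 1 1 := by
      rw [laxProd_cons, Matrix.mul_apply, Fin.sum_univ_two, lax_self, lax_ne _ _ _ one_ne_zero,
        smul_mul_assoc]
    rw [e]
    refine ⟨BlockTriangular.add (fun s t hts => ?_) ((blockTriangular_diagonal _).mul h1),
      fun s => ?_⟩
    · rw [Matrix.smul_apply, siteUnit_mul_apply]
      split_ifs with hs
      · by_contra hne
        have hagree : ∀ m, n ≤ m → Function.update s n 1 m = t m := by
          intro m hm
          by_contra hmt
          exact hne (by rw [laxProd_apply_eq_zero η u (hml m hm) 0 1 hmt, smul_zero])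
        refine absurd hts (lt_asymm (toColex_lt_of (fun m hm => ?_) hs ?_))
        · rw [← hagree m hm.le, Function.update_of_ne hm.ne']
        · rw [← hagree n le_rfl, Function.update_self]
      · rw [smul_zero]
    · rw [Matrix.add_apply, Matrix.smul_apply, siteUnit_mul_apply, diagonal_mul, h2, List.map_cons,
        List.prod_cons]
      rw [add_eq_right]
      split_ifs with hs
      · rw [laxProd_apply_eq_zero η u (hml n le_rfl), smul_zero]
        rw [Function.update_self, hs]
        exact one_ne_zero
      · rw [smul_zero]

/-- The counterpart of `laxProd_one_one` for the upper diagonal entry and increasing sites. -/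
theorem laxProd_zero_zero (η : R) (v : Fin N → R) {l : List (Fin N)}
    (hl : l.Pairwise fun m n => n < m) :
    BlockTriangular (laxProd η v l.reverse 0 0) (fun s : Conf N => toColex s) ∧
      ∀ s, laxProd η v l.reverse 0 0 s s =
        (l.map fun n => v n + if s n = 0 then η else 0).prod := by
  induction l with
  | nil =>
    refine ⟨fun s t h => Matrix.one_apply_ne ?_, fun s => Matrix.one_apply_eq s⟩
    rintro rfl
    exact lt_irrefl _ h
  | cons n l ih =>
    obtain ⟨hn, hl⟩ := List.pairwise_cons.mp hl
    obtain ⟨h1, h2⟩ := ih hl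
    have hml : ∀ m, n ≤ m → m ∉ l.reverse := fun m hm h =>
      absurd (hn m (List.mem_reverse.mp h)) (not_lt.mpr hm)
    have e : laxProd η v (n :: l).reverse 0 0 = laxProd η v l.reverse 0 0 *
        (diagonal fun s => v n + if s n = 0 then η else 0) +
          η • (laxProd η v l.reverse 0 1 * siteUnit R n 0 1) := by
      rw [List.reverse_cons, laxProd_append_singleton, Matrix.mul_apply, Fin.sum_univ_two, lax_self,
        lax_ne _ _ _ one_ne_zero, mul_smul_comm]
    rw [e]
    refine ⟨BlockTriangular.add (h1.mul (blockTriangular_diagonal _)) (fun s t hts => ?_),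
      fun s => ?_⟩
    · rw [Matrix.smul_apply, mul_siteUnit_apply]
      split_ifs with ht
      · by_contra hne
        have hagree : ∀ m, n ≤ m → s m = Function.update t n 0 m := by
          intro m hm
          by_contra hmt
          exact hne (by rw [laxProd_apply_eq_zero η v (hml m hm) 0 1 hmt, smul_zero])
        refine absurd hts (lt_asymm (toColex_lt_of (fun m hm => ?_) ?_ ht))
        · rw [hagree m hm.le, Function.update_of_ne hm.ne']
        · rw [hagree n le_rfl, Function.update_self]
      · rw [smul_zero]
    · rw [Matrix.add_apply, Matrix.smul_apply, mul_siteUnit_apply, mul_diagonal, h2, List.map_cons,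
        List.prod_cons, mul_comm, add_eq_left]
      split_ifs with hs
      · rw [laxProd_apply_eq_zero η v (hml n le_rfl), smul_zero]
        rw [Function.update_self, hs]
        exact one_ne_zero
      · rw [smul_zero]

theorem sites_pairwise : (List.finRange N).reverse.Pairwise fun m n => n < m :=
  List.pairwise_reverse.mpr (List.pairwise_lt_finRange N)

theorem prod_sites (f : Fin N → R) : ((List.finRange N).reverse.map f).prod = ∏ n, f n := by
  rw [List.map_reverse, List.prod_reverse, Fin.prod_univ_def]

theorem chainT_eq_laxProd (η : R) (ξ : Fin N → R) (α : R) (B : Matrix (Fin 2) (Fin 2) R) (α' : R)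
    (B' : Matrix (Fin 2) (Fin 2) R) (x : R) :
    chainT η ξ α B α' B' x = trace (auxMat (Matrix (Conf N) (Conf N) R) (α • 1 + (x + η) • B) *
      (laxProd η (fun n => x - ξ n) (List.finRange N).reverse *
        auxMat (Matrix (Conf N) (Conf N) R) (α' • 1 + x • B') *
          laxProd η (fun n => x + ξ n) (List.finRange N).reverse.reverse)) := by
  rw [chainT, openT, dressed_eq_prod]
  rfl

theorem charpoly_of_blockTriangular {n γ : Type*} [Fintype n] [DecidableEq n] [LinearOrder γ]
    {b : n → γ} (hb : Function.Injective b) {M : Matrix n n R} (h : BlockTriangular M b) :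
    M.charpoly = ∏ i, (Polynomial.X - Polynomial.C (M i i)) := by
  let _ := LinearOrder.lift' b hb
  exact charpoly_of_isUpperTriangular M fun i j hij => h hij

theorem blockTriangular_mul_apply_self {n γ : Type*} [Fintype n] [LinearOrder γ]
    {b : n → γ} (hb : Function.Injective b) {M M' : Matrix n n R} (h : BlockTriangular M b)
    (h' : BlockTriangular M' b) (i : n) : (M * M') i i = M i i * M' i i := by
  rw [Matrix.mul_apply]
  refine Finset.sum_eq_single i (fun j _ hj => ?_) fun hi => absurd (Finset.mem_univ i) hi
  rcases lt_or_gt_of_ne (hb.ne hj) with hlt | hlt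
  · rw [h hlt, zero_mul]
  · rw [h' hlt, mul_zero]

/-- Distinct polynomials, finite in number, have distinct values at some point. -/
theorem exists_injective_eval {ι : Type*} [Finite ι] {q : ι → Polynomial ℂ}
    (hq : Function.Injective q) : ∃ x : ℂ, Function.Injective fun i => (q i).eval x := by
  classical
  have := Fintype.ofFinite ι
  have h0 : ∏ p ∈ (Finset.univ : Finset ι).offDiag, (q p.1 - q p.2) ≠ 0 :=
    Finset.prod_ne_zero_iff.mpr fun p hp => sub_ne_zero.mpr fun h =>
      (Finset.mem_offDiag.mp hp).2.2 (hq h)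
  obtain ⟨x, hx⟩ := Infinite.exists_notMem_finset
    (∏ p ∈ (Finset.univ : Finset ι).offDiag, (q p.1 - q p.2)).roots.toFinset
  rw [Multiset.mem_toFinset, Polynomial.mem_roots h0, Polynomial.IsRoot, Polynomial.eval_prod,
    Finset.prod_eq_zero_iff] at hx
  refine ⟨x, fun i j hij => by_contra fun hne => hx ⟨(i, j), ?_, ?_⟩⟩
  · simpa using hne
  · simpa [sub_eq_zero] using hij

/-- For nilpotent boundary matrices `A₊ = σ⁺`, `A₋ = σ⁻` in the limit of infinite coupling, the
transfer matrix is a product of two entries of the bulk monodromy matrix. It is triangular, and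
for generic inhomogeneities its spectrum is simple. -/
theorem exists_simple_nilpotent {η : ℂ} (hη : η ≠ 0) {ξ : Fin N → ℂ} (hξ : GenericInhom η ξ) :
    ∃ x, (chainT η ξ 0 !![0, 1; 0, 0] 0 !![0, 0; 1, 0] x).charpoly.roots.Nodup := by
  have e : ∀ x, chainT η ξ 0 !![0, 1; 0, 0] 0 !![0, 0; 1, 0] x = ((x + η) * x) •
      (laxProd η (fun n => x - ξ n) (List.finRange N).reverse 1 1 *
        laxProd η (fun n => x + ξ n) (List.finRange N).reverse.reverse 0 0) := by
    intro x
    rw [chainT_eq_laxProd]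
    simp [trace_fin_two, Matrix.mul_apply, Fin.sum_univ_two, auxMat,
      Algebra.algebraMap_eq_smul_one, smul_smul, mul_comm x]
  let g : Fin N → Fin 2 → Polynomial ℂ := fun n a =>
    (Polynomial.X - Polynomial.C (ξ n) + if a = 1 then Polynomial.C η else 0) *
      (Polynomial.X + Polynomial.C (ξ n) + if a = 0 then Polynomial.C η else 0)
  let q : Conf N → Polynomial ℂ := fun s =>
    (Polynomial.X + Polynomial.C η) * Polynomial.X * ∏ n, g n (s n)
  have hg0 : ∀ n x, (g n 0).eval x = (x - ξ n) * (x + ξ n + η) := fun n x => by simp [g]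
  have hg1 : ∀ n x, (g n 1).eval x = (x - ξ n + η) * (x + ξ n) := fun n x => by simp [g]
  have fin2 : ∀ a : Fin 2, a = 0 ∨ a = 1 := by decide
  -- the factor of a site `n` with spin `0` vanishes at `ξ n`, all other factors do not
  have hq : Function.Injective q := by
    have key : ∀ s t : Conf N, q s = q t → ∀ n, s n = 0 → t n = 0 := by
      intro s t hst n hs
      by_contra ht
      replace ht : t n = 1 := (fin2 (t n)).resolve_left ht
      have h1 : (q s).eval (ξ n) = 0 := by
        simp only [q, Polynomial.eval_mul, Polynomial.eval_prod]
        rw [Finset.prod_eq_zero (Finset.mem_univ n) (by rw [hs, hg0]; ring), mul_zero]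
      rw [hst] at h1
      simp only [q, Polynomial.eval_mul, Polynomial.eval_prod, Polynomial.eval_add,
        Polynomial.eval_X, Polynomial.eval_C, mul_eq_zero, Finset.prod_eq_zero_iff] at h1
      have hn := hξ.1 n
      simp only [Set.mem_insert_iff, Set.mem_singleton_iff, not_or] at hn
      rcases h1 with (h1 | h1) | ⟨m, -, hm⟩
      · exact hn.2.1 (by linear_combination h1)
      · exact hn.1 h1
      · by_cases hmn : m = n
        · subst hmn
          rw [ht, hg1, mul_eq_zero] at hm
          rcases hm with hm | hm
          · exact hη (by linear_combination hm)
          · exact hn.1 (by linear_combination hm / 2)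
        · have hmn' := hξ.2 n m (Ne.symm hmn)
          simp only [Set.mem_insert_iff, Set.mem_singleton_iff, not_or] at hmn'
          rcases fin2 (t m) with h | h
          · rw [h, hg0, mul_eq_zero] at hm
            rcases hm with hm | hm
            · exact hmn'.2.1 (by linear_combination hm)
            · exact hmn'.1.2.1 (by linear_combination hm)
          · rw [h, hg1, mul_eq_zero] at hm
            rcases hm with hm | hm
            · exact hmn'.2.2.1 (by linear_combination hm)
            · exact hmn'.1.1 (by linear_combination hm)
    intro s t hst
    funext n
    rcases fin2 (s n) with h | h
    · rw [h, key s t hst n h]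
    · rcases fin2 (t n) with h' | h'
      · rw [key t s hst.symm n h', h']
      · rw [h, h']
  obtain ⟨x, hx⟩ := exists_injective_eval hq
  refine ⟨x, ?_⟩
  obtain ⟨t1, d1⟩ := laxProd_one_one η (fun n => x - ξ n) sites_pairwise
  obtain ⟨t2, d2⟩ := laxProd_zero_zero η (fun n => x + ξ n) sites_pairwise
  have ht := t1.mul t2
  rw [e, charpoly_of_blockTriangular toColex.injective (M := _ • _)
    fun s t h => by rw [Matrix.smul_apply, ht h, smul_zero]]
  refine nodup_roots_prod fun s t hst => hx ?_
  have hd : ∀ s : Conf N, (((x + η) * x) •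
      (laxProd η (fun n => x - ξ n) (List.finRange N).reverse 1 1 *
        laxProd η (fun n => x + ξ n) (List.finRange N).reverse.reverse 0 0)) s s =
      (q s).eval x := by
    intro s
    rw [Matrix.smul_apply, blockTriangular_mul_apply_self toColex.injective t1 t2, d1, d2,
      prod_sites, prod_sites, ← Finset.prod_mul_distrib]
    simp only [q, Polynomial.eval_mul, Polynomial.eval_prod, Polynomial.eval_add,
      Polynomial.eval_X, Polynomial.eval_C, smul_eq_mul]
    congr 1
    refine Finset.prod_congr rfl fun n _ => ?_
    rcases fin2 (s n) with h | h <;> simp [h, hg0, hg1]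
  exact (hd s).symm.trans (hst.trans (hd t))

end Witness

section Scaling

variable {N : ℕ} {R : Type*} [CommRing R]

theorem auxMat_smul {𝒜 : Type*} [Ring 𝒜] [Algebra R 𝒜] (a : R) (K : Matrix (Fin 2) (Fin 2) R) :
    auxMat 𝒜 (a • K) = a • auxMat 𝒜 K := by
  ext i j
  change algebraMap R 𝒜 (a * K i j) = a • algebraMap R 𝒜 (K i j)
  rw [map_mul, Algebra.smul_def]

/-- Both boundary matrices can be rescaled. -/
theorem chainT_smul (η : R) (ξ : Fin N → R) (a b α : R) (B : Matrix (Fin 2) (Fin 2) R) (α' : R)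
    (B' : Matrix (Fin 2) (Fin 2) R) (x : R) :
    chainT η ξ (a * α) (a • B) (b * α') (b • B') x = (a * b) • chainT η ξ α B α' B' x := by
  rw [chainT_eq_laxProd, chainT_eq_laxProd, smul_comm (x + η) a B, smul_comm x b B', mul_smul,
    mul_smul, ← smul_add, ← smul_add, auxMat_smul, auxMat_smul]
  simp only [smul_mul_assoc, mul_smul_comm, smul_smul, trace_smul]
  rw [mul_comm b a]

theorem laxProd_smul (s η : R) (u : Fin N → R) (l : List (Fin N)) :
    laxProd (s * η) (fun n => s * u n) l = s ^ l.length • laxProd η u l := by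
  induction l with
  | nil => simp [laxProd]
  | cons n l ih =>
    have : lax (siteUnit R n) (s * η) (s * u n) = s • lax (siteUnit R n) η (u n) := by
      simp [lax, smul_smul]
    rw [laxProd_cons, laxProd_cons, ih, this, smul_mul_assoc, mul_smul_comm, smul_smul,
      List.length_cons, pow_succ']

/-- Homogeneity: the unit of the spectral parameter can be changed. -/
theorem chainT_homogeneous (s η : R) (ξ : Fin N → R) (α : R) (B : Matrix (Fin 2) (Fin 2) R) (α' : R)
    (B' : Matrix (Fin 2) (Fin 2) R) (x : R) :
    chainT (s * η) (fun n => s * ξ n) (s * α) B (s * α') B' (s * x) =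
      s ^ (2 * N + 2) • chainT η ξ α B α' B' x := by
  rw [chainT_eq_laxProd, chainT_eq_laxProd]
  simp only [← mul_sub, ← mul_add, laxProd_smul, mul_smul, ← smul_add, auxMat_smul,
    List.length_reverse, List.length_finRange]
  simp only [smul_mul_assoc, mul_smul_comm, smul_smul, trace_smul]
  congr 1
  ring

theorem nodup_smul {n : Type*} [Fintype n] [DecidableEq n] {M : Matrix n n ℂ} {c : ℂ} (hc : c ≠ 0)
    (hM : M.charpoly.roots.Nodup) : (c • M).charpoly.roots.Nodup := by
  simpa using nodup_affine hM 0 hc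

end Scaling

section Generic

variable {N : ℕ}

theorem mapMatrix_fin_two {R S : Type*} [CommRing R] [CommRing S] (f : R →+* S) (a b c d : R) :
    f.mapMatrix !![a, b; c, d] = !![f a, f b; f c, f d] := by
  ext i j
  fin_cases i <;> fin_cases j <;> rfl

/-- Some transfer matrix in a one-parameter family, in which both `A₊²` and `A₋²` are the identity,
has simple spectrum. It is found as a perturbation of the one with nilpotent boundary matrices. -/
theorem exists_simple_involutive {η : ℂ} (hη : η ≠ 0) {ξ : Fin N → ℂ} (hξ : GenericInhom η ξ) :
    ∃ k x, (chainT η ξ 1 !![1, 1; 0, -1] 1 !![1, 0; k, -1] x).charpoly.roots.Nodup := by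
  obtain ⟨x, hx⟩ := exists_simple_nilpotent hη hξ
  have hmap : ∀ ε : ℂ, (Polynomial.evalRingHom ε).mapMatrix
      (chainT (Polynomial.C η) (Polynomial.C ∘ ξ) Polynomial.X
        !![Polynomial.X, 1; 0, -Polynomial.X] Polynomial.X !![Polynomial.X, 0; 1, -Polynomial.X]
        (Polynomial.C x)) = chainT η ξ ε !![ε, 1; 0, -ε] ε !![ε, 0; 1, -ε] x := by
    intro ε
    have hξ : Polynomial.evalRingHom ε ∘ Polynomial.C ∘ ξ = ξ := by
      ext n
      simp
    rw [chainT_map, mapMatrix_fin_two, mapMatrix_fin_two, hξ]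
    simp
  obtain ⟨ε, hε, h⟩ := exists_notMem_nodup (by rw [hmap]; simpa using hx) {0}
  replace hε : ε ≠ 0 := by simpa using hε
  rw [hmap] at h
  refine ⟨1 / ε ^ 2, x, ?_⟩
  have hiso : JointlyIsospectral (chainT η ξ ε !![ε, 1; 0, -ε] ε !![ε, 0; 1, -ε])
      (chainT η ξ (ε * 1) (ε • !![1, 1; 0, -1]) (ε * 1) (ε • !![1, 0; 1 / ε ^ 2, -1])) := by
    rw [mul_one]
    refine chainT_invariants η ξ ε ε ?_ ?_ ?_ ?_ ?_ ?_ ?_ ?_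
    all_goals simp [trace_fin_two, hε]
    field_simp
  rw [hiso.sameSpectrum x, chainT_smul] at h
  have h' := nodup_smul (inv_ne_zero (mul_ne_zero hε hε)) h
  rwa [smul_smul, inv_mul_cancel₀ (mul_ne_zero hε hε), one_smul] at h'

/-- A polynomial in `c`, `u`, `v` divides some nonzero polynomial in `c`, `u²`, `v²`. -/
theorem exists_polynomial_squares {f : MvPolynomial (Fin 3) ℂ} (hf : f ≠ 0) :
    ∃ P : MvPolynomial (Fin 3) ℂ, P ≠ 0 ∧ ∀ c u v : ℂ,
      MvPolynomial.eval ![c, u ^ 2, v ^ 2] P ≠ 0 → MvPolynomial.eval ![c, u, v] f ≠ 0 := by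
  let φ : MvPolynomial (Fin 3) ℂ →ₐ[ℂ] MvPolynomial (Fin 3) ℂ :=
    MvPolynomial.aeval ![MvPolynomial.X 0, MvPolynomial.X 1 ^ 2, MvPolynomial.X 2 ^ 2]
  let _ := φ.toRingHom.toAlgebra
  have hmap : ∀ q, algebraMap (MvPolynomial (Fin 3) ℂ) (MvPolynomial (Fin 3) ℂ) q = φ q :=
    fun q => rfl
  have hX : ∀ i, IsIntegral (MvPolynomial (Fin 3) ℂ) (MvPolynomial.X i : MvPolynomial (Fin 3) ℂ) := by
    intro i
    fin_cases i
    · have : IsIntegral (MvPolynomial (Fin 3) ℂ) (φ (MvPolynomial.X 0)) := isIntegral_algebraMap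
      simpa [φ] using this
    · have : IsIntegral (MvPolynomial (Fin 3) ℂ) (φ (MvPolynomial.X 1)) := isIntegral_algebraMap
      exact IsIntegral.of_pow two_pos (by simpa [φ] using this)
    · have : IsIntegral (MvPolynomial (Fin 3) ℂ) (φ (MvPolynomial.X 2)) := isIntegral_algebraMap
      exact IsIntegral.of_pow two_pos (by simpa [φ] using this)
  have hint : IsIntegral (MvPolynomial (Fin 3) ℂ) f := by
    refine MvPolynomial.induction_on f (fun a => ?_) (fun p q => IsIntegral.add)
      fun p i hp => hp.mul (hX i)
    have : IsIntegral (MvPolynomial (Fin 3) ℂ) (φ (MvPolynomial.C a)) := isIntegral_algebraMap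
    simpa [φ] using this
  have hne := Ideal.comap_ne_bot_of_integral_mem hf (Ideal.mem_span_singleton_self f) hint
  obtain ⟨P, hP, hP0⟩ := Submodule.exists_mem_ne_zero_of_ne_bot hne
  refine ⟨P, hP0, fun c u v h h0 => h ?_⟩
  obtain ⟨g, hg⟩ := Ideal.mem_span_singleton.mp (Ideal.mem_comap.mp hP)
  have h1 : MvPolynomial.eval ![c, u, v] (φ P) = MvPolynomial.eval ![c, u ^ 2, v ^ 2] P := by
    rw [← MvPolynomial.coe_aeval_eq_eval, ← MvPolynomial.coe_aeval_eq_eval]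
    change MvPolynomial.aeval ![c, u, v] (MvPolynomial.aeval _ P) = MvPolynomial.aeval _ P
    rw [MvPolynomial.comp_aeval_apply]
    congr 2
    ext i
    fin_cases i <;> simp
  rw [← h1, ← hmap, hg, map_mul, h0, zero_mul]

end Generic

section Transfer

variable {N : ℕ}

theorem BoundaryParams.slope_trace (p : BoundaryParams) (σ : ℤˣ) : (p.slope σ).trace = 0 := by
  simp [slope, trace_fin_two]

theorem BoundaryParams.slope_mul_slope_trace (p : BoundaryParams) (hp : p.Admissible) (σ : ℤˣ) :
    (p.slope σ * p.slope σ).trace = 2 / p.zetaBarSq σ := by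
  obtain ⟨h1, h2⟩ := hp σ
  have he : Complex.exp (p.τ σ) * Complex.exp (-p.τ σ) = 1 := by
    rw [← Complex.exp_add, add_neg_cancel, Complex.exp_zero]
  simp only [slope, zetaBarSq, trace_fin_two, Matrix.mul_apply, Fin.sum_univ_two,
    Matrix.smul_apply, of_apply, cons_val', cons_val_zero, cons_val_one, smul_eq_mul]
  simp
  field_simp
  linear_combination 8 * p.κ σ ^ 2 * he

theorem BoundaryParams.slope_trace_coupling (p : BoundaryParams) (hp : p.Admissible) :
    (p.slope 1 * p.slope (-1)).trace = 2 * p.coupling := by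
  have h1 := (hp 1).1
  have h2 := (hp (-1)).1
  simp only [slope, coupling, trace_fin_two, Matrix.mul_apply, Fin.sum_univ_two,
    Matrix.smul_apply, of_apply, cons_val', cons_val_zero, cons_val_one, smul_eq_mul,
    Complex.cosh, neg_sub]
  rw [sub_eq_add_neg, sub_eq_add_neg, Complex.exp_add, Complex.exp_add]
  simp
  field_simp
  ring

theorem BoundaryParams.Admissible.zetaBarSq_ne_zero {p : BoundaryParams} (hp : p.Admissible)
    (σ : ℤˣ) : p.zetaBarSq σ ≠ 0 :=
  div_ne_zero (pow_ne_zero 2 (hp σ).1) (hp σ).2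

theorem hasSimpleSpectrum_transfer {η : ℂ} {ξ : Fin N → ℂ} {p : BoundaryParams}
    (hp : p.Admissible) {x : ℂ}
    (h : (chainT η ξ 1 (p.slope 1) 1 (p.slope (-1)) x).charpoly.roots.Nodup) :
    HasSimpleSpectrum (transfer η ξ p) :=
  ⟨x + η / 2, by rwa [transfer_eq η ξ hp, add_sub_cancel_right]⟩

/-- For almost all boundary parameters the spectrum is simple. -/
theorem exists_polynomial_simple {η : ℂ} (hη : η ≠ 0) {ξ : Fin N → ℂ} (hξ : GenericInhom η ξ) :
    ∃ P : MvPolynomial (Fin 3) ℂ, P ≠ 0 ∧ ∀ p : BoundaryParams, p.Admissible →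
      MvPolynomial.eval ![p.coupling, p.zetaBarSq 1, p.zetaBarSq (-1)] P ≠ 0 →
        HasSimpleSpectrum (transfer η ξ p) := by
  obtain ⟨k, x, hx⟩ := exists_simple_involutive hη hξ
  -- the boundary matrices `A₊`, `A₋` with `tr A₊² = 2 / u²`, `tr A₋² = 2 / v²`, `tr A₊ A₋ = 2 c`,
  -- multiplied by `u` and `v`
  let f : MvPolynomial (Fin 3) ℂ := charDisc (chainT (MvPolynomial.C η) (MvPolynomial.C ∘ ξ)
    (MvPolynomial.X 1) !![1, 1; 0, -1] (MvPolynomial.X 2)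
    !![1, 0; 2 * (MvPolynomial.X 0 * MvPolynomial.X 1 * MvPolynomial.X 2) - 2, -1]
    (MvPolynomial.C x) : Matrix (Conf N) (Conf N) (MvPolynomial (Fin 3) ℂ))
  have hf : ∀ c u v : ℂ, MvPolynomial.eval ![c, u, v] f =
      charDisc (chainT η ξ u !![1, 1; 0, -1] v !![1, 0; 2 * (c * u * v) - 2, -1] x) := by
    intro c u v
    have hξ : MvPolynomial.eval ![c, u, v] ∘ MvPolynomial.C ∘ ξ = ξ := by
      ext n
      simp
    rw [← charDisc_map, chainT_map, mapMatrix_fin_two, mapMatrix_fin_two, hξ]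
    simp
  have hf0 : f ≠ 0 := by
    intro h0
    have h := hf (k / 2 + 1) 1 1
    rw [h0, map_zero, eq_comm] at h
    refine (charDisc_ne_zero_iff _).mpr hx ?_
    rw [← h]
    congr 6
    ring
  obtain ⟨P, hP0, hP⟩ := exists_polynomial_squares hf0
  refine ⟨P, hP0, fun p hp h => ?_⟩
  set u := p.zetaBar 1 1 with hu
  set v := p.zetaBar 1 (-1) with hv
  have hu2 : u ^ 2 = p.zetaBarSq 1 := p.zetaBar_sq 1 1
  have hv2 : v ^ 2 = p.zetaBarSq (-1) := p.zetaBar_sq 1 (-1)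
  have hu0 : u ≠ 0 := fun h0 => hp.zetaBarSq_ne_zero 1 (by rw [← hu2, h0]; ring)
  have hv0 : v ≠ 0 := fun h0 => hp.zetaBarSq_ne_zero (-1) (by rw [← hv2, h0]; ring)
  rw [← hu2, ← hv2] at h
  replace h := hP _ _ _ h
  rw [hf, charDisc_ne_zero_iff] at h
  replace h := nodup_smul (mul_ne_zero (inv_ne_zero hu0) (inv_ne_zero hv0)) h
  rw [← chainT_smul, inv_mul_cancel₀ hu0, inv_mul_cancel₀ hv0] at h
  refine hasSimpleSpectrum_transfer hp (x := x) ?_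
  have h0 : (p.slope 1 * p.slope 1).trace ≠ 0 := by
    rw [p.slope_mul_slope_trace hp]
    exact div_ne_zero two_ne_zero (hp.zetaBarSq_ne_zero 1)
  rwa [(chainT_invariants η ξ 1 1 (p.slope_trace 1) (p.slope_trace (-1)) ?_ ?_ h0
    ?_ ?_ ?_).sameSpectrum x]
  · simp [trace_fin_two]
  · simp [trace_fin_two]
  · rw [p.slope_mul_slope_trace hp, ← hu2]
    simp [trace_fin_two]
    field_simp
    norm_num
  · rw [p.slope_mul_slope_trace hp, ← hv2]
    simp [trace_fin_two]
    field_simp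
    norm_num
  · rw [p.slope_trace_coupling hp]
    simp [trace_fin_two]
    field_simp
    ring

/-! ### Isospectral transfer matrices -/

theorem transfer_comm (η : ℂ) (ξ : Fin N → ℂ) {p : BoundaryParams} (hp : p.Admissible) (z w : ℂ) :
    transfer η ξ p z * transfer η ξ p w = transfer η ξ p w * transfer η ξ p z := by
  rw [transfer_eq η ξ hp, transfer_eq η ξ hp]
  exact chainT_comm η ξ 1 1 (p.slope_trace 1) (p.slope_trace (-1)) _ _

/-- Both sets of boundary parameters have the same invariants, up to an exchange of the boundaries
if `ε = -1`. -/
theorem jointlyIsospectral_transfer {η : ℂ} {ξ : Fin N → ℂ} (hξ : GenericInhom η ξ)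
    {p₁ p₂ : BoundaryParams} (h₁ : p₁.Admissible) (h₂ : p₂.Admissible)
    (hc : p₁.coupling = p₂.coupling) {ε : ℤˣ}
    (hε : ∀ σ : ℤˣ, p₁.zetaBarSq σ = p₂.zetaBarSq (σ * ε)) :
    JointlyIsospectral (transfer η ξ p₁) (transfer η ξ p₂) := by
  suffices h : JointlyIsospectral (chainT η ξ 1 (p₁.slope 1) 1 (p₁.slope (-1)))
      (chainT η ξ 1 (p₂.slope 1) 1 (p₂.slope (-1))) by
    intro z w μ
    simp only [transfer_eq η ξ h₁, transfer_eq η ξ h₂]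
    exact h _ _ μ
  have h0 : (p₁.slope 1 * p₁.slope 1).trace ≠ 0 := by
    rw [p₁.slope_mul_slope_trace h₁]
    exact div_ne_zero two_ne_zero (h₁.zetaBarSq_ne_zero 1)
  rcases Int.units_eq_one_or ε with rfl | rfl
  · refine chainT_invariants η ξ 1 1 (p₁.slope_trace _) (p₁.slope_trace _) (p₂.slope_trace _)
      (p₂.slope_trace _) h0 ?_ ?_ ?_
    · rw [p₁.slope_mul_slope_trace h₁, p₂.slope_mul_slope_trace h₂, hε, mul_one]
    · rw [p₁.slope_mul_slope_trace h₁, p₂.slope_mul_slope_trace h₂, hε, mul_one]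
    · rw [p₁.slope_trace_coupling h₁, p₂.slope_trace_coupling h₂, hc]
  · have hne : ∀ m n, m ≠ n → η ^ 2 - (ξ m - ξ n) ^ 2 ≠ 0 := by
      intro m n hmn h
      have := (hξ.2 m n hmn).2
      simp only [Set.mem_insert_iff, Set.mem_singleton_iff, not_or] at this
      rw [sq_sub_sq, mul_eq_zero] at h
      rcases h with h | h
      · exact this.2.1 (by linear_combination h)
      · exact this.2.2 (by linear_combination -h)
    refine JointlyIsospectral.trans ?_
      (chainT_swap hne 1 1 (p₂.slope_trace 1) (p₂.slope_trace (-1))).symm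
    refine chainT_invariants η ξ 1 1 (p₁.slope_trace _) (p₁.slope_trace _)
      (by rw [trace_transpose, p₂.slope_trace]) (by rw [trace_transpose, p₂.slope_trace]) h0 ?_ ?_ ?_
    · rw [← transpose_mul, trace_transpose, p₁.slope_mul_slope_trace h₁,
        p₂.slope_mul_slope_trace h₂, hε, one_mul]
    · rw [← transpose_mul, trace_transpose, p₁.slope_mul_slope_trace h₁,
        p₂.slope_mul_slope_trace h₂, hε, neg_mul_neg, one_mul]
    · rw [← transpose_mul, trace_transpose, p₁.slope_trace_coupling h₁,
        p₂.slope_trace_coupling h₂, hc]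

theorem BoundaryParams.root_sq (p : BoundaryParams) (σ : ℤˣ) :
    p.root σ ^ 2 = 1 + 4 * p.κ σ ^ 2 := by
  unfold root
  rw [← Complex.cpow_nat_mul]
  norm_num

theorem BoundaryParams.Admissible.root_ne_zero {p : BoundaryParams} (hp : p.Admissible) (σ : ℤˣ) :
    p.root σ ≠ 0 := fun h => (hp σ).2 (by rw [← p.root_sq, h]; ring)

theorem BoundaryParams.Admissible.zetaBar_ne_zero {p : BoundaryParams} (hp : p.Admissible)
    (ε : ℤˣ → ℤˣ) (σ : ℤˣ) : p.zetaBar ε σ ≠ 0 :=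
  fun h => hp.zetaBarSq_ne_zero σ (by rw [← p.zetaBar_sq ε, h]; ring)

theorem BoundaryParams.Admissible.diagonal {p : BoundaryParams} (hp : p.Admissible)
    (ε : ℤˣ → ℤˣ) : (p.diagonal ε).Admissible :=
  fun σ => ⟨hp.zetaBar_ne_zero ε σ, by simp [BoundaryParams.diagonal]⟩

theorem BoundaryParams.diagonal_zetaBarSq (p : BoundaryParams) (ε : ℤˣ → ℤˣ) (σ : ℤˣ) :
    (p.diagonal ε).zetaBarSq σ = p.zetaBarSq σ := by
  rw [← p.zetaBar_sq ε]
  simp [zetaBarSq, diagonal]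

/-- On the locus `ω = 0` the coupling is `1 / (ζ̄₊ ζ̄₋)`, as for diagonal boundary matrices. -/
theorem BoundaryParams.coupling_eq_diagonal {p : BoundaryParams} (hp : p.Admissible)
    (ε : ℤˣ → ℤˣ) (h : p.omega (ε 1 * ε (-1)) = 0) :
    p.coupling = (p.diagonal ε).coupling := by
  have hr1 := hp.root_ne_zero 1
  have hr2 := hp.root_ne_zero (-1)
  have hz1 := (hp 1).1
  have hz2 := (hp (-1)).1
  have hs : ∀ σ, ((ε σ : ℤ) : ℂ) ^ 2 = 1 := fun σ => by
    rcases Int.units_eq_one_or (ε σ) with h | h <;> simp [h]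
  have hs0 : ∀ σ, ((ε σ : ℤ) : ℂ) ≠ 0 := fun σ h => by simpa [h] using hs σ
  have h1 := hs0 1
  have h2 := hs0 (-1)
  have e1 := hs 1
  have e2 := hs (-1)
  rw [omega, sub_eq_zero, Units.val_mul, Int.cast_mul] at h
  rw [coupling, h]
  simp only [coupling, diagonal, zetaBar, mul_zero, zero_mul, add_zero]
  field_simp
  rw [e1, e2]
  norm_num

theorem jointlyIsospectral_diagonal {η : ℂ} {ξ : Fin N → ℂ} (hξ : GenericInhom η ξ)
    {p : BoundaryParams} (hp : p.Admissible) {ε : ℤˣ → ℤˣ} (h : p.omega (ε 1 * ε (-1)) = 0) :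
    JointlyIsospectral (transfer η ξ p) (transfer η ξ (p.diagonal ε)) :=
  jointlyIsospectral_transfer hξ hp (hp.diagonal ε) (p.coupling_eq_diagonal hp ε h) (ε := 1)
    fun σ => by rw [mul_one, p.diagonal_zetaBarSq]

end Transfer

/-! ### Simplicity of the spectrum for diagonal boundary matrices -/

section Diagonal

variable {N : ℕ}

/-- Expansion of a product of Lax operators in `η`: off-diagonal corrections to the diagonal entry
are of second order. -/
theorem laxProd_expansion {R : Type*} [CommRing R] (η : R) (u : Fin N → R) (l : List (Fin N)) :
    ∃ V V' : Matrix (Conf N) (Conf N) R,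
      laxProd η u l 0 0 = (diagonal fun s =>
        (l.map fun n => u n + if s n = 0 then η else 0).prod) + η ^ 2 • V ∧
      laxProd η u l 1 0 = η • V' := by
  induction l with
  | nil =>
    refine ⟨0, 0, ?_, ?_⟩
    · simp [laxProd]
    · simp [laxProd]
  | cons n l ih =>
    obtain ⟨V, V', h, h'⟩ := ih
    refine ⟨(diagonal fun s => u n + if s n = 0 then η else 0) * V + siteUnit R n 1 0 * V',
      siteUnit R n 0 1 * laxProd η u l 0 0 +
        (diagonal fun s => u n + if s n = 1 then η else 0) * V', ?_, ?_⟩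
    · rw [laxProd_cons, Matrix.mul_apply, Fin.sum_univ_two, lax_self, lax_ne _ _ _ zero_ne_one, h,
        h', mul_add, diagonal_mul_diagonal, smul_add, mul_smul_comm, smul_mul_smul_comm, ← sq,
        add_assoc]
      rfl
    · rw [laxProd_cons, Matrix.mul_apply, Fin.sum_univ_two, lax_self, lax_ne _ _ _ one_ne_zero, h',
        mul_smul_comm, smul_mul_assoc, smul_add]

theorem exists_prod_one_add_mul {R ι : Type*} [CommRing R] (t : R) (f : ι → R) (s : Finset ι) :
    ∃ r, ∏ i ∈ s, (1 + t * f i) = 1 + t * (∑ i ∈ s, f i + t * r) := by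
  classical
  induction s using Finset.induction_on with
  | empty => exact ⟨0, by simp⟩
  | insert a s ha ih =>
    obtain ⟨r, hr⟩ := ih
    refine ⟨r + f a * (∑ i ∈ s, f i + t * r), ?_⟩
    rw [Finset.prod_insert ha, Finset.sum_insert ha, hr]
    ring

/-- The subsets of `Fin N` are separated by the sums of powers of `2` which they index. -/
theorem binary_injective (N : ℕ) {a : ℂ} (ha : a ≠ 0) :
    Function.Injective fun s : Conf N => a * ∑ n : Fin N, if s n = 0 then (2 : ℂ) ^ (n : ℕ) else 0 := by
  intro s t h
  have h1 : ∀ s : Conf N, (∑ n : Fin N, if s n = 0 then (2 : ℂ) ^ (n : ℕ) else 0) =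
      ((∑ k ∈ ((Finset.univ : Finset (Fin N)).filter fun n => s n = 0).map Fin.valEmbedding, 2 ^ k : ℕ) : ℂ) := by
    intro s
    rw [Finset.sum_map, Finset.sum_filter]
    push_cast
    simp
  have h2 := mul_left_cancel₀ ha h
  rw [h1, h1, Nat.cast_inj] at h2
  have h3 := Finset.map_injective _ (Finset.geomSum_injective le_rfl h2)
  funext n
  have h4 : s n = 0 ↔ t n = 0 := by simpa using Finset.ext_iff.mp h3 n
  have fin2 : ∀ a : Fin 2, a = 0 ∨ a = 1 := by decide
  rcases fin2 (s n) with h | h <;> rcases fin2 (t n) with h' | h' <;> simp_all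

/-- Some transfer matrix with diagonal boundary matrices has simple spectrum. It is found for small
`η`, at a point where both boundary matrices are proportional to the same projector, to first order
of perturbation theory. -/
theorem exists_simple_diagonal (N : ℕ) : ∃ (η : ℂ) (ξ : Fin N → ℂ) (α α' x : ℂ), η ≠ 0 ∧
    (chainT η ξ α !![1, 0; 0, -1] α' !![1, 0; 0, -1] x).charpoly.roots.Nodup := by
  have hex : ∀ n : Fin N, ∃ z : ℂ, z ^ 2 = 1 - (2 ^ (n : ℕ))⁻¹ := fun n =>
    IsAlgClosed.exists_pow_nat_eq _ two_pos
  choose ξ hξ using hex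
  have hw : ∀ n : Fin N, (2 ^ (n : ℕ) : ℂ) * (1 - ξ n ^ 2) = 1 := fun n => by
    rw [hξ]
    simp
  set c : ℂ := ∏ n, (1 - ξ n ^ 2) with hc
  have hc0 : c ≠ 0 := Finset.prod_ne_zero_iff.mpr fun n _ h => by simpa [h] using hw n
  let T : Matrix (Conf N) (Conf N) (Polynomial ℂ) := chainT Polynomial.X (Polynomial.C ∘ ξ)
    (1 + Polynomial.X) !![1, 0; 0, -1] 1 !![1, 0; 0, -1] 1
  -- the spectrum is degenerate at `η = 0`; the degeneracy is lifted by the linear term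
  obtain ⟨M, hM, hM0⟩ : ∃ M : Matrix (Conf N) (Conf N) (Polynomial ℂ),
      T = (4 * (1 + Polynomial.X : Polynomial ℂ)) •
        (Polynomial.C c • 1 + (Polynomial.X : Polynomial ℂ) • M) ∧
      (Polynomial.evalRingHom 0).mapMatrix M =
        diagonal fun s => 2 * c * ∑ n : Fin N, if s n = 0 then (2 : ℂ) ^ (n : ℕ) else 0 := by
    obtain ⟨V, -, hV, -⟩ := laxProd_expansion (Polynomial.X : Polynomial ℂ)
      (fun n => 1 - Polynomial.C (ξ n)) (List.finRange N).reverse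
    obtain ⟨W, -, hW, -⟩ := laxProd_expansion (Polynomial.X : Polynomial ℂ)
      (fun n => 1 + Polynomial.C (ξ n)) (List.finRange N).reverse.reverse
    let f : Conf N → Fin N → Polynomial ℂ := fun s n =>
      if s n = 0 then Polynomial.C (2 ^ (n : ℕ)) * (2 + Polynomial.X) else 0
    choose r hr using fun s => exists_prod_one_add_mul (Polynomial.X : Polynomial ℂ) (f s)
      Finset.univ
    let D₁ : Conf N → Polynomial ℂ := fun s =>
      ∏ n, (1 - Polynomial.C (ξ n) + if s n = 0 then Polynomial.X else 0)
    let D₂ : Conf N → Polynomial ℂ := fun s =>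
      ∏ n, (1 + Polynomial.C (ξ n) + if s n = 0 then Polynomial.X else 0)
    have hD : ∀ s, D₁ s * D₂ s = Polynomial.C c +
        Polynomial.X * (Polynomial.C c * (∑ n, f s n + Polynomial.X * r s)) := by
      intro s
      have h1 : ∀ n, (1 - Polynomial.C (ξ n) + if s n = 0 then Polynomial.X else 0) *
          (1 + Polynomial.C (ξ n) + if s n = 0 then Polynomial.X else 0) =
          Polynomial.C (1 - ξ n ^ 2) * (1 + Polynomial.X * f s n) := by
        intro n
        have hCw : Polynomial.C (2 ^ (n : ℕ) : ℂ) * (1 - Polynomial.C (ξ n) ^ 2) = 1 := by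
          rw [← Polynomial.C_pow, ← Polynomial.C_1, ← Polynomial.C_sub, ← Polynomial.C_mul, hw]
        simp only [f, Polynomial.C_sub, Polynomial.C_1, Polynomial.C_pow] at hCw ⊢
        split_ifs
        · linear_combination -(Polynomial.X * (2 + Polynomial.X)) * hCw
        · ring
      simp only [D₁, D₂]
      rw [← Finset.prod_mul_distrib, Finset.prod_congr rfl fun n _ => h1 n,
        Finset.prod_mul_distrib, hr, ← map_prod, ← hc]
      ring
    have hT : T = (4 * (1 + Polynomial.X : Polynomial ℂ)) •
        (laxProd Polynomial.X (fun n => 1 - Polynomial.C (ξ n)) (List.finRange N).reverse 0 0 *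
          laxProd Polynomial.X (fun n => 1 + Polynomial.C (ξ n))
            (List.finRange N).reverse.reverse 0 0) := by
      have e1 : ((1 + Polynomial.X : Polynomial ℂ) • 1 + (1 + Polynomial.X : Polynomial ℂ) •
          !![1, 0; 0, -1] : Matrix (Fin 2) (Fin 2) (Polynomial ℂ)) =
          !![2 * (1 + Polynomial.X), 0; 0, 0] := by
        ext1 i j
        fin_cases i <;> fin_cases j <;> simp
        ring
      have e2 : ((1 : Polynomial ℂ) • 1 + (1 : Polynomial ℂ) • !![1, 0; 0, -1] :
          Matrix (Fin 2) (Fin 2) (Polynomial ℂ)) = !![2, 0; 0, 0] := by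
        ext1 i j
        fin_cases i <;> fin_cases j <;> simp
        ring
      simp only [T]
      rw [chainT_eq_laxProd, e1, e2]
      simp only [trace_fin_two, Matrix.mul_apply, Fin.sum_univ_two, auxMat, map_apply, of_apply,
        cons_val', cons_val_zero, cons_val_one, empty_val', cons_val_fin_one, zero_smul, mul_zero,
        zero_mul, add_zero, Algebra.algebraMap_eq_smul_one, smul_mul_assoc, mul_smul_comm, one_mul,
        mul_one, smul_smul, Function.comp_apply]
      congr 1
      ring
    rw [List.reverse_reverse] at hW
    simp only [List.reverse_reverse] at hT
    rw [hV, hW] at hT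
    refine ⟨(diagonal fun s => Polynomial.C c * (∑ n, f s n + Polynomial.X * r s)) +
      (Polynomial.X : Polynomial ℂ) • (diagonal D₁ * W + V * diagonal D₂ +
        (Polynomial.X ^ 2 : Polynomial ℂ) • (V * W)), ?_, ?_⟩
    · rw [hT]
      congr 1
      have e1 : (diagonal fun s : Conf N => ((List.finRange N).reverse.map fun n =>
          1 - Polynomial.C (ξ n) + if s n = 0 then Polynomial.X else 0).prod) = diagonal D₁ := by
        simp only [prod_sites, D₁]
      have e2 : (diagonal fun s : Conf N => ((List.finRange N).map fun n =>
          1 + Polynomial.C (ξ n) + if s n = 0 then Polynomial.X else 0).prod) = diagonal D₂ := by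
        simp only [← Fin.prod_univ_def, D₂]
      have e3 : (diagonal fun s : Conf N => Polynomial.X *
          (Polynomial.C c * (∑ n, f s n + Polynomial.X * r s))) = (Polynomial.X : Polynomial ℂ) •
          diagonal fun s => Polynomial.C c * (∑ n, f s n + Polynomial.X * r s) := by
        rw [← diagonal_smul]
        rfl
      rw [e1, e2, add_mul, mul_add, mul_add, diagonal_mul_diagonal, funext hD, ← diagonal_add,
        smul_one_eq_diagonal, e3]
      simp only [mul_smul_comm, smul_mul_assoc]
      module
    · ext1 s t
      by_cases hst : s = t
      · subst hst
        have : ∀ n, Polynomial.eval 0 (f s n) = 2 * if s n = 0 then (2 : ℂ) ^ (n : ℕ) else 0 := by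
          intro n
          simp only [f]
          split_ifs <;> simp [mul_comm]
        have hsum : ∑ n, Polynomial.eval 0 (f s n) =
            2 * ∑ n : Fin N, if s n = 0 then (2 : ℂ) ^ (n : ℕ) else 0 := by
          rw [Finset.mul_sum, Finset.sum_congr rfl fun n _ => this n]
        simp only [RingHom.mapMatrix_apply, map_apply, Matrix.add_apply, Matrix.smul_apply,
          diagonal_apply_eq, smul_eq_mul, Polynomial.coe_evalRingHom, Polynomial.eval_add,
          Polynomial.eval_mul, Polynomial.eval_X, Polynomial.eval_C, Polynomial.eval_finsetSum,
          hsum]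
        ring
      · simp [hst]
  have hmap : ∀ ε : ℂ, (Polynomial.evalRingHom ε).mapMatrix T =
      chainT ε ξ (1 + ε) !![1, 0; 0, -1] 1 !![1, 0; 0, -1] 1 := by
    intro ε
    have hξ : Polynomial.evalRingHom ε ∘ Polynomial.C ∘ ξ = ξ := by
      ext n
      simp
    rw [chainT_map, mapMatrix_fin_two, hξ]
    simp
  obtain ⟨ε, hε, h⟩ := exists_notMem_nodup (M := M) (by
    rw [hM0, charpoly_diagonal]
    exact nodup_roots_prod (binary_injective N (mul_ne_zero two_ne_zero hc0))) {0, -1}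
  simp only [Finset.mem_insert, Finset.mem_singleton, not_or] at hε
  refine ⟨ε, ξ, 1 + ε, 1, 1, hε.1, ?_⟩
  have hsmul : ∀ (a : Polynomial ℂ) (X : Matrix (Conf N) (Conf N) (Polynomial ℂ)),
      (Polynomial.evalRingHom ε).mapMatrix (a • X) =
        a.eval ε • (Polynomial.evalRingHom ε).mapMatrix X := by
    intro a X
    ext i j
    simp
  rw [← hmap, hM, hsmul, map_add, hsmul, hsmul, map_one]
  have h1 : Polynomial.eval ε (4 * (1 + Polynomial.X)) ≠ 0 := by
    simp only [Polynomial.eval_mul, Polynomial.eval_add, Polynomial.eval_one, Polynomial.eval_X,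
      Polynomial.eval_ofNat]
    exact mul_ne_zero (by norm_num) fun h => hε.2 (by linear_combination h)
  exact nodup_smul h1 (nodup_affine h _ (by simpa using hε.1))

/-- With diagonal boundary matrices the spectrum is simple for almost all inhomogeneities and
boundary parameters. -/
theorem exists_polynomial_simple_diagonal (N : ℕ) {η : ℂ} (hη : η ≠ 0) :
    ∃ Q : MvPolynomial (Fin N ⊕ ℤˣ) ℂ, Q ≠ 0 ∧ ∃ x, ∀ (ξ : Fin N → ℂ) (a : ℤˣ → ℂ),
      MvPolynomial.eval (Sum.elim ξ a) Q ≠ 0 →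
        (chainT η ξ (a 1) !![1, 0; 0, -1] (a (-1)) !![1, 0; 0, -1] x).charpoly.roots.Nodup := by
  obtain ⟨ε, ξ₀, α, α', x, hε, h⟩ := exists_simple_diagonal N
  replace h := nodup_smul (pow_ne_zero (2 * N + 2) (div_ne_zero hη hε)) h
  rw [← chainT_homogeneous, div_mul_cancel₀ η hε] at h
  set s := η / ε
  let Q : MvPolynomial (Fin N ⊕ ℤˣ) ℂ := charDisc (chainT (MvPolynomial.C η)
    (fun n => MvPolynomial.X (Sum.inl n)) (MvPolynomial.X (Sum.inr 1)) !![1, 0; 0, -1]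
    (MvPolynomial.X (Sum.inr (-1))) !![1, 0; 0, -1] (MvPolynomial.C (s * x)) :
      Matrix (Conf N) (Conf N) (MvPolynomial (Fin N ⊕ ℤˣ) ℂ))
  have hQ : ∀ (ξ : Fin N → ℂ) (a : ℤˣ → ℂ), MvPolynomial.eval (Sum.elim ξ a) Q =
      charDisc (chainT η ξ (a 1) !![1, 0; 0, -1] (a (-1)) !![1, 0; 0, -1] (s * x)) := by
    intro ξ a
    have hξ : (MvPolynomial.eval (Sum.elim ξ a) ∘ fun n => MvPolynomial.X (Sum.inl n)) = ξ := by
      ext n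
      simp
    rw [← charDisc_map, chainT_map, mapMatrix_fin_two, hξ]
    simp
  refine ⟨Q, fun h0 => ?_, s * x, fun ξ a hne => ?_⟩
  · have h1 := hQ (fun n => s * ξ₀ n) fun σ => if σ = 1 then s * α else s * α'
    rw [h0, map_zero, if_pos rfl, if_neg (by decide)] at h1
    exact (charDisc_ne_zero_iff _).mpr h h1.symm
  · rwa [hQ, charDisc_ne_zero_iff] at hne

theorem BoundaryParams.diagonal_slope (p : BoundaryParams) (ε : ℤˣ → ℤˣ) (σ : ℤˣ) :
    (p.diagonal ε).slope σ = (p.zetaBar ε σ)⁻¹ • !![1, 0; 0, -1] := by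
  simp [slope, diagonal]

/-- On the locus `ω = 0` the spectrum is simple for almost all parameters. -/
theorem exists_polynomial_simple_of_omega (N : ℕ) {η : ℂ} (hη : η ≠ 0) :
    ∃ Q : MvPolynomial (Fin N ⊕ ℤˣ) ℂ, Q ≠ 0 ∧ ∀ ξ : Fin N → ℂ, GenericInhom η ξ →
      ∀ p : BoundaryParams, p.Admissible → ∀ ε : ℤˣ → ℤˣ, p.omega (ε 1 * ε (-1)) = 0 →
        MvPolynomial.eval (Sum.elim ξ (p.zetaBar ε)) Q ≠ 0 →
          HasSimpleSpectrum (transfer η ξ p) := by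
  obtain ⟨Q, hQ0, x, hQ⟩ := exists_polynomial_simple_diagonal N hη
  refine ⟨Q, hQ0, fun ξ hξ p hp ε hω hne => ?_⟩
  have h1 := hp.zetaBar_ne_zero ε 1
  have h2 := hp.zetaBar_ne_zero ε (-1)
  have h := nodup_smul (mul_ne_zero (inv_ne_zero h1) (inv_ne_zero h2)) (hQ ξ _ hne)
  rw [← chainT_smul, inv_mul_cancel₀ h1, inv_mul_cancel₀ h2, ← p.diagonal_slope,
    ← p.diagonal_slope] at h
  obtain ⟨z, hz⟩ := hasSimpleSpectrum_transfer (hp.diagonal ε) h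
  exact ⟨z, by rwa [(jointlyIsospectral_diagonal hξ hp hω).sameSpectrum z]⟩

end Diagonal

end OpenXXX

theorem mainTheorem5 (N : ℕ) (η : ℂ) (hη : η ≠ 0) :
    (∀ ξ : Fin N → ℂ, OpenXXX.GenericInhom η ξ →
      -- for almost any boundary parameters the spectrum is simple
      (∃ P : MvPolynomial (Fin 3) ℂ, P ≠ 0 ∧
        ∀ p : OpenXXX.BoundaryParams, p.Admissible →
          MvPolynomial.eval ![p.coupling, p.zetaBarSq 1, p.zetaBarSq (-1)] P ≠ 0 →
            OpenXXX.HasSimpleSpectrum (OpenXXX.transfer η ξ p)) ∧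
      -- isospectrality of two sets of boundary parameters
      (∀ p₁ p₂ : OpenXXX.BoundaryParams, p₁.Admissible → p₂.Admissible →
        p₁.coupling = p₂.coupling →
        ∀ ε : ℤˣ, (∀ σ : ℤˣ, p₁.zetaBarSq σ = p₂.zetaBarSq (σ * ε)) →
          OpenXXX.SameSpectrum (OpenXXX.transfer η ξ p₁) (OpenXXX.transfer η ξ p₂) ∧
          (OpenXXX.HasSimpleSpectrum (OpenXXX.transfer η ξ p₁) →
            OpenXXX.SimilarFamilies (OpenXXX.transfer η ξ p₁) (OpenXXX.transfer η ξ p₂))) ∧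
      -- isospectrality with diagonal boundary parameters
      (∀ p : OpenXXX.BoundaryParams, p.Admissible →
        ∀ ε : ℤˣ → ℤˣ, p.omega (ε 1 * ε (-1)) = 0 →
          OpenXXX.SameSpectrum (OpenXXX.transfer η ξ p)
            (OpenXXX.transfer η ξ (p.diagonal ε)) ∧
          (OpenXXX.HasSimpleSpectrum (OpenXXX.transfer η ξ p) →
            OpenXXX.SimilarFamilies (OpenXXX.transfer η ξ p)
              (OpenXXX.transfer η ξ (p.diagonal ε))))) ∧
    -- on the locus `ω = 0` the spectrum is still simple for almost any choice
    (∃ Q : MvPolynomial (Fin N ⊕ ℤˣ) ℂ, Q ≠ 0 ∧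
      ∀ ξ : Fin N → ℂ, OpenXXX.GenericInhom η ξ →
        ∀ p : OpenXXX.BoundaryParams, p.Admissible →
          ∀ ε : ℤˣ → ℤˣ, p.omega (ε 1 * ε (-1)) = 0 →
            MvPolynomial.eval (Sum.elim ξ (p.zetaBar ε)) Q ≠ 0 →
              OpenXXX.HasSimpleSpectrum (OpenXXX.transfer η ξ p)) := by
  refine ⟨fun ξ hξ => ⟨OpenXXX.exists_polynomial_simple hη hξ, fun p₁ p₂ h₁ h₂ hc ε hε => ?_,
    fun p hp ε hω => ?_⟩, OpenXXX.exists_polynomial_simple_of_omega N hη⟩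
  · have h := OpenXXX.jointlyIsospectral_transfer hξ h₁ h₂ hc hε
    exact ⟨h.sameSpectrum, h.similar (OpenXXX.transfer_comm η ξ h₁) (OpenXXX.transfer_comm η ξ h₂)⟩
  · have h := OpenXXX.jointlyIsospectral_diagonal hξ hp hω
    exact ⟨h.sameSpectrum,
      h.similar (OpenXXX.transfer_comm η ξ hp) (OpenXXX.transfer_comm η ξ (hp.diagonal ε))⟩
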